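/- **Theorem.** Let $a<b$ and let $X=\{X(t):t\in[a,b]\}$ be a (jointly measurable) real stochastic process with mean function $\mu(t)=\mathbb E X(t)$ and covariance function $R(s,t)=\operatorname{cov}(X(s),X(t))$. Let $X_1,X_2,\dots$ be independent realizations of $X$, let $T_{ij}$ ($i,j\ge1$) be random points of $[a,b]$ with common density $f_T$, and let $U_{ij}$ ($i,j\ge1$) be identically distributed errors with mean zero and finite variance; all the $X_i$, $T_{ij}$, $U_{ij}$ are mutually independent. For each $n$ let $m_i=m_{in}\ge2$ ($1\le i\le n$) be integers, $N_i=m_i(m_i-1)$, and suppose that $$Y_{ij}=X_i(T_{ij})+U_{ij},\qquad 1\le i\le n,\ 1\le j\le m_i,$$ is observed. Let $h_\mu=h_{\mu,n}>0$ and $h_R=h_{R,n}>0$ be bandwidths, $K$ a kernel, and $K_h(u)=h^{-1}K(u/h)$. Let $\hat\mu(t)=\hat a_0$, where $(\hat a_0,\hat a_1)$ minimizes over $(a_0,a_1)\in\mathbb R^2$ $$\frac1n\sum_{i=1}^n\frac1{m_i}\sum_{j=1}^{m_i}\{Y_{ij}-a_0-a_1(T_{ij}-t)\}^2K_{h_\mu}(T_{ij}-t),$$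 and let $\hat C(s,t)=\hat a_0$, where $(\hat a_0,\hat a_1,\hat a_2)$ minimizes over $(a_0,a_1,a_2)\in\mathbb R^3$ $$\frac1n\sum_{i=1}^n\frac1{N_i}\sum_{1\le j\ne k\le m_i}\{Y_{ij}Y_{ik}-a_0-a_1(T_{ij}-s)-a_2(T_{ik}-t)\}^2K_{h_R}(T_{ij}-s)K_{h_R}(T_{ik}-t)$$ (with some choice of a minimizer where it is not unique). Put $\hat R(s,t)=\hat C(s,t)-\hat\mu(s)\hat\mu(t)$. For $k=1,2$ let $$\gamma_{nk}=\Bigl(\frac1n\sum_{i=1}^nm_i^{-k}\Bigr)^{-1},$$ and let $$\delta_{n1}(h)=\Bigl[\Bigl\{1+\frac1{h\gamma_{n1}}\Bigr\}\frac{\log n}n\Bigr]^{1/2},\qquad \delta_{n2}(h)=\Bigl[\Bigl\{1+\frac1{h\gamma_{n1}}+\frac1{h^2\gamma_{n2}}\Bigr\}\frac{\log n}n\Bigr]^{1/2}.$$ Assume: - (C1) there are constants $0<m_T\le M_T<\infty$ with $m_T\le f_T(t)\le M_T$ for all $t\in[a,b]$, and $f_T$ is differentiable on $[a,b]$ with a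 bounded derivative; - (C2) $K$ is a symmetric probability density function on $[-1,1]$ (and vanishes outside it), of bounded variation on $[-1,1]$; - (C3) $\mu$ is twice differentiable on $[a,b]$ with a bounded second derivative; - (C4) all second-order partial derivatives of $R$ exist and are bounded on $[a,b]^2$; - (C5) for some $\lambda_\mu\in(2,\infty)$, $\mathbb E|U_{ij}|^{\lambda_\mu}<\infty$ and $\mathbb E\sup_{t\in[a,b]}|X(t)|^{\lambda_\mu}<\infty$; moreover $h_\mu\to0$ and $(h_\mu^2+h_\mu/\gamma_{n1})^{-1}(\log n/n)^{1-2/\lambda_\mu}\to0$ as $n\to\infty$; - (C6) for some $\lambda_R\in(2,\infty)$, $\mathbb E|U_{ij}|^{2\lambda_R}<\infty$ and $\mathbb E\sup_{t\in[a,b]}|X(t)|^{2\lambda_R}<\infty$; moreover $h_R\to0$ and $(h_R^4+h_R^3/\gamma_{n1}+h_R^2/\gamma_{n2})^{-1}(\log n/n)^{1-2/\lambda_R}\to0$ as $n\to\infty$. Then, almost surely, $$\sup_{s,t\in[a,b]}|\hat R(s,t)-R(s,t)|=O\bigl(h_\mu^2+\delta_{n1}(h_\mu)+h_R^2+\delta_{n2}(h_R)\bigr)\qquad(n\to\infty).$$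 -/

import Mathlib

open Real Set Filter Topology MeasureTheory ProbabilityTheory
open scoped ENNReal

noncomputable section

namespace FunctionalData

/-! ### Local-linear estimators

The data of one sample size `n` are the numbers `m i` of observations on the curves `i < n`, the
design points `T i j` and the responses `Y i j`, for `j < m i` (indices start at `0`). -/

/-- The rescaled kernel `K_h(u) = (1/h) K(u/h)`. -/
def scaledKernel (K : ℝ → ℝ) (h u : ℝ) : ℝ := (1 / h) * K (u / h)

/-- The weighted least squares criterion of the local-linear mean smoother at `t`. -/
def meanCriterion (K : ℝ → ℝ) (h : ℝ) (n : ℕ) (m : ℕ → ℕ) (T Y : ℕ → ℕ → ℝ) (t a₀ a₁ : ℝ) : ℝ :=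
  (1 / (n : ℝ)) * ∑ i ∈ Finset.range n, (1 / (m i : ℝ)) * ∑ j ∈ Finset.range (m i),
    (Y i j - a₀ - a₁ * (T i j - t)) ^ 2 * scaledKernel K h (T i j - t)

/-- The local-linear mean estimator at `t`: the first coordinate of a minimizer of the criterion.
A minimizer always exists for a nonnegative kernel; if it is not unique, one value is chosen. -/
def meanEstimator (K : ℝ → ℝ) (h : ℝ) (n : ℕ) (m : ℕ → ℕ) (T Y : ℕ → ℕ → ℝ) (t : ℝ) : ℝ :=
  Classical.epsilon fun a₀ : ℝ => ∃ a₁ : ℝ, ∀ b₀ b₁ : ℝ,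
    meanCriterion K h n m T Y t a₀ a₁ ≤ meanCriterion K h n m T Y t b₀ b₁

/-- The weighted least squares criterion of the local-linear surface smoother at `(s, t)`, for the
products `Y i j * Y i k` with `k ≠ j`; the weights are `1 / N i`, where `N i = m i (m i - 1)`. -/
def productCriterion (K : ℝ → ℝ) (h : ℝ) (n : ℕ) (m : ℕ → ℕ) (T Y : ℕ → ℕ → ℝ)
    (s t a₀ a₁ a₂ : ℝ) : ℝ :=
  (1 / (n : ℝ)) * ∑ i ∈ Finset.range n, (1 / ((m i : ℝ) * ((m i : ℝ) - 1))) *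
    ∑ j ∈ Finset.range (m i), ∑ k ∈ (Finset.range (m i)).erase j,
      (Y i j * Y i k - a₀ - a₁ * (T i j - s) - a₂ * (T i k - t)) ^ 2 *
        scaledKernel K h (T i j - s) * scaledKernel K h (T i k - t)

/-- The local-linear estimator of `E (X s * X t)`: the first coordinate of a minimizer of the
criterion (one value is chosen if the minimizer is not unique). -/
def productEstimator (K : ℝ → ℝ) (h : ℝ) (n : ℕ) (m : ℕ → ℕ) (T Y : ℕ → ℕ → ℝ) (s t : ℝ) : ℝ :=
  Classical.epsilon fun a₀ : ℝ => ∃ a₁ a₂ : ℝ, ∀ b₀ b₁ b₂ : ℝ,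
    productCriterion K h n m T Y s t a₀ a₁ a₂ ≤ productCriterion K h n m T Y s t b₀ b₁ b₂

/-- The covariance estimator, with bandwidth `hμ` for the mean and `hR` for the surface. -/
def covEstimator (K : ℝ → ℝ) (hμ hR : ℝ) (n : ℕ) (m : ℕ → ℕ) (T Y : ℕ → ℕ → ℝ) (s t : ℝ) : ℝ :=
  productEstimator K hR n m T Y s t -
    meanEstimator K hμ n m T Y s * meanEstimator K hμ n m T Y t

/-! ### Rates -/

/-- The `k`-th order harmonic mean of `m 0, …, m (n - 1)`. -/
def harmonicMean (n : ℕ) (m : ℕ → ℕ) (k : ℕ) : ℝ :=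
  ((n : ℝ)⁻¹ * ∑ i ∈ Finset.range n, ((m i : ℝ) ^ k)⁻¹)⁻¹

/-- `δ_{n1}(h)`. -/
def delta₁ (n : ℕ) (m : ℕ → ℕ) (h : ℝ) : ℝ :=
  √((1 + (h * harmonicMean n m 1)⁻¹) * Real.log n / n)

/-- `δ_{n2}(h)`. -/
def delta₂ (n : ℕ) (m : ℕ → ℕ) (h : ℝ) : ℝ :=
  √((1 + (h * harmonicMean n m 1)⁻¹ + (h ^ 2 * harmonicMean n m 2)⁻¹) * Real.log n / n)

/-! ### The process and the sampling model -/

/-- The mean function of the process `X` on the probability space `(𝒳, Q)`. -/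
def meanFun {𝒳 : Type*} [MeasurableSpace 𝒳] (Q : Measure 𝒳) (X : 𝒳 → ℝ → ℝ) (t : ℝ) : ℝ :=
  ∫ x, X x t ∂Q

/-- The covariance function of the process `X` on the probability space `(𝒳, Q)`. -/
def covFun {𝒳 : Type*} [MeasurableSpace 𝒳] (Q : Measure 𝒳) (X : 𝒳 → ℝ → ℝ) (s t : ℝ) : ℝ :=
  cov[fun x => X x s, fun x => X x t; Q]

/-- The supremum of `|X t|` over `t ∈ [a, b]`, as an extended nonnegative number. -/
def pathSup {𝒳 : Type*} (a b : ℝ) (X : 𝒳 → ℝ → ℝ) (x : 𝒳) : ℝ≥0∞ :=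
  ⨆ t ∈ Icc a b, ‖X x t‖ₑ

/-- The sampling model. `X` is a measurable process on `(𝒳, Q)`; its values outside `[a, b]` are
irrelevant. The `i`-th curve is the independent realization `t ↦ X (ξ i ω) t`. The design points
`T i j` have density `fT` on `[a, b]`, the errors `U i j` are identically distributed with mean
zero and finite variance, and all the `ξ i`, `T i j`, `U i j` are mutually independent. -/
structure IsSamplingModel {Ω 𝒳 : Type*} [MeasurableSpace Ω] [MeasurableSpace 𝒳]
    (P : Measure Ω) (Q : Measure 𝒳) (a b : ℝ) (X : 𝒳 → ℝ → ℝ) (fT : ℝ → ℝ)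
    (ξ : ℕ → Ω → 𝒳) (T U : ℕ → ℕ → Ω → ℝ) : Prop where
  measurable_process : Measurable (Function.uncurry X)
  aemeasurable_pathSup : AEMeasurable (pathSup a b X) Q
  realization : ∀ i, MeasurePreserving (ξ i) P Q
  measurable_design : ∀ i j, Measurable (T i j)
  design_law : ∀ i j, P.map (T i j) =
    (volume.restrict (Icc a b)).withDensity fun t => ENNReal.ofReal (fT t)
  measurable_error : ∀ i j, Measurable (U i j)
  error_identDistrib : ∀ i j, IdentDistrib (U i j) (U 0 0) P P
  error_memLp : ∀ i j, MemLp (U i j) 2 P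
  error_mean : ∀ i j, ∫ ω, U i j ω ∂P = 0
  independent : iIndep (Sum.elim (fun i : ℕ => MeasurableSpace.comap (ξ i) inferInstance)
    (Sum.elim (fun p : ℕ × ℕ => MeasurableSpace.comap (T p.1 p.2) inferInstance)
      (fun p : ℕ × ℕ => MeasurableSpace.comap (U p.1 p.2) inferInstance))) P

/-- The observations `Y i j = X_i (T i j) + U i j`. -/
def observation {Ω 𝒳 : Type*} (X : 𝒳 → ℝ → ℝ) (ξ : ℕ → Ω → 𝒳) (T U : ℕ → ℕ → Ω → ℝ) (ω : Ω)
    (i j : ℕ) : ℝ :=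
  X (ξ i ω) (T i j ω) + U i j ω

/-! ### Regularity conditions -/

/-- `fT` is bounded away from zero and infinity on `[a, b]`, and differentiable there with a
bounded derivative (one-sided at the endpoints). -/
def DensityCondition (a b : ℝ) (fT : ℝ → ℝ) : Prop :=
  (∃ c M : ℝ, 0 < c ∧ ∀ t ∈ Icc a b, c ≤ fT t ∧ fT t ≤ M) ∧
  ∃ (f' : ℝ → ℝ) (M : ℝ), ∀ t ∈ Icc a b, HasDerivWithinAt fT (f' t) (Icc a b) t ∧ |f' t| ≤ M

/-- `K` is a symmetric probability density on `[-1, 1]`, of bounded variation on `[-1, 1]`. -/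
structure KernelCondition (K : ℝ → ℝ) : Prop where
  nonneg : ∀ u, 0 ≤ K u
  symm : ∀ u, K (-u) = K u
  support : ∀ u, u ∉ Icc (-1 : ℝ) 1 → K u = 0
  integral_eq_one : ∫ u, K u = 1
  boundedVariation : BoundedVariationOn K (Icc (-1) 1)

/-- `f` is twice differentiable on `[a, b]` with a bounded second derivative. -/
def MeanSmoothness (a b : ℝ) (f : ℝ → ℝ) : Prop :=
  ∃ (f' f'' : ℝ → ℝ) (M : ℝ), ∀ t ∈ Icc a b,
    HasDerivWithinAt f (f' t) (Icc a b) t ∧ HasDerivWithinAt f' (f'' t) (Icc a b) t ∧ |f'' t| ≤ M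

/-- All second-order partial derivatives of `F` exist and are bounded on `[a, b]²`. Here `F₁`, `F₂`
are the first-order partial derivatives, and `Fᵢⱼ` is the partial derivative of `Fᵢ` in the `j`-th
variable. -/
def CovSmoothness (a b : ℝ) (F : ℝ → ℝ → ℝ) : Prop :=
  ∃ (F₁ F₂ F₁₁ F₁₂ F₂₁ F₂₂ : ℝ → ℝ → ℝ) (M : ℝ), ∀ s ∈ Icc a b, ∀ t ∈ Icc a b,
    HasDerivWithinAt (fun x => F x t) (F₁ s t) (Icc a b) s ∧
    HasDerivWithinAt (fun y => F s y) (F₂ s t) (Icc a b) t ∧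
    HasDerivWithinAt (fun x => F₁ x t) (F₁₁ s t) (Icc a b) s ∧
    HasDerivWithinAt (fun y => F₁ s y) (F₁₂ s t) (Icc a b) t ∧
    HasDerivWithinAt (fun x => F₂ x t) (F₂₁ s t) (Icc a b) s ∧
    HasDerivWithinAt (fun y => F₂ s y) (F₂₂ s t) (Icc a b) t ∧
    |F₁₁ s t| ≤ M ∧ |F₁₂ s t| ≤ M ∧ |F₂₁ s t| ≤ M ∧ |F₂₂ s t| ≤ M

/-- The errors and the suprema of the paths have finite absolute moments of order `p`. -/
def MomentCondition {Ω 𝒳 : Type*} [MeasurableSpace Ω] [MeasurableSpace 𝒳]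
    (P : Measure Ω) (Q : Measure 𝒳) (a b : ℝ) (X : 𝒳 → ℝ → ℝ) (U : ℕ → ℕ → Ω → ℝ)
    (p : ℝ) : Prop :=
  (∀ i j, ∫⁻ ω, ‖U i j ω‖ₑ ^ p ∂P < ∞) ∧ ∫⁻ x, pathSup a b X x ^ p ∂Q < ∞

/-- The bandwidth condition for the mean. -/
def MeanBandwidthCondition (m : ℕ → ℕ → ℕ) (h : ℕ → ℝ) (lam : ℝ) : Prop :=
  (∀ n, 0 < h n) ∧ Tendsto h atTop (𝓝 0) ∧
  Tendsto (fun n : ℕ => (h n ^ 2 + h n / harmonicMean n (m n) 1)⁻¹ *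
    (Real.log n / n) ^ (1 - 2 / lam)) atTop (𝓝 0)

/-- The bandwidth condition for the covariance. -/
def CovBandwidthCondition (m : ℕ → ℕ → ℕ) (h : ℕ → ℝ) (lam : ℝ) : Prop :=
  (∀ n, 0 < h n) ∧ Tendsto h atTop (𝓝 0) ∧
  Tendsto (fun n : ℕ => (h n ^ 4 + h n ^ 3 / harmonicMean n (m n) 1 +
    h n ^ 2 / harmonicMean n (m n) 2)⁻¹ * (Real.log n / n) ^ (1 - 2 / lam)) atTop (𝓝 0)

end FunctionalData

end

namespace FunctionalData

/-! ### Weighted least squares for a positive linear functional -/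

section LeastSquares

variable {ι : Type*} {d : ℕ} {L : (ι → ℝ) →ₗ[ℝ] ℝ} {z : Fin d → ι → ℝ} {y : ι → ℝ} {c : ℝ}

/-! At a fixed point both estimators are weighted least squares fits: the criterion is `L ((y - ∑ aᵢ
zᵢ) ^ 2)` for a positive linear functional `L`, a kernel-weighted average over the data, with
regressors `1, (T - t)/h` for the mean and `1, (T - s)/h, (T' - t)/h` for the surface. If the Gram
matrix of the regressors is bounded below, any minimizer differs from a reference vector `β` by at
most a constant times the correlations of `y - ∑ βᵢ zᵢ` with the regressors (`leastSquares_error`).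
With `β` read off from the Taylor expansion of the mean or of the second moment function, this
residual is centred noise plus a remainder that is `O(h²)` on the kernel window.

It remains to control two families of kernel averages, almost surely and uniformly in the evaluation
point: the Gram entries should be within `O(δ)` of their means, and the noise correlations should be
`O(δ)`. The means form a matrix that is bounded below up to the boundary of `[a, b]`, because half a
kernel window always fits into `[a, b]` (`KernelCondition.exists_local_lower_bound`); for the
surface the matrix is a compression of a Kronecker product (`product_moment_ge`). Since `δ → 0`, the
empirical Gram matrices are eventually bounded below as well.

The uniform law `ae_eventually_abs_sum_favg_le` treats each curve as one independent summand.
Finitely many evaluation points (`ae_eventually_abs_sum_le`): the curve averages are truncated at a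
level `Q`, Bernstein's inequality, a union bound over polynomially many points and Borel-Cantelli
handle the truncated part, and the bandwidth condition is what makes the tails negligible. All
points: bounded variation of the kernel gives a monotone function whose increments dominate the
oscillation over a cell of mesh `(b - a)/n` and have integral `O(1/n)` whatever the bandwidth.

Two inputs are specific to the sampling scheme. The variances come from counting distinct design
points, each of which falls into a window with probability `O(h)` (`sum_lintegral_window_le`,
`sum_lintegral_window_pair_le`); this produces the factors `h² + h/γ₁` and `h⁴ + h²/γ₂`. And since
the number of observations on a curve changes with `n`, the truncation needs an envelope of all
running averages of the errors at once; a dyadic `L²` argument shows that it has the required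
moments (`lintegral_avgSup_rpow_lt_top`).

Finally the error of the covariance estimator is the error for the second moment minus that of a
product of two mean estimators, and the latter is linear in the mean errors up to a product of two
of them. -/

theorem map_sq_residual_sub (a e : Fin d → ℝ) :
    L ((y - ∑ i, (a i + e i) • z i) ^ 2) = L ((y - ∑ i, a i • z i) ^ 2)
      - 2 * ∑ i, e i * L ((y - ∑ j, a j • z j) * z i) + L ((∑ i, e i • z i) ^ 2) := by
  have h : (y - ∑ i, (a i + e i) • z i) ^ 2 = (y - ∑ i, a i • z i) ^ 2
      - (2 : ℝ) • ∑ i, e i • ((y - ∑ j, a j • z j) * z i) + (∑ i, e i • z i) ^ 2 := by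
    have h1 : ∑ i, e i • ((y - ∑ j, a j • z j) * z i)
        = (y - ∑ j, a j • z j) * ∑ i, e i • z i := by
      rw [Finset.mul_sum]
      exact Finset.sum_congr rfl fun i _ => (mul_smul_comm _ _ _).symm
    rw [h1]
    simp only [add_smul, Finset.sum_add_distrib, two_smul]
    ring
  rw [h, map_add, map_sub, map_smul, map_sum]
  simp

/-- Coercivity makes the Gram map injective, hence surjective in finite dimension, so the normal
equations are solvable. At a solution the linear term of `map_sq_residual_sub` vanishes and the
remaining quadratic term is nonnegative. -/
theorem exists_leastSquares (hL : ∀ f, 0 ≤ f → 0 ≤ L f) (hc : 0 < c)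
    (hpd : ∀ v : Fin d → ℝ, c * ∑ i, v i ^ 2 ≤ L ((∑ i, v i • z i) ^ 2)) :
    ∃ a : Fin d → ℝ, ∀ b : Fin d → ℝ,
      L ((y - ∑ i, a i • z i) ^ 2) ≤ L ((y - ∑ i, b i • z i) ^ 2) := by
  let M : (Fin d → ℝ) →ₗ[ℝ] (Fin d → ℝ) :=
    { toFun := fun v i => L ((∑ j, v j • z j) * z i)
      map_add' := by
        intro v w
        ext i
        simp [add_smul, Finset.sum_add_distrib, add_mul]
      map_smul' := by
        intro r v
        ext i
        simp [mul_smul, ← Finset.smul_sum] }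
  have hinj : Function.Injective M := by
    rw [injective_iff_map_eq_zero]
    intro v hv
    have h1 : L ((∑ i, v i • z i) ^ 2) = ∑ i, v i * M v i := by
      have : (∑ i, v i • z i) ^ 2 = ∑ i, v i • ((∑ j, v j • z j) * z i) := by
        rw [sq]
        conv_lhs => rw [Finset.mul_sum]
        exact Finset.sum_congr rfl fun i _ => (mul_smul_comm _ _ _)
      rw [this, map_sum]
      simp [M]
    have h2 := hpd v
    rw [h1, hv] at h2
    simp only [Pi.zero_apply, mul_zero, Finset.sum_const_zero] at h2
    have h3 : ∑ i, v i ^ 2 = 0 :=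
      le_antisymm (by nlinarith) (Finset.sum_nonneg fun i _ => sq_nonneg _)
    rw [Finset.sum_eq_zero_iff_of_nonneg fun i _ => sq_nonneg _] at h3
    ext i
    simpa using h3 i (Finset.mem_univ i)
  obtain ⟨a, ha⟩ := (LinearMap.injective_iff_surjective.1 hinj) fun i => L (y * z i)
  refine ⟨a, fun b => ?_⟩
  have h := map_sq_residual_sub (L := L) (y := y) (z := z) a (b - a)
  have h0 : ∀ i, L ((y - ∑ j, a j • z j) * z i) = 0 := by
    intro i
    have := congrFun ha i
    simp only [M, LinearMap.coe_mk, AddHom.coe_mk] at this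
    rw [sub_mul, map_sub, this, sub_self]
  simp only [Pi.sub_apply, add_sub_cancel, h0, mul_zero, Finset.sum_const_zero, sub_zero] at h
  rw [h]
  linarith [hL ((∑ i, (b i - a i) • z i) ^ 2) fun l => by
    simp only [Pi.zero_apply, Pi.pow_apply]; positivity]

/-- Along the line from `β` through `a` the criterion is a parabola in the parameter `τ`, minimal at
`τ = 1`; this forces its quadratic coefficient `q` to be at most its linear coefficient `g`.
Coercivity bounds `q` below by `c |v|²`, and `g` is at most `B` times the `ℓ¹` norm of `v = a - β`;
Cauchy-Schwarz, with its factor `d`, compares the norms. Only minimality of `a` enters, so the bound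
covers every choice of a minimizer. -/
theorem leastSquares_error (hc : 0 < c)
    (hpd : ∀ v : Fin d → ℝ, c * ∑ i, v i ^ 2 ≤ L ((∑ i, v i • z i) ^ 2))
    {a : Fin d → ℝ} (ha : ∀ b : Fin d → ℝ,
      L ((y - ∑ i, a i • z i) ^ 2) ≤ L ((y - ∑ i, b i • z i) ^ 2))
    (β : Fin d → ℝ) {B : ℝ} (hB : ∀ i, |L ((y - ∑ j, β j • z j) * z i)| ≤ B) (i : Fin d) :
    |a i - β i| ≤ d * B / c := by
  set v : Fin d → ℝ := a - β with hv
  set g : ℝ := ∑ i, v i * L ((y - ∑ j, β j • z j) * z i) with hg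
  set q : ℝ := L ((∑ i, v i • z i) ^ 2) with hq
  have key : ∀ τ : ℝ, L ((y - ∑ i, (β i + τ * v i) • z i) ^ 2)
      = L ((y - ∑ i, β i • z i) ^ 2) - 2 * τ * g + τ ^ 2 * q := by
    intro τ
    have h := map_sq_residual_sub (L := L) (y := y) (z := z) β (fun i => τ * v i)
    rw [h, hg, hq]
    have h1 : (∑ i, (τ * v i) • z i) ^ 2 = τ ^ 2 • (∑ i, v i • z i) ^ 2 := by
      simp only [mul_smul, ← Finset.smul_sum, smul_pow]
    rw [h1, map_smul, Finset.mul_sum, Finset.mul_sum, smul_eq_mul]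
    congr 2
    exact Finset.sum_congr rfl fun i _ => by ring
  have hmin : ∀ τ : ℝ, -2 * g + q ≤ -2 * τ * g + τ ^ 2 * q := by
    intro τ
    have h1 := ha fun i => β i + τ * v i
    have h2 := key 1
    have h3 : ∀ i, β i + 1 * v i = a i := fun i => by simp [hv]
    simp only [h3] at h2
    rw [key τ, h2] at h1
    linarith
  have hqg : q ≤ g := by
    by_contra hlt
    push Not at hlt
    have hq0 : 0 ≤ q := le_trans (mul_nonneg hc.le (Finset.sum_nonneg fun i _ => sq_nonneg _))
        (hpd v)
    rcases hq0.eq_or_lt with h0 | h0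
    · have := hmin 0
      rw [← h0] at this hlt
      linarith
    -- The vertex of the parabola: comparing it with the value at `τ = 1` leaves `(q - g)² / q ≤ 0`.
    · have h1 := hmin (g / q)
      have h2 : -2 * (g / q) * g + (g / q) ^ 2 * q = -(g ^ 2 / q) := by field_simp; ring
      rw [h2] at h1
      have h3 : 0 < (q - g) ^ 2 / q := div_pos (pow_pos (sub_pos.2 hlt) 2) h0
      have h4 : (q - g) ^ 2 / q = q - 2 * g + g ^ 2 / q := by field_simp; ring
      linarith
  set N : ℝ := ∑ i, |v i| with hN
  have hN0 : 0 ≤ N := Finset.sum_nonneg fun i _ => abs_nonneg _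
  have hgB : g ≤ B * N := by
    rw [hg, hN, Finset.mul_sum]
    refine Finset.sum_le_sum fun i _ => ?_
    calc v i * L ((y - ∑ j, β j • z j) * z i) ≤ |v i * L ((y - ∑ j,
        β j • z j) * z i)| := le_abs_self _
      _ = |L ((y - ∑ j, β j • z j) * z i)| * |v i| := by rw [abs_mul, mul_comm]
      _ ≤ B * |v i| := mul_le_mul_of_nonneg_right (hB i) (abs_nonneg _)
  have hCS : N ^ 2 ≤ d * ∑ i, v i ^ 2 := by
    have := sq_sum_le_card_mul_sum_sq (s := (Finset.univ : Finset (Fin d))) (f := fun i => |v i|)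
    simpa [hN, sq_abs] using this
  have hfin : c * N ^ 2 ≤ d * (B * N) := by
    have h1 : c * ∑ i, v i ^ 2 ≤ B * N := (hpd v).trans (hqg.trans hgB)
    have hd : (0 : ℝ) ≤ d := Nat.cast_nonneg d
    nlinarith
  have hvi : |a i - β i| ≤ N := Finset.single_le_sum (f := fun i => |v i|)
    (fun i _ => abs_nonneg _) (Finset.mem_univ i)
  refine hvi.trans ?_
  rw [le_div_iff₀ hc]
  rcases hN0.eq_or_lt with h0 | h0
  · rw [← h0, zero_mul]
    exact mul_nonneg (Nat.cast_nonneg d) ((abs_nonneg _).trans (hB i))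
  · nlinarith

end LeastSquares

/-! ### Functions of bounded variation on the line -/

/-- `k` is bounded by `M`, and its increments are dominated by those of a monotone function that
is also bounded by `M`. -/
def HasModulus (k : ℝ → ℝ) (M : ℝ) : Prop :=
  (∀ x, |k x| ≤ M) ∧
    ∃ ψ : ℝ → ℝ, Monotone ψ ∧ (∀ x, |ψ x| ≤ M) ∧ ∀ x y, x ≤ y → |k x - k y| ≤ ψ y - ψ x

theorem HasModulus.nonneg {k : ℝ → ℝ} {M : ℝ} (h : HasModulus k M) : 0 ≤ M :=
  (abs_nonneg _).trans (h.1 0)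

theorem HasModulus.measurable {k : ℝ → ℝ} {M : ℝ} (h : HasModulus k M) : Measurable k := by
  obtain ⟨-, ψ, hψ, -, hk⟩ := h
  have h1 : Monotone fun x => ψ x + k x := by
    intro x y hxy
    have := (abs_le.1 (hk x y hxy)).2
    show ψ x + k x ≤ ψ y + k y
    linarith
  have h2 : k = fun x => (ψ x + k x) - ψ x := by ext; ring
  rw [h2]
  exact h1.measurable.sub hψ.measurable

theorem HasModulus.mono {k : ℝ → ℝ} {M M' : ℝ} (h : HasModulus k M) (hM : M ≤ M') :
    HasModulus k M' := by
  obtain ⟨h1, ψ, hψ, h2, hk⟩ := h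
  exact ⟨fun x => (h1 x).trans hM, ψ, hψ, fun x => (h2 x).trans hM, hk⟩

/-- The product rule for increments: `N ψ + M ψ'` dominates. Its size is what doubles the constant;
the product itself is bounded by `M N`. -/
theorem HasModulus.mul {k l : ℝ → ℝ} {M N : ℝ} (hk : HasModulus k M) (hl : HasModulus l N) :
    HasModulus (fun x => k x * l x) (2 * M * N) := by
  have hM := hk.nonneg
  have hN := hl.nonneg
  obtain ⟨h1, ψ, hψ, h2, h3⟩ := hk
  obtain ⟨h1', ψ', hψ', h2', h3'⟩ := hl
  refine ⟨fun x => ?_, fun x => N * ψ x + M * ψ' x, ?_, fun x => ?_, fun x y hxy => ?_⟩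
  · rw [abs_mul]
    nlinarith [mul_le_mul (h1 x) (h1' x) (abs_nonneg _) hM, mul_nonneg hM hN]
  · exact (hψ.const_mul hN).add (hψ'.const_mul hM)
  · calc |N * ψ x + M * ψ' x| ≤ |N * ψ x| + |M * ψ' x| := abs_add_le _ _
      _ = N * |ψ x| + M * |ψ' x| := by rw [abs_mul, abs_mul, abs_of_nonneg hM, abs_of_nonneg hN]
      _ ≤ N * M + M * N := by gcongr; exacts [h2 x, h2' x]
      _ = 2 * M * N := by ring
  · have e : k x * l x - k y * l y = (k x - k y) * l x + k y * (l x - l y) := by ring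
    calc |k x * l x - k y * l y| ≤ |(k x - k y) * l x| + |k y * (l x - l y)| := by
          rw [e]; exact abs_add_le _ _
      _ = |k x - k y| * |l x| + |k y| * |l x - l y| := by rw [abs_mul, abs_mul]
      _ ≤ (ψ y - ψ x) * N + M * (ψ' y - ψ' x) := by
          gcongr
          · exact (abs_nonneg _).trans (h3 x y hxy)
          · exact h3 x y hxy
          · exact h1' x
          · exact h1 y
          · exact h3' x y hxy
      _ = _ := by ring

/-- The clamp is the identity on the support of the kernel, so multiplying a kernel by `u` is the
same as multiplying it by this bounded function. This brings `u ^ r K(u)` into the class. -/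
theorem hasModulus_clamp : HasModulus (fun x => max (-1) (min 1 x)) 1 := by
  have hm : Monotone fun x : ℝ => max (-1) (min 1 x) := fun x y h =>
    max_le_max le_rfl (min_le_min le_rfl h)
  have hb : ∀ x : ℝ, |max (-1) (min 1 x)| ≤ 1 := fun x =>
    abs_le.2 ⟨le_max_left _ _, max_le (by norm_num) (min_le_left _ _)⟩
  refine ⟨hb, _, hm, hb, fun x y h => ?_⟩
  rw [abs_sub_comm, abs_of_nonneg (sub_nonneg.2 (hm h))]

/-- On `[-1, 1]` the variation function dominates the increments. The extension by zero may jump at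
both ends, so the dominating function receives an additional jump there, large enough to cover `sup
|K|`. -/
theorem hasModulus_of_boundedVariationOn {K : ℝ → ℝ} (hK : BoundedVariationOn K (Icc (-1) 1))
    (h0 : ∀ u, u ∉ Icc (-1 : ℝ) 1 → K u = 0) : ∃ M, HasModulus K M := by
  set s : Set ℝ := Icc (-1) 1
  have hl : LocallyBoundedVariationOn K s := hK.locallyBoundedVariationOn
  set V : ℝ → ℝ := variationOnFromTo K s (-1)
  have hm1 : (-1 : ℝ) ∈ s := by simp [s]
  have h1 : (1 : ℝ) ∈ s := by simp [s]
  have hVmono : MonotoneOn V s := variationOnFromTo.monotoneOn hl hm1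
  have hV : ∀ x ∈ s, ∀ y ∈ s, x ≤ y → |K x - K y| ≤ V y - V x := by
    intro x hx y hy hxy
    have e : V y - V x = variationOnFromTo K s x y := by
      have := variationOnFromTo.add hl hm1 hx hy
      simp only [V]; linarith
    rw [e, abs_sub_comm]
    rw [variationOnFromTo.eq_of_le _ _ hxy, ← Real.dist_eq, dist_comm, dist_edist]
    refine ENNReal.toReal_mono (hl x y hx hy) ?_
    exact eVariationOn.edist_le _ ⟨hx, ⟨le_rfl, hxy⟩⟩ ⟨hy, ⟨hxy, le_rfl⟩⟩
  have hV0 : V (-1) = 0 := variationOnFromTo.self _ _ _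
  have hVnn : ∀ x ∈ s, 0 ≤ V x := fun x hx => hV0 ▸ hVmono hm1 hx hx.1
  have hV1 : ∀ x ∈ s, V x ≤ V 1 := fun x hx => hVmono hx h1 hx.2
  set A : ℝ := |K (-1)| + V 1 with hA
  have hKA : ∀ x, |K x| ≤ A := by
    intro x
    by_cases hx : x ∈ s
    · have := hV (-1) hm1 x hx hx.1
      have h2 : |K x| ≤ |K (-1)| + |K (-1) - K x| := by
        have := abs_sub (K (-1)) (K (-1) - K x); simpa using this
      linarith [hV1 x hx]
    · rw [h0 x hx, abs_zero]
      have := hVnn 1 h1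
      positivity
  have hA0 : 0 ≤ A := (abs_nonneg _).trans (hKA 0)
  have hV10 := hVnn 1 h1
  -- `A` bounds `|K|` and is the height of the jumps of `ψ` added at `-1` and just after `1`.
  set ψ : ℝ → ℝ := fun x => if x < -1 then 0 else if x ≤ 1 then A + V x else 2 * A + V 1 with hψ
  have hψlt : ∀ x, x < -1 → ψ x = 0 := fun x hx => by simp [hψ, hx]
  have hψs : ∀ x ∈ s, ψ x = A + V x := fun x hx => by simp [hψ, not_lt.2 hx.1, hx.2]
  have hψgt : ∀ x, 1 < x → ψ x = 2 * A + V 1 := fun x hx => by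
    simp [hψ, not_lt.2 (by linarith : -1 ≤ x), not_le.2 hx]
  have tri : ∀ x, x < -1 ∨ x ∈ s ∨ 1 < x := fun x => by
    rcases lt_or_ge x (-1) with h | h
    · exact Or.inl h
    · rcases le_or_gt x 1 with h' | h'
      · exact Or.inr (Or.inl ⟨h, h'⟩)
      · exact Or.inr (Or.inr h')
  have hns : ∀ x, x < -1 ∨ 1 < x → K x = 0 := fun x hx => h0 x fun hx' => by
    rcases hx with h | h
    · exact absurd hx'.1 (not_le.2 h)
    · exact absurd hx'.2 (not_le.2 h)
  have hmain : ∀ x y, x ≤ y → |K x - K y| ≤ ψ y - ψ x := by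
    intro x y hxy
    rcases tri x with hx | hx | hx <;> rcases tri y with hy | hy | hy
    · simp [hns x (Or.inl hx), hns y (Or.inl hy), hψlt x hx, hψlt y hy]
    · rw [hns x (Or.inl hx), hψlt x hx, hψs y hy, zero_sub, abs_neg]
      linarith [hKA y, hVnn y hy]
    · rw [hns x (Or.inl hx), hns y (Or.inr hy), hψlt x hx, hψgt y hy, sub_self, abs_zero]
      linarith
    · exact absurd (hx.1.trans hxy) (not_le.2 hy)
    · rw [hψs x hx, hψs y hy]
      linarith [hV x hx y hy hxy]
    · rw [hns y (Or.inr hy), hψs x hx, hψgt y hy, sub_zero]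
      linarith [hKA x, hV1 x hx]
    · linarith
    · exact absurd (hxy.trans hy.2) (not_le.2 hx)
    · simp [hns x (Or.inr hx), hns y (Or.inr hy), hψgt x hx, hψgt y hy]
  refine ⟨2 * A + V 1, fun x => (hKA x).trans (by linarith), ψ, ?_, ?_, hmain⟩
  · intro x y hxy
    have := (abs_nonneg _).trans (hmain x y hxy)
    linarith
  · intro x
    rcases tri x with hx | hx | hx
    · rw [hψlt x hx, abs_zero]; linarith
    · rw [hψs x hx, abs_of_nonneg (by linarith [hVnn x hx])]
      linarith [hV1 x hx]
    · rw [hψgt x hx, abs_of_nonneg (by linarith)]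

/-- The functions `u ↦ u ^ r K(u)`. -/
def kernelMoment (K : ℝ → ℝ) (r : ℕ) (u : ℝ) : ℝ := u ^ r * K u

theorem KernelCondition.exists_hasModulus {K : ℝ → ℝ} (hK : KernelCondition K) :
    ∃ M, 1 ≤ M ∧ ∀ r ≤ 2, HasModulus (kernelMoment K r) M := by
  obtain ⟨M, hM⟩ := hasModulus_of_boundedVariationOn hK.boundedVariation hK.support
  have hM0 := hM.nonneg
  have hstep : ∀ r, kernelMoment K (r + 1)
      = fun u => max (-1) (min 1 u) * kernelMoment K r u := by
    intro r
    ext u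
    by_cases hu : u ∈ Icc (-1 : ℝ) 1
    · rw [min_eq_right hu.2, max_eq_right hu.1]
      simp only [kernelMoment]; ring
    · simp [kernelMoment, hK.support u hu]
  have k0 : HasModulus (kernelMoment K 0) M := by
    have : kernelMoment K 0 = K := by ext; simp [kernelMoment]
    rwa [this]
  have k1 : HasModulus (kernelMoment K 1) (2 * 1 * M) := by
    rw [hstep 0]; exact hasModulus_clamp.mul k0
  have k2 : HasModulus (kernelMoment K 2) (2 * 1 * (2 * 1 * M)) := by
    rw [hstep 1]; exact hasModulus_clamp.mul k1
  refine ⟨4 * M + 1, by linarith, fun r hr => ?_⟩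
  interval_cases r
  · exact k0.mono (by linarith)
  · exact k1.mono (by linarith)
  · exact k2.mono (by linarith)

/-! ### Taylor bounds on an interval -/

/-- The mean value inequality applied twice, first to `f'` and then to `f` minus its tangent. The
constant is `M` instead of `M / 2`, which is harmless for rates and avoids integrating a second
derivative that need not be integrable. -/
theorem abs_sub_taylor_le {a b M : ℝ} {f f' f'' : ℝ → ℝ}
    (h1 : ∀ t ∈ Icc a b, HasDerivWithinAt f (f' t) (Icc a b) t)
    (h2 : ∀ t ∈ Icc a b, HasDerivWithinAt f' (f'' t) (Icc a b) t)
    (h3 : ∀ t ∈ Icc a b, |f'' t| ≤ M) {s x : ℝ} (hs : s ∈ Icc a b) (hx : x ∈ Icc a b) :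
    |f x - f s - f' s * (x - s)| ≤ M * (x - s) ^ 2 := by
  have hM : 0 ≤ M := (abs_nonneg _).trans (h3 s hs)
  have hsub : uIcc s x ⊆ Icc a b := (convex_Icc a b).ordConnected.uIcc_subset hs hx
  have hd : ∀ t ∈ uIcc s x, HasDerivWithinAt (fun t => f t - f' s * (t - s)) (f' t - f' s)
      (uIcc s x) t := by
    intro t ht
    have e := ((hasDerivAt_id t).sub_const s).const_mul (f' s)
    simpa using ((h1 t (hsub ht)).mono hsub).fun_sub e.hasDerivWithinAt
  have hb : ∀ t ∈ uIcc s x, ‖f' t - f' s‖ ≤ M * |x - s| := by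
    intro t ht
    have h := (convex_Icc a b).norm_image_sub_le_of_norm_hasDerivWithin_le h2 h3 hs (hsub ht)
    refine h.trans (mul_le_mul_of_nonneg_left ?_ hM)
    exact abs_sub_left_of_mem_uIcc ht
  have h := (convex_uIcc s x).norm_image_sub_le_of_norm_hasDerivWithin_le hd hb
    left_mem_uIcc right_mem_uIcc
  simp only [Real.norm_eq_abs, sub_self, mul_zero, sub_zero] at h
  calc |f x - f s - f' s * (x - s)| = |f x - f' s * (x - s) - f s| := by congr 1; ring
    _ ≤ M * |x - s| * |x - s| := h
    _ = M * (x - s) ^ 2 := by rw [mul_assoc, ← sq, sq_abs]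

/-- Move from `(s, t)` to `(s, v)` and then to `(u, v)`: two one-dimensional expansions, plus the
change of the first partial derivative along the vertical leg, which is controlled by a single mixed
partial. Neither continuity nor symmetry of the second derivatives is needed. -/
theorem abs_sub_taylor_le_of_partials {a b M : ℝ} {F F₁ F₂ F₁₁ F₁₂ F₂₂ : ℝ → ℝ → ℝ}
    (h1 : ∀ s ∈ Icc a b, ∀ t ∈ Icc a b, HasDerivWithinAt (fun x => F x t) (F₁ s t) (Icc a b) s)
    (h2 : ∀ s ∈ Icc a b, ∀ t ∈ Icc a b, HasDerivWithinAt (fun y => F s y) (F₂ s t) (Icc a b) t)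
    (h11 : ∀ s ∈ Icc a b, ∀ t ∈ Icc a b, HasDerivWithinAt (fun x => F₁ x t) (F₁₁ s t) (Icc a b) s)
    (h12 : ∀ s ∈ Icc a b, ∀ t ∈ Icc a b, HasDerivWithinAt (fun y => F₁ s y) (F₁₂ s t) (Icc a b) t)
    (h22 : ∀ s ∈ Icc a b, ∀ t ∈ Icc a b, HasDerivWithinAt (fun y => F₂ s y) (F₂₂ s t) (Icc a b) t)
    (b11 : ∀ s ∈ Icc a b, ∀ t ∈ Icc a b, |F₁₁ s t| ≤ M)
    (b12 : ∀ s ∈ Icc a b, ∀ t ∈ Icc a b, |F₁₂ s t| ≤ M)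
    (b22 : ∀ s ∈ Icc a b, ∀ t ∈ Icc a b, |F₂₂ s t| ≤ M)
    {s t u v : ℝ} (hs : s ∈ Icc a b) (ht : t ∈ Icc a b) (hu : u ∈ Icc a b) (hv : v ∈ Icc a b) :
    |F u v - F s t - F₁ s t * (u - s) - F₂ s t * (v - t)| ≤ M * (|u - s| + |v - t|) ^ 2 := by
  have e1 := abs_sub_taylor_le (f := fun x => F x v) (f' := fun x => F₁ x v)
    (f'' := fun x => F₁₁ x v) (fun x hx => h1 x hx v hv) (fun x hx => h11 x hx v hv)
    (fun x hx => b11 x hx v hv) hs hu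
  have e2 := abs_sub_taylor_le (f := fun y => F s y) (f' := fun y => F₂ s y)
    (f'' := fun y => F₂₂ s y) (fun y hy => h2 s hs y hy) (fun y hy => h22 s hs y hy)
    (fun y hy => b22 s hs y hy) ht hv
  have e3 : |F₁ s v - F₁ s t| ≤ M * |v - t| :=
    (convex_Icc a b).norm_image_sub_le_of_norm_hasDerivWithin_le (fun y hy => h12 s hs y hy)
      (fun y hy => b12 s hs y hy) ht hv
  have hM : 0 ≤ M := (abs_nonneg _).trans (b11 s hs t ht)
  have e : F u v - F s t - F₁ s t * (u - s) - F₂ s t * (v - t)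
      = (F u v - F s v - F₁ s v * (u - s)) + (F s v - F s t - F₂ s t * (v - t))
        + (F₁ s v - F₁ s t) * (u - s) := by ring
  rw [e]
  refine (abs_add_three _ _ _).trans ?_
  rw [abs_mul]
  have e4 : |F₁ s v - F₁ s t| * |u - s| ≤ M * |v - t| * |u - s| :=
    mul_le_mul_of_nonneg_right e3 (abs_nonneg _)
  have p : 0 ≤ M * (|u - s| * |v - t|) := by positivity
  rw [← sq_abs (u - s)] at e1
  rw [← sq_abs (v - t)] at e2
  nlinarith

/-! ### Local moments of the kernel -/

theorem HasModulus.intervalIntegrable {k : ℝ → ℝ} {M : ℝ} (h : HasModulus k M) (x y : ℝ) :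
    IntervalIntegrable k volume x y := by
  refine (intervalIntegrable_const (c := M)).mono_fun h.measurable.aestronglyMeasurable ?_
  filter_upwards with u
  rw [Real.norm_eq_abs, Real.norm_eq_abs, abs_of_nonneg h.nonneg]
  exact h.1 u

theorem HasModulus.integrable {k : ℝ → ℝ} {M : ℝ} (h : HasModulus k M) {E : Type*}
    [MeasurableSpace E] (τ : Measure E) [IsFiniteMeasure τ] {g : E → ℝ} (hg : Measurable g) :
    Integrable (fun x => k (g x)) τ :=
  Integrable.of_bound (h.measurable.comp hg).aestronglyMeasurable M
    (Eventually.of_forall fun x => h.1 (g x))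

theorem sq_mul_kernel (K : ℝ → ℝ) (α β u : ℝ) :
    (α + β * u) ^ 2 * K u
      = α ^ 2 * kernelMoment K 0 u + 2 * α * β * kernelMoment K 1 u
        + β ^ 2 * kernelMoment K 2 u := by
  simp only [kernelMoment]; ring

theorem KernelCondition.integral_unit {K : ℝ → ℝ} (hK : KernelCondition K) :
    ∫ u in (0 : ℝ)..1, K u = 1 / 2 := by
  obtain ⟨M, hM⟩ := hasModulus_of_boundedVariationOn hK.boundedVariation hK.support
  have h1 : ∫ u in (-1 : ℝ)..1, K u = 1 := by
    rw [intervalIntegral.integral_of_le (by norm_num), ← integral_Icc_eq_integral_Ioc,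
      setIntegral_eq_integral_of_forall_compl_eq_zero fun u hu => hK.support u hu,
      hK.integral_eq_one]
  have h2 : ∫ u in (-1 : ℝ)..0, K u = ∫ u in (0 : ℝ)..1, K u := by
    have := intervalIntegral.integral_comp_neg (a := 0) (b := 1) K
    simp only [hK.symm, neg_zero] at this
    exact this.symm
  have h3 := intervalIntegral.integral_add_adjacent_intervals
    (hM.intervalIntegrable (-1) 0) (hM.intervalIntegrable 0 1)
  linarith

/-- The half kernel is not concentrated at one point, so the moment matrix of `1, u` under it is
positive definite. Only half of the support is used because at an endpoint of `[a, b]` nothing more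
is available. -/
theorem KernelCondition.exists_unit_lower_bound {K : ℝ → ℝ} (hK : KernelCondition K) :
    ∃ c, 0 < c ∧ ∀ α β : ℝ,
      c * (α ^ 2 + β ^ 2) ≤ ∫ u in (0 : ℝ)..1, (α + β * u) ^ 2 * K u := by
  obtain ⟨M, -, hM⟩ := hK.exists_hasModulus
  set A := ∫ u in (0 : ℝ)..1, kernelMoment K 0 u with hA
  set B := ∫ u in (0 : ℝ)..1, kernelMoment K 1 u with hB
  set C := ∫ u in (0 : ℝ)..1, kernelMoment K 2 u with hC
  have i0 := (hM 0 (by norm_num)).intervalIntegrable 0 1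
  have i1 := (hM 1 (by norm_num)).intervalIntegrable 0 1
  have i2 := (hM 2 (by norm_num)).intervalIntegrable 0 1
  have hq : ∀ α β : ℝ, ∫ u in (0 : ℝ)..1, (α + β * u) ^ 2 * K u
      = α ^ 2 * A + 2 * α * β * B + β ^ 2 * C := by
    intro α β
    simp only [sq_mul_kernel]
    rw [intervalIntegral.integral_add ((i0.const_mul _).add (i1.const_mul _)) (i2.const_mul _),
      intervalIntegral.integral_add (i0.const_mul _) (i1.const_mul _)]
    simp only [intervalIntegral.integral_const_mul, hA, hB, hC]
  have hA' : A = 1 / 2 := by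
    rw [hA, ← hK.integral_unit]; simp [kernelMoment]
  have hnn : ∀ α β : ℝ, 0 ≤ ∫ u in (0 : ℝ)..1, (α + β * u) ^ 2 * K u := fun α β =>
    intervalIntegral.integral_nonneg (by norm_num) fun u _ => mul_nonneg (sq_nonneg _) (hK.nonneg u)
  have hdet : 0 < A * C - B ^ 2 := by
    have h0 : ∫ u in (0 : ℝ)..1, (-B + A * u) ^ 2 * K u ≠ 0 := by
      intro h0
      have hint : IntervalIntegrable (fun u => (-B + A * u) ^ 2 * K u) volume 0 1 := by
        simp only [sq_mul_kernel]
        exact ((i0.const_mul _).add (i1.const_mul _)).add (i2.const_mul _)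
      rw [intervalIntegral.integral_eq_zero_iff_of_le_of_nonneg_ae (by norm_num)
        (Eventually.of_forall fun u => mul_nonneg (sq_nonneg _) (hK.nonneg u)) hint] at h0
      -- If the determinant vanished, so would `(-B + u/2)² K(u)` almost everywhere on `(0, 1]`;
      -- away from the single root `u = 2B` the kernel would be zero, against its half mass `1/2`.
      have hz : K =ᵐ[volume.restrict (Ioc (0 : ℝ) 1)] fun _ => (0 : ℝ) := by
        have hne : ∀ᵐ u ∂(volume.restrict (Ioc (0 : ℝ) 1)), u ≠ 2 * B :=
          ae_restrict_of_ae (Measure.ae_ne volume (2 * B))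
        filter_upwards [h0, hne] with u hu hne
        simp only [Pi.zero_apply, mul_eq_zero] at hu
        rcases hu with hu | hu
        · exfalso
          have := pow_eq_zero_iff (two_ne_zero) |>.1 hu
          rw [hA'] at this
          exact hne (by linarith)
        · exact hu
      have h1 := hK.integral_unit
      rw [intervalIntegral.integral_of_le (by norm_num), integral_congr_ae hz] at h1
      simp at h1
    have h1 := lt_of_le_of_ne (hnn (-B) A) (Ne.symm h0)
    rw [hq, hA'] at h1
    rw [hA']
    nlinarith
  have hC0 : 0 < C := by
    rw [hA'] at hdet
    nlinarith [sq_nonneg B]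
  refine ⟨(A * C - B ^ 2) / (A + C), div_pos hdet (by linarith), fun α β => ?_⟩
  rw [hq, div_mul_eq_mul_div, div_le_iff₀ (by linarith)]
  -- For a symmetric positive definite `2 × 2` matrix the least eigenvalue is at least determinant
  -- over trace. By Cayley-Hamilton the difference below is the squared norm of the image of `(α,
  -- β)`.
  have e : (α ^ 2 * A + 2 * α * β * B + β ^ 2 * C) * (A + C)
      - (A * C - B ^ 2) * (α ^ 2 + β ^ 2) = (α * A + β * B) ^ 2 + (α * B + β * C) ^ 2 := by ring
  nlinarith [sq_nonneg (α * A + β * B), sq_nonneg (α * B + β * C)]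

theorem scaledKernel_nonneg {K : ℝ → ℝ} (hK : KernelCondition K) {h : ℝ} (hh : 0 < h) (u : ℝ) :
    0 ≤ scaledKernel K h u := by
  have := hK.nonneg (u / h)
  unfold scaledKernel
  positivity

theorem sq_mul_scaledKernel (K : ℝ → ℝ) (h α β u : ℝ) :
    (α + β * (u / h)) ^ 2 * scaledKernel K h u
      = (1 / h) * (α ^ 2 * kernelMoment K 0 (u / h) + 2 * α * β * kernelMoment K 1 (u / h)
        + β ^ 2 * kernelMoment K 2 (u / h)) := by
  rw [← sq_mul_kernel]
  simp only [scaledKernel]; ring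

/-- Uniform positive definiteness of the local moment matrix, including at the boundary. -/
theorem KernelCondition.exists_local_lower_bound {K : ℝ → ℝ} (hK : KernelCondition K)
    {a b : ℝ} {τ : Measure ℝ} [IsFiniteMeasure τ] {cT : ℝ} (hcT : 0 < cT)
    (hτ : ENNReal.ofReal cT • volume.restrict (Icc a b) ≤ τ) :
    ∃ c, 0 < c ∧ ∀ s ∈ Icc a b, ∀ h, 0 < h → h ≤ (b - a) / 2 → ∀ α β : ℝ,
      c * (α ^ 2 + β ^ 2)
        ≤ ∫ x, (α + β * ((x - s) / h)) ^ 2 * scaledKernel K h (x - s) ∂τ := by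
  obtain ⟨M, -, hM⟩ := hK.exists_hasModulus
  obtain ⟨c, hc, hcq⟩ := hK.exists_unit_lower_bound
  refine ⟨cT * c, mul_pos hcT hc, fun s hs h hh hhab α β => ?_⟩
  set g : ℝ → ℝ := fun x => (α + β * ((x - s) / h)) ^ 2 * scaledKernel K h (x - s) with hg
  have hg0 : ∀ x, 0 ≤ g x := fun x => mul_nonneg (sq_nonneg _) (scaledKernel_nonneg hK hh _)
  have hgint : ∀ ν : Measure ℝ, IsFiniteMeasure ν → Integrable g ν := by
    intro ν _
    have hm : Measurable fun x : ℝ => (x - s) / h := by fun_prop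
    have := ((((hM 0 (by norm_num)).integrable ν hm).const_mul (α ^ 2)).add
      (((hM 1 (by norm_num)).integrable ν hm).const_mul (2 * α * β))).add
      (((hM 2 (by norm_num)).integrable ν hm).const_mul (β ^ 2)) |>.const_mul (1 / h)
    refine this.congr (Eventually.of_forall fun x => ?_)
    simp only [hg, sq_mul_scaledKernel, Pi.add_apply]
  have h1 : cT * ∫ x in Icc a b, g x ≤ ∫ x, g x ∂τ := by
    have := integral_mono_measure hτ (Eventually.of_forall hg0) (hgint τ inferInstance)
    rwa [integral_smul_measure, ENNReal.toReal_ofReal hcT.le, smul_eq_mul] at this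
  have hsub : ∀ x y, x ≤ y → Icc x y ⊆ Icc a b →
      ∫ u in x..y, g u ≤ ∫ u in Icc a b, g u := by
    intro x y hxy hs'
    rw [intervalIntegral.integral_of_le hxy, ← integral_Icc_eq_integral_Ioc]
    exact setIntegral_mono_set (hgint _ inferInstance) (Eventually.of_forall hg0)
      hs'.eventuallyLE
  have hgu : ∀ u, g u = (1 / h) * ((α + β * ((u - s) / h)) ^ 2 * K ((u - s) / h)) := by
    intro u; simp only [hg, scaledKernel]; ring
  have hsubst : ∀ x y : ℝ, ∫ u in (s + h * x)..(s + h * y), g u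
      = ∫ u in x..y, (α + β * u) ^ 2 * K u := by
    intro x y
    simp only [hgu]
    rw [intervalIntegral.integral_const_mul]
    have := intervalIntegral.integral_comp_div_sub
      (a := s + h * x) (b := s + h * y) (fun u => (α + β * u) ^ 2 * K u) hh.ne' (s / h)
    simp only [← sub_div] at this
    rw [this]
    have e : ∀ x, (s + h * x - s) / h = x := fun x => by field_simp; ring
    rw [e, e, smul_eq_mul, one_div, inv_mul_cancel_left₀ hh.ne']
  have key : c * (α ^ 2 + β ^ 2) ≤ ∫ u in Icc a b, g u := by
    -- As `h ≤ (b - a) / 2`, the right half window fits into `[a, b]` for `s` left of the midpoint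
    -- and the left half window otherwise; the latter is reflected by symmetry of the kernel, which
    -- turns `β` into `-β`.
    rcases le_total s ((a + b) / 2) with hsm | hsm
    · have h2 := hsub (s + h * 0) (s + h * 1) (by linarith)
        (Icc_subset_Icc (by linarith [hs.1]) (by linarith))
      rw [hsubst] at h2
      exact (hcq α β).trans h2
    · have h2 := hsub (s + h * (-1)) (s + h * 0) (by linarith)
        (Icc_subset_Icc (by linarith) (by linarith [hs.2]))
      rw [hsubst] at h2
      have h3 : ∫ u in (-1 : ℝ)..0, (α + β * u) ^ 2 * K u
          = ∫ u in (0 : ℝ)..1, (α + (-β) * u) ^ 2 * K u := by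
        have := intervalIntegral.integral_comp_neg (a := 0) (b := 1)
          fun u => (α + β * u) ^ 2 * K u
        rw [neg_zero] at this
        rw [← this]
        refine intervalIntegral.integral_congr fun u _ => ?_
        simp only [hK.symm]; ring
      rw [h3] at h2
      have h4 := (hcq α (-β)).trans h2
      rwa [neg_sq] at h4
  calc cT * c * (α ^ 2 + β ^ 2) = cT * (c * (α ^ 2 + β ^ 2)) := by ring
    _ ≤ cT * ∫ u in Icc a b, g u := mul_le_mul_of_nonneg_left key hcT.le
    _ ≤ _ := h1

/-! ### Almost sure uniform rates for sums of independent variables -/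

section Concentration

variable {Ω : Type*} [MeasurableSpace Ω] {P : Measure Ω} [IsProbabilityMeasure P]

/-- From `exp x ≤ 1 + x + x²` for `|x| ≤ 1`: the linear term integrates to zero and `1 + y ≤ exp y`.
-/
theorem mgf_le_of_bounded {W : Ω → ℝ} (hm : Measurable W) {B θ : ℝ} (hB : ∀ ω, |W ω| ≤ B)
    (h0 : ∫ ω, W ω ∂P = 0) (hθ : 0 ≤ θ) (hθB : θ * B ≤ 1) :
    mgf W P θ ≤ exp (θ ^ 2 * ∫ ω, W ω ^ 2 ∂P) := by
  have hW : Integrable W P := Integrable.of_bound hm.aestronglyMeasurable B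
    (Eventually.of_forall fun ω => hB ω)
  have hW2 : Integrable (fun ω => W ω ^ 2) P :=
    Integrable.of_bound (hm.pow_const 2).aestronglyMeasurable (B ^ 2)
      (Eventually.of_forall fun ω => by
        rw [Real.norm_eq_abs, abs_pow]
        exact pow_le_pow_left₀ (abs_nonneg _) (hB ω) 2)
  have hpt : ∀ ω, exp (θ * W ω) ≤ 1 + θ * W ω + θ ^ 2 * W ω ^ 2 := by
    intro ω
    have h1 : |θ * W ω| ≤ 1 := by
      rw [abs_mul, abs_of_nonneg hθ]
      exact (mul_le_mul_of_nonneg_left (hB ω) hθ).trans hθB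
    have := (abs_le.1 (Real.abs_exp_sub_one_sub_id_le h1)).2
    nlinarith
  have hexp : Integrable (fun ω => exp (θ * W ω)) P :=
    Integrable.of_bound (by fun_prop) (exp (θ * B)) (Eventually.of_forall fun ω => by
      rw [Real.norm_eq_abs, abs_of_pos (exp_pos _)]
      exact exp_le_exp.2 (mul_le_mul_of_nonneg_left ((le_abs_self _).trans (hB ω)) hθ))
  calc mgf W P θ = ∫ ω, exp (θ * W ω) ∂P := rfl
    _ ≤ ∫ ω, (1 + θ * W ω + θ ^ 2 * W ω ^ 2) ∂P :=
        integral_mono hexp (((integrable_const _).add (hW.const_mul _)).add (hW2.const_mul _)) hpt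
    _ = 1 + θ ^ 2 * ∫ ω, W ω ^ 2 ∂P := by
        have i1 : Integrable (fun ω => 1 + θ * W ω) P := (integrable_const _).add (hW.const_mul _)
        rw [integral_add i1 (hW2.const_mul _),
          integral_add (integrable_const _) (hW.const_mul _), integral_const_mul,
          integral_const_mul, h0]
        simp
    _ ≤ _ := by rw [add_comm]; exact add_one_le_exp _

theorem measure_sum_ge_le {W : ℕ → Ω → ℝ} (hind : iIndepFun W P) (hm : ∀ i, Measurable (W i))
    {n : ℕ} {B θ V : ℝ} (hB : ∀ i ω, |W i ω| ≤ B) (h0 : ∀ i, ∫ ω, W i ω ∂P = 0)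
    (hV : ∑ i ∈ Finset.range n, ∫ ω, W i ω ^ 2 ∂P ≤ V) (hθ : 0 ≤ θ) (hθB : θ * B ≤ 1) (x : ℝ) :
    P.real {ω | x ≤ ∑ i ∈ Finset.range n, W i ω} ≤ exp (-(θ * x) + θ ^ 2 * V) := by
  have hS : ∀ ω, |(∑ i ∈ Finset.range n, W i) ω| ≤ n * B := by
    intro ω
    rw [Finset.sum_apply]
    refine (Finset.abs_sum_le_sum_abs _ _).trans ?_
    refine (Finset.sum_le_sum fun i _ => hB i ω).trans ?_
    simp
  have hSm : Measurable (∑ i ∈ Finset.range n, W i) := by fun_prop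
  have hexp : Integrable (fun ω => exp (θ * (∑ i ∈ Finset.range n, W i) ω)) P :=
    Integrable.of_bound (by fun_prop) (exp (θ * (n * B))) (Eventually.of_forall fun ω => by
      rw [Real.norm_eq_abs, abs_of_pos (exp_pos _)]
      exact exp_le_exp.2 (mul_le_mul_of_nonneg_left ((le_abs_self _).trans (hS ω)) hθ))
  have h := measure_ge_le_exp_mul_mgf (μ := P) x hθ hexp
  simp only [Finset.sum_apply] at h
  refine h.trans ?_
  rw [hind.mgf_sum hm, exp_add, neg_mul]
  refine mul_le_mul_of_nonneg_left ?_ (exp_pos _).le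
  calc ∏ i ∈ Finset.range n, mgf (W i) P θ
      ≤ ∏ i ∈ Finset.range n, exp (θ ^ 2 * ∫ ω, W i ω ^ 2 ∂P) :=
        Finset.prod_le_prod (fun i _ => mgf_nonneg)
          fun i _ => mgf_le_of_bounded (hm i) (hB i) (h0 i) hθ hθB
    _ = exp (θ ^ 2 * ∑ i ∈ Finset.range n, ∫ ω, W i ω ^ 2 ∂P) := by
        rw [← exp_sum, Finset.mul_sum]
    _ ≤ _ := exp_le_exp.2 (mul_le_mul_of_nonneg_left hV (sq_nonneg _))

/-- A one-parameter form of Bernstein's inequality. -/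
theorem measure_abs_sum_ge_le {W : ℕ → Ω → ℝ} (hind : iIndepFun W P)
    (hm : ∀ i, Measurable (W i))
    {n : ℕ} {B θ V : ℝ} (hB : ∀ i ω, |W i ω| ≤ B) (h0 : ∀ i, ∫ ω, W i ω ∂P = 0)
    (hV : ∑ i ∈ Finset.range n, ∫ ω, W i ω ^ 2 ∂P ≤ V) (hθ : 0 ≤ θ) (hθB : θ * B ≤ 1) (x : ℝ) :
    P.real {ω | x ≤ |∑ i ∈ Finset.range n, W i ω|} ≤ 2 * exp (-(θ * x) + θ ^ 2 * V) := by
  have h1 := measure_sum_ge_le hind hm hB h0 hV hθ hθB x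
  have h2 := measure_sum_ge_le (W := fun i ω => -W i ω) (P := P)
    (hind.comp (fun _ x => -x) fun _ => measurable_neg) (fun i => (hm i).neg) (n := n) (B := B)
    (V := V) (θ := θ) (fun i ω => by rw [abs_neg]; exact hB i ω)
    (fun i => by rw [integral_neg, h0, neg_zero]) (by simpa only [neg_sq] using hV) hθ hθB x
  have hsub : {ω | x ≤ |∑ i ∈ Finset.range n, W i ω|} ⊆
      {ω | x ≤ ∑ i ∈ Finset.range n, W i ω} ∪ {ω | x ≤ ∑ i ∈ Finset.range n, -W i ω} := by
    intro ω hω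
    simp only [mem_ofPred_eq, mem_union, Finset.sum_neg_distrib] at hω ⊢
    exact le_abs.1 hω
  calc _ ≤ _ := measureReal_mono hsub
    _ ≤ _ := measureReal_union_le _ _
    _ ≤ _ := by linarith

/-- Truncation at level `Q`. -/
noncomputable def trunc (Q x : ℝ) : ℝ := if |x| ≤ Q then x else 0

theorem measurable_trunc (Q : ℝ) : Measurable (trunc Q) :=
  Measurable.ite (measurableSet_le measurable_id.abs measurable_const) measurable_id
    measurable_const

theorem abs_trunc_le {Q : ℝ} (hQ : 0 ≤ Q) (x : ℝ) : |trunc Q x| ≤ Q := by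
  unfold trunc
  split_ifs with h
  · exact h
  · simpa using hQ

theorem abs_trunc_le_abs (Q x : ℝ) : |trunc Q x| ≤ |x| := by
  unfold trunc
  split_ifs with h
  · exact le_rfl
  · simp

/-- On the event that truncation acts, `g > Q`, and `g = g ^ (1 - lam) * g ^ lam` with a negative
power of `g` in front. Stating it with an envelope `g` lets one strong law for the envelopes serve
all evaluation points simultaneously. -/
theorem abs_sub_trunc_le {Q x g lam : ℝ} (hQ : 0 < Q) (hlam : 1 < lam) (hg : |x| ≤ g) :
    |x - trunc Q x| ≤ Q ^ (1 - lam) * g ^ lam := by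
  unfold trunc
  have hg0 : 0 ≤ g := (abs_nonneg _).trans hg
  split_ifs with h
  · rw [sub_self, abs_zero]
    positivity
  · push Not at h
    have hgQ : Q < g := h.trans_le hg
    have hgp : 0 < g := hQ.trans hgQ
    rw [sub_zero]
    calc |x| ≤ g := hg
      _ = g ^ (1 - lam) * g ^ lam := by rw [← rpow_add hgp]; simp
      _ ≤ _ := mul_le_mul_of_nonneg_right
          (rpow_le_rpow_of_nonpos hQ hgQ.le (by linarith)) (by positivity)

/-- The tail bound behind the almost sure rate, for a single sample size. -/
theorem measure_abs_sum_trunc_ge_le {Z : ℕ → Ω → ℝ} (hind : iIndepFun Z P)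
    (hm : ∀ i, Measurable (Z i)) {n : ℕ} {Q θ V : ℝ} (hQ : 0 ≤ Q)
    (hV : ∑ i ∈ Finset.range n, ∫⁻ ω, ‖Z i ω‖ₑ ^ 2 ∂P ≤ ENNReal.ofReal V) (hV0 : 0 ≤ V)
    (hθ : 0 ≤ θ) (hθB : θ * (2 * Q) ≤ 1) (x : ℝ) :
    P.real {ω | x ≤ |∑ i ∈ Finset.range n, (trunc Q (Z i ω) - ∫ ω', trunc Q (Z i ω') ∂P)|}
      ≤ 2 * exp (-(θ * x) + θ ^ 2 * V) := by
  have hmt : ∀ i, Measurable fun ω => trunc Q (Z i ω) := fun i => (measurable_trunc Q).comp (hm i)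
  have hti : ∀ i, Integrable (fun ω => trunc Q (Z i ω)) P := fun i =>
    Integrable.of_bound (hmt i).aestronglyMeasurable Q
      (Eventually.of_forall fun ω => abs_trunc_le hQ _)
  have hE : ∀ i, |∫ ω', trunc Q (Z i ω') ∂P| ≤ Q := fun i => by
    have := norm_integral_le_of_norm_le_const (μ := P)
      (f := fun ω => trunc Q (Z i ω)) (Eventually.of_forall fun ω => abs_trunc_le hQ (Z i ω))
    simpa using this
  have hti2 : ∀ i, Integrable (fun ω => trunc Q (Z i ω) ^ 2) P := fun i =>
    Integrable.of_bound ((hmt i).pow_const 2).aestronglyMeasurable (Q ^ 2)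
      (Eventually.of_forall fun ω => by
        rw [Real.norm_eq_abs, abs_pow]
        exact pow_le_pow_left₀ (abs_nonneg _) (abs_trunc_le hQ _) 2)
  refine measure_abs_sum_ge_le (B := 2 * Q)
    (W := fun i ω => trunc Q (Z i ω) - ∫ ω', trunc Q (Z i ω') ∂P)
    (hind.comp (fun i x => trunc Q x - ∫ ω', trunc Q (Z i ω') ∂P)
      fun i => (measurable_trunc Q).sub_const _)
    (fun i => (hmt i).sub_const _) (fun i ω => ?_) (fun i => ?_) ?_ hθ hθB x
  · have := abs_sub (trunc Q (Z i ω)) (∫ ω', trunc Q (Z i ω') ∂P)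
    linarith [abs_trunc_le hQ (Z i ω), hE i]
  · rw [integral_sub (hti i) (integrable_const _)]
    simp
  · have hfin : ∀ i ∈ Finset.range n, ∫⁻ ω, ‖Z i ω‖ₑ ^ 2 ∂P ≠ ∞ := fun i hi =>
      ((Finset.single_le_sum (f := fun i => ∫⁻ ω, ‖Z i ω‖ₑ ^ 2 ∂P) (fun _ _ => zero_le)
        hi).trans_lt (hV.trans_lt ENNReal.ofReal_lt_top)).ne
    have hstep : ∀ i ∈ Finset.range n,
        ∫ ω, (trunc Q (Z i ω) - ∫ ω', trunc Q (Z i ω') ∂P) ^ 2 ∂P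
          ≤ (∫⁻ ω, ‖Z i ω‖ₑ ^ 2 ∂P).toReal := by
      intro i hi
      set e := ∫ ω', trunc Q (Z i ω') ∂P
      have h1 : ∫ ω, (trunc Q (Z i ω) - e) ^ 2 ∂P ≤ ∫ ω, trunc Q (Z i ω) ^ 2 ∂P := by
        have e1 : ∀ ω, (trunc Q (Z i ω) - e) ^ 2
            = trunc Q (Z i ω) ^ 2 - 2 * e * trunc Q (Z i ω) + e ^ 2 := fun ω => by ring
        simp only [e1]
        have i1 : Integrable (fun ω => trunc Q (Z i ω) ^ 2 - 2 * e * trunc Q (Z i ω)) P :=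
          (hti2 i).sub ((hti i).const_mul _)
        rw [integral_add i1 (integrable_const _),
          integral_sub (hti2 i) ((hti i).const_mul _), integral_const_mul]
        simp only [integral_const, probReal_univ, smul_eq_mul, one_mul]
        change _ - 2 * e * e + e ^ 2 ≤ _
        nlinarith [sq_nonneg e]
      refine h1.trans ?_
      rw [integral_eq_lintegral_of_nonneg_ae (Eventually.of_forall fun ω => sq_nonneg _)
        ((hmt i).pow_const 2).aestronglyMeasurable]
      refine ENNReal.toReal_mono (hfin i hi) (lintegral_mono fun ω => ?_)
      rw [← enorm_pow, Real.enorm_of_nonneg (sq_nonneg (Z i ω))]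
      exact ENNReal.ofReal_le_ofReal (sq_le_sq.2 (abs_trunc_le_abs _ _))
    refine (Finset.sum_le_sum hstep).trans ?_
    rw [← ENNReal.toReal_sum hfin]
    exact ENNReal.toReal_le_of_le_ofReal hV0 hV

/-- The order of magnitude `n a_n` of the sums. -/
noncomputable def sumRate (β : ℕ → ℝ) (n : ℕ) : ℝ := √(n * β n * Real.log n)

/-- The truncation level. -/
noncomputable def truncLevel (lam : ℝ) (n : ℕ) : ℝ := (Real.log n / n) ^ (-(1 / lam))

/-- The truncation level is the one at which the tail contribution `n Q ^ (1 - lam)` equals `Q log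
n`. Bernstein's inequality at scale `r` tolerates summands with `Q log n ≤ r`, and for `r = √(n β
log n)` this is precisely the lower bound on `β`. -/
theorem truncLevel_mul_log_le {β lam : ℝ} (hlam : 0 < lam) {n : ℕ} (hn : 2 ≤ n)
    (hβ : (Real.log n / n) ^ (1 - 2 / lam) ≤ β) :
    0 < truncLevel lam n ∧ truncLevel lam n * Real.log n ≤ √(n * β * Real.log n) ∧
      n * truncLevel lam n ^ (1 - lam) = truncLevel lam n * Real.log n := by
  have hn0 : (0 : ℝ) < n := by positivity
  have hlog : 0 < Real.log n := Real.log_pos (by exact_mod_cast hn)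
  set l := Real.log n / n with hl
  have hl0 : 0 < l := div_pos hlog hn0
  have hnl : Real.log n = n * l := by rw [hl]; field_simp
  have hQ : 0 < truncLevel lam n := rpow_pos_of_pos hl0 _
  refine ⟨hQ, ?_, ?_⟩
  · apply Real.le_sqrt_of_sq_le
    calc (truncLevel lam n * Real.log n) ^ 2
        = n * (l ^ (-(1 / lam)) * l ^ (-(1 / lam)) * l) * Real.log n := by
          unfold truncLevel; rw [← hl, hnl]; ring
      _ = n * l ^ (1 - 2 / lam) * Real.log n := by
          congr 2
          nth_rewrite 3 [← rpow_one l]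
          rw [← rpow_add hl0, ← rpow_add hl0]
          congr 1; ring
      _ ≤ _ := by gcongr
  · unfold truncLevel
    rw [← hl, hnl, ← rpow_mul hl0.le]
    have : l ^ (-(1 / lam) * (1 - lam)) = l ^ (-(1 / lam)) * l := by
      nth_rewrite 3 [← rpow_one l]
      rw [← rpow_add hl0]
      congr 1; field_simp; ring
    rw [this]; ring

/-- Simultaneous almost sure rate over polynomially many sums of independent variables with a
common envelope. -/
theorem ae_eventually_abs_sum_le {κ : Type*} {grid : ℕ → Finset κ} {N : ℕ} {Cg : ℝ}
    (hgrid : ∀ n, 1 ≤ n → ((grid n).card : ℝ) ≤ Cg * (n : ℝ) ^ N)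
    {β : ℕ → ℝ} {lam : ℝ} (hlam : 1 < lam)
    (hβ : ∀ᶠ n : ℕ in atTop, (Real.log n / n) ^ (1 - 2 / lam) ≤ β n)
    {Z : ℕ → ℕ → κ → Ω → ℝ} (hm : ∀ n i k, Measurable (Z n i k))
    (hind : ∀ n k, iIndepFun (fun i => Z n i k) P)
    {G : ℕ → Ω → ℝ} (hZG : ∀ᵐ ω ∂P, ∀ n, ∀ i < n, ∀ k ∈ grid n, |Z n i k ω| ≤ G i ω)
    (hGsum : ∀ᵐ ω ∂P, ∃ C : ℝ, ∀ᶠ n : ℕ in atTop, ∑ i ∈ Finset.range n, G i ω ^ lam ≤ C * n)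
    {CG : ℝ} (hGint : ∀ i, Integrable (fun ω => G i ω ^ lam) P)
    (hGmean : ∀ i, ∫ ω, G i ω ^ lam ∂P ≤ CG)
    {CV : ℝ} (hV : ∀ᶠ n : ℕ in atTop, ∀ k ∈ grid n,
      ∑ i ∈ Finset.range n, ∫⁻ ω, ‖Z n i k ω‖ₑ ^ 2 ∂P ≤ ENNReal.ofReal (CV * (n * β n))) :
    ∀ᵐ ω ∂P, ∃ C : ℝ, ∀ᶠ n : ℕ in atTop, ∀ k ∈ grid n,
      |∑ i ∈ Finset.range n, (Z n i k ω - ∫ ω', Z n i k ω' ∂P)| ≤ C * sumRate β n := by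
  wlog hCV : 0 ≤ CV generalizing CV
  · refine this (CV := 0) ?_ le_rfl
    filter_upwards [hV, hβ, eventually_ge_atTop 2] with n h1 h2 hn k hk
    refine (h1 k hk).trans (ENNReal.ofReal_le_ofReal ?_)
    have hn0 : (0 : ℝ) < n := by positivity
    have hlog : 0 < Real.log n := Real.log_pos (by exact_mod_cast hn)
    have : 0 ≤ β n := le_trans (by positivity) h2
    rw [zero_mul]
    exact mul_nonpos_of_nonpos_of_nonneg (le_of_not_ge hCV) (by positivity)
  -- With `θ = log n / (2 r)` the Bernstein exponent is `-A log n / 2 + CV log n / 4 = -(CV / 4 + N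
  -- + 2) log n + CV log n / 4`, so each probability is at most `2 n ^ (-(N + 2))`, and the union
  -- over `Cg n ^ N` points is summable.
  set A : ℝ := CV / 2 + 2 * (N + 2) with hA
  set Q : ℕ → ℝ := truncLevel lam with hQ
  obtain ⟨n₀, hn₀⟩ := eventually_atTop.1 ((hβ.and hV).and (eventually_ge_atTop 2))
  have facts := fun n (hn : n₀ ≤ n) =>
    truncLevel_mul_log_le (by linarith : 0 < lam) (hn₀ n hn).2 (hn₀ n hn).1.1
  set bad : ℕ → Set Ω := fun n => if n₀ ≤ n then ⋃ k ∈ grid n, {ω | A * sumRate β n ≤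
    |∑ i ∈ Finset.range n, (trunc (Q n) (Z n i k ω) - ∫ ω', trunc (Q n) (Z n i k ω') ∂P)|}
    else ∅ with hbad
  have hbadP : ∀ n, P (bad n) ≤ ENNReal.ofReal (2 * Cg * (1 / (n : ℝ) ^ 2)) := by
    intro n
    by_cases hn : n₀ ≤ n
    swap
    · simp [hbad, hn]
    obtain ⟨hQ0, hQr, -⟩ := facts n hn
    have hn2 := (hn₀ n hn).2
    have hn0 : (0 : ℝ) < n := by positivity
    have hlog : 0 < Real.log n := Real.log_pos (by exact_mod_cast hn2)
    have hr : 0 < sumRate β n := lt_of_lt_of_le (mul_pos hQ0 hlog) hQr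
    have hβ0 : 0 ≤ β n := le_trans (by positivity) (hn₀ n hn).1.1
    have hr2 : sumRate β n ^ 2 = n * β n * Real.log n := Real.sq_sqrt (by positivity)
    have hk : ∀ k ∈ grid n, P.real {ω | A * sumRate β n ≤
        |∑ i ∈ Finset.range n, (trunc (Q n) (Z n i k ω) - ∫ ω', trunc (Q n) (Z n i k ω') ∂P)|}
          ≤ 2 * (1 / (n : ℝ) ^ (N + 2)) := by
      intro k hk
      -- The centred truncated summands are bounded by `2 Q`; the requirement `θ * (2 Q) ≤ 1` is `Q
      -- log n ≤ sumRate β n`.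
      have h := measure_abs_sum_trunc_ge_le (hind n k) (fun i => hm n i k) hQ0.le
        ((hn₀ n hn).1.2 k hk) (by positivity) (θ := Real.log n / (2 * sumRate β n))
        (by positivity) (by
          rw [div_mul_eq_mul_div, div_le_one (by positivity)]
          change _ ≤ 2 * √(n * β n * Real.log n)
          linarith) (A * sumRate β n)
      refine h.trans (mul_le_mul_of_nonneg_left ?_ (by norm_num))
      have e1 : -(Real.log n / (2 * sumRate β n) * (A * sumRate β n))
          + (Real.log n / (2 * sumRate β n)) ^ 2 * (CV * (n * β n))
          = -((N + 2 : ℕ) * Real.log n) := by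
        have e2 : (Real.log n / (2 * sumRate β n)) ^ 2 * (CV * (n * β n))
            = CV * Real.log n / 4 := by
          rw [div_pow, mul_pow, hr2]
          by_cases hb : β n = 0
          · exfalso
            rw [hb] at hr2
            simp at hr2
            exact hr.ne' hr2
          · field_simp; ring
        have e3 : Real.log n / (2 * sumRate β n) * (A * sumRate β n) = A * Real.log n / 2 := by
          field_simp
        rw [e2, e3, hA]
        push_cast
        ring
      rw [e1, exp_neg, ← Real.log_pow, exp_log (by positivity), one_div]
    have hsum : P.real (bad n) ≤ 2 * Cg * (1 / (n : ℝ) ^ 2) := by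
      simp only [hbad, hn, if_true]
      refine (measureReal_biUnion_finset_le _ _).trans ((Finset.sum_le_sum hk).trans ?_)
      rw [Finset.sum_const, nsmul_eq_mul]
      calc ((grid n).card : ℝ) * (2 * (1 / (n : ℝ) ^ (N + 2)))
          ≤ (Cg * (n : ℝ) ^ N) * (2 * (1 / (n : ℝ) ^ (N + 2))) :=
            mul_le_mul_of_nonneg_right (hgrid n (by omega)) (by positivity)
        _ = _ := by rw [pow_add]; field_simp
    rw [← ENNReal.ofReal_toReal (measure_ne_top P (bad n))]
    exact ENNReal.ofReal_le_ofReal hsum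
  have hBC := ae_eventually_notMem (μ := P) (s := bad) (ne_top_of_le_ne_top
    ((Real.summable_one_div_nat_pow.2 one_lt_two).mul_left (2 * Cg)).tsum_ofReal_ne_top
    (ENNReal.tsum_le_tsum hbadP))
  filter_upwards [hBC, hZG, hGsum] with ω h1 h2 ⟨C, h3⟩
  have hC : ∀ᶠ n : ℕ in atTop, ∑ i ∈ Finset.range n, G i ω ^ lam ≤ |C| * n := by
    filter_upwards [h3] with n hn
    exact hn.trans (mul_le_mul_of_nonneg_right (le_abs_self C) (Nat.cast_nonneg n))
  refine ⟨A + |C| + |CG|, ?_⟩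
  filter_upwards [h1, hC, eventually_ge_atTop n₀] with n hn1 hn3 hn k hk
  obtain ⟨hQ0, hQr, hQn⟩ := facts n hn
  have hmain : |∑ i ∈ Finset.range n,
      (trunc (Q n) (Z n i k ω) - ∫ ω', trunc (Q n) (Z n i k ω') ∂P)| ≤ A * sumRate β n := by
    by_contra hlt
    apply hn1
    simp only [hbad, hn, if_true, mem_iUnion]
    exact ⟨k, hk, (not_le.1 hlt).le⟩
  -- The tails are handled pathwise: the sum of `G i ^ lam` grows at most linearly for this `ω`, and
  -- `n Q ^ (1 - lam) = Q log n` is at most the rate.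
  have htail : |∑ i ∈ Finset.range n, (Z n i k ω - trunc (Q n) (Z n i k ω))|
      ≤ |C| * sumRate β n := by
    calc _ ≤ ∑ i ∈ Finset.range n, |Z n i k ω - trunc (Q n) (Z n i k ω)| :=
          Finset.abs_sum_le_sum_abs _ _
      _ ≤ ∑ i ∈ Finset.range n, Q n ^ (1 - lam) * G i ω ^ lam :=
          Finset.sum_le_sum fun i hi =>
            abs_sub_trunc_le hQ0 hlam (h2 n i (Finset.mem_range.1 hi) k hk)
      _ = Q n ^ (1 - lam) * ∑ i ∈ Finset.range n, G i ω ^ lam := by rw [Finset.mul_sum]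
      _ ≤ Q n ^ (1 - lam) * (|C| * n) := mul_le_mul_of_nonneg_left hn3 (rpow_nonneg hQ0.le _)
      _ = |C| * (n * Q n ^ (1 - lam)) := by ring
      _ = |C| * (Q n * Real.log n) := by rw [hQn]
      _ ≤ _ := mul_le_mul_of_nonneg_left hQr (abs_nonneg _)
  have hZint : ∀ i ∈ Finset.range n, Integrable (Z n i k) P := by
    intro i hi
    have hfin : ∫⁻ ω, ‖Z n i k ω‖ₑ ^ 2 ∂P < ∞ :=
      (Finset.single_le_sum (f := fun i => ∫⁻ ω, ‖Z n i k ω‖ₑ ^ 2 ∂P) (fun _ _ => zero_le)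
        hi).trans_lt (((hn₀ n hn).1.2 k hk).trans_lt ENNReal.ofReal_lt_top)
    have : MemLp (Z n i k) 2 P := by
      refine ⟨(hm n i k).aestronglyMeasurable, ?_⟩
      rw [eLpNorm_lt_top_iff_lintegral_rpow_enorm_lt_top (by norm_num) (by norm_num)]
      simpa using hfin
    exact this.integrable (by norm_num)
  have hmean : |∑ i ∈ Finset.range n,
      (∫ ω', trunc (Q n) (Z n i k ω') ∂P - ∫ ω', Z n i k ω' ∂P)| ≤ |CG| * sumRate β n := by
    calc _ ≤ ∑ i ∈ Finset.range n, |∫ ω', trunc (Q n) (Z n i k ω') ∂P - ∫ ω', Z n i k ω' ∂P| :=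
          Finset.abs_sum_le_sum_abs _ _
      _ ≤ ∑ i ∈ Finset.range n, Q n ^ (1 - lam) * |CG| := by
          refine Finset.sum_le_sum fun i hi => ?_
          have hti : Integrable (fun ω => trunc (Q n) (Z n i k ω)) P :=
            Integrable.of_bound ((measurable_trunc _).comp (hm n i k)).aestronglyMeasurable (Q n)
              (Eventually.of_forall fun ω => abs_trunc_le hQ0.le _)
          rw [← integral_sub hti (hZint i hi)]
          refine (norm_integral_le_of_norm_le ((hGint i).const_mul (Q n ^ (1 - lam)))
            (f := fun ω => trunc (Q n) (Z n i k ω) - Z n i k ω) ?_).trans ?_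
          · filter_upwards [hZG] with ω' h
            rw [norm_sub_rev]
            exact abs_sub_trunc_le hQ0 hlam (h n i (Finset.mem_range.1 hi) k hk)
          · rw [integral_const_mul]
            exact mul_le_mul_of_nonneg_left ((hGmean i).trans (le_abs_self _))
              (rpow_nonneg hQ0.le _)
      _ = |CG| * (n * Q n ^ (1 - lam)) := by
          rw [Finset.sum_const, Finset.card_range, nsmul_eq_mul]; ring
      _ = |CG| * (Q n * Real.log n) := by rw [hQn]
      _ ≤ _ := mul_le_mul_of_nonneg_left hQr (abs_nonneg _)
  have hsplit : ∑ i ∈ Finset.range n, (Z n i k ω - ∫ ω', Z n i k ω' ∂P)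
      = ∑ i ∈ Finset.range n, (trunc (Q n) (Z n i k ω) - ∫ ω', trunc (Q n) (Z n i k ω') ∂P)
        + ∑ i ∈ Finset.range n, (Z n i k ω - trunc (Q n) (Z n i k ω))
        + ∑ i ∈ Finset.range n,
          (∫ ω', trunc (Q n) (Z n i k ω') ∂P - ∫ ω', Z n i k ω' ∂P) := by
    rw [← Finset.sum_add_distrib, ← Finset.sum_add_distrib]
    exact Finset.sum_congr rfl fun i _ => by ring
  rw [hsplit]
  refine (abs_add_three _ _ _).trans ?_
  linarith

end Concentration

/-! ### Kernel averages over curves -/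

section Averages

variable {Ω ι E : Type*}

/-- The average of `f` over a finite index set. -/
noncomputable def favg (s : Finset ι) (f : ι → ℝ) : ℝ := (s.card : ℝ)⁻¹ * ∑ l ∈ s, f l

theorem favg_mono {s : Finset ι} {f g : ι → ℝ} (h : ∀ l ∈ s, f l ≤ g l) : favg s f ≤ favg s g :=
  mul_le_mul_of_nonneg_left (Finset.sum_le_sum h) (by positivity)

theorem favg_const_mul (s : Finset ι) (c : ℝ) (f : ι → ℝ) :
    favg s (fun l => c * f l) = c * favg s f := by
  simp only [favg, ← Finset.mul_sum]; ring

theorem favg_add (s : Finset ι) (f g : ι → ℝ) :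
    favg s (fun l => f l + g l) = favg s f + favg s g := by
  simp only [favg, Finset.sum_add_distrib]; ring

theorem favg_sub (s : Finset ι) (f g : ι → ℝ) :
    favg s (fun l => f l - g l) = favg s f - favg s g := by
  simp only [favg, Finset.sum_sub_distrib]; ring

theorem favg_const {s : Finset ι} (hs : s.Nonempty) (c : ℝ) : favg s (fun _ => c) = c := by
  have : (s.card : ℝ) ≠ 0 := by exact_mod_cast hs.card_ne_zero
  simp [favg, this]

theorem favg_const_le (s : Finset ι) {c : ℝ} (hc : 0 ≤ c) : favg s (fun _ => c) ≤ c := by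
  rcases s.eq_empty_or_nonempty with rfl | hs
  · simpa [favg] using hc
  · exact (favg_const hs c).le

theorem abs_favg_le (s : Finset ι) (f : ι → ℝ) : |favg s f| ≤ favg s fun l => |f l| := by
  unfold favg
  rw [abs_mul, abs_of_nonneg (by positivity : (0 : ℝ) ≤ (s.card : ℝ)⁻¹)]
  exact mul_le_mul_of_nonneg_left (Finset.abs_sum_le_sum_abs _ _) (by positivity)

theorem measurable_favg {m : MeasurableSpace Ω} {s : Finset ι} {f : ι → Ω → ℝ}
    (h : ∀ l, Measurable[m] (f l)) : Measurable[m] fun ω => favg s fun l => f l ω := by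
  unfold favg
  exact (Finset.measurable_sum _ fun l _ => h l).const_mul _

variable [mΩ : MeasurableSpace Ω] {P : Measure Ω}

theorem integral_favg {s : Finset ι} {f : ι → Ω → ℝ} (h : ∀ l ∈ s, Integrable (f l) P) :
    ∫ ω, favg s (fun l => f l ω) ∂P = favg s fun l => ∫ ω, f l ω ∂P := by
  unfold favg
  rw [integral_const_mul, integral_finsetSum _ h]

theorem integrable_favg {s : Finset ι} {f : ι → Ω → ℝ} (h : ∀ l ∈ s, Integrable (f l) P) :
    Integrable (fun ω => favg s fun l => f l ω) P :=
  (integrable_finsetSum _ h).const_mul _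

/-- The responses depend on the design, so they are first replaced by envelopes that do not. Then
every entry of the expanded square factors into an envelope moment and a design integral. No
cancellation between different observations of a curve is claimed; dependence within a curve is
arbitrary. -/
theorem lintegral_favg_sq_le {𝓩 𝓣 : MeasurableSpace Ω} (h𝓩 : 𝓩 ≤ mΩ) (h𝓣 : 𝓣 ≤ mΩ)
    (hind : Indep 𝓩 𝓣 P) {s : Finset ι} {y Z W : ι → Ω → ℝ}
    (hZm : ∀ l, Measurable[𝓩] (Z l)) (hWm : ∀ l, Measurable[𝓣] (W l))
    (hy : ∀ᵐ ω ∂P, ∀ l, |y l ω| ≤ Z l ω) {CZ : ℝ≥0∞}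
    (hZ : ∀ l ∈ s, ∀ l' ∈ s, ∫⁻ ω, ENNReal.ofReal (Z l ω * Z l' ω) ∂P ≤ CZ) :
    ∫⁻ ω, ‖favg s fun l => y l ω * W l ω‖ₑ ^ 2 ∂P ≤ CZ * (ENNReal.ofReal ((s.card : ℝ)⁻¹ ^ 2) *
      ∑ l ∈ s, ∑ l' ∈ s, ∫⁻ ω, ‖W l ω * W l' ω‖ₑ ∂P) := by
  have hpt : ∀ᵐ ω ∂P, ‖favg s fun l => y l ω * W l ω‖ₑ ^ 2 ≤
      ENNReal.ofReal ((s.card : ℝ)⁻¹ ^ 2) * ∑ l ∈ s, ∑ l' ∈ s,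
        ENNReal.ofReal (Z l ω * Z l' ω) * ‖W l ω * W l' ω‖ₑ := by
    filter_upwards [hy] with ω hω
    have hZ0 : ∀ l, 0 ≤ Z l ω := fun l => (abs_nonneg _).trans (hω l)
    have e1 : ∀ l l', ENNReal.ofReal (Z l ω * Z l' ω) * ‖W l ω * W l' ω‖ₑ
        = ENNReal.ofReal ((Z l ω * |W l ω|) * (Z l' ω * |W l' ω|)) := by
      intro l l'
      rw [Real.enorm_eq_ofReal_abs, ← ENNReal.ofReal_mul (mul_nonneg (hZ0 l) (hZ0 l')), abs_mul]
      congr 1; ring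
    have hn : ∀ l, 0 ≤ Z l ω * |W l ω| := fun l => mul_nonneg (hZ0 l) (abs_nonneg _)
    simp only [e1]
    have e2 : ∀ l ∈ s, ∑ l' ∈ s, ENNReal.ofReal ((Z l ω * |W l ω|) * (Z l' ω * |W l' ω|))
        = ENNReal.ofReal (∑ l' ∈ s, (Z l ω * |W l ω|) * (Z l' ω * |W l' ω|)) := fun l _ =>
      (ENNReal.ofReal_sum_of_nonneg fun l' _ => mul_nonneg (hn l) (hn l')).symm
    rw [Finset.sum_congr rfl e2, ← ENNReal.ofReal_sum_of_nonneg fun l _ =>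
      Finset.sum_nonneg fun l' _ => mul_nonneg (hn l) (hn l'), ← ENNReal.ofReal_mul (by positivity),
      Real.enorm_eq_ofReal_abs, ← ENNReal.ofReal_pow (abs_nonneg _)]
    refine ENNReal.ofReal_le_ofReal ?_
    rw [← Finset.sum_mul_sum, ← sq, ← mul_pow]
    refine pow_le_pow_left₀ (abs_nonneg _) ?_ 2
    refine (abs_favg_le _ _).trans (favg_mono fun l _ => ?_)
    rw [abs_mul]
    exact mul_le_mul_of_nonneg_right (hω l) (abs_nonneg _)
  have hZm' : ∀ l l', Measurable[𝓩] fun ω => ENNReal.ofReal (Z l ω * Z l' ω) := fun l l' =>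
    ENNReal.measurable_ofReal.comp ((hZm l).mul (hZm l'))
  have hWm' : ∀ l l', Measurable[𝓣] fun ω => ‖W l ω * W l' ω‖ₑ := fun l l' =>
    measurable_enorm.comp ((hWm l).mul (hWm l'))
  have hmm : ∀ l l', Measurable[mΩ] fun ω => ENNReal.ofReal (Z l ω * Z l' ω) * ‖W l ω * W l' ω‖ₑ :=
    fun l l' => ((hZm' l l').mono h𝓩 le_rfl).mul ((hWm' l l').mono h𝓣 le_rfl)
  refine (lintegral_mono_ae hpt).trans ?_
  rw [lintegral_const_mul _ (Finset.measurable_sum _ fun l _ =>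
    Finset.measurable_sum _ fun l' _ => hmm l l'), mul_left_comm]
  refine mul_le_mul_right ?_ _
  rw [lintegral_finsetSum _ fun l _ => Finset.measurable_sum _ fun l' _ => hmm l l',
    Finset.mul_sum]
  refine Finset.sum_le_sum fun l hl => ?_
  rw [lintegral_finsetSum _ fun l' _ => hmm l l', Finset.mul_sum]
  refine Finset.sum_le_sum fun l' hl' => ?_
  rw [lintegral_mul_eq_lintegral_mul_lintegral_of_independent_measurableSpace h𝓩 h𝓣 hind
    (hZm' l l') (hWm' l l')]
  exact mul_le_mul_left (hZ l hl l' hl') _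

/-- Independent curves: `y i l` are the responses of curve `i`, `tt i l` the design points, and
`Z i l` is an envelope of `y i l` that is independent of the design. -/
structure IsCurveArray [MeasurableSpace E] (P : Measure Ω) (𝓕 𝓩 𝓣 : ℕ → MeasurableSpace Ω)
    (tt : ℕ → ι → Ω → E) (y Z : ℕ → ι → Ω → ℝ) (CZ : ℝ) (s : ℕ → ℕ → Finset ι) : Prop where
  le : ∀ i, 𝓕 i ≤ mΩ
  curve_indep : iIndep 𝓕 P
  envelope_le : ∀ i, 𝓩 i ≤ 𝓕 i
  design_le : ∀ i, 𝓣 i ≤ 𝓕 i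
  indep : ∀ i, Indep (𝓩 i) (𝓣 i) P
  measurable_response : ∀ i l, Measurable[𝓕 i] (y i l)
  measurable_envelope : ∀ i l, Measurable[𝓩 i] (Z i l)
  measurable_design : ∀ i l, Measurable[𝓣 i] (tt i l)
  abs_le : ∀ᵐ ω ∂P, ∀ i l, |y i l ω| ≤ Z i l ω
  moment_nonneg : 0 ≤ CZ
  moment_le : ∀ n, ∀ i < n, ∀ l ∈ s n i, ∀ l' ∈ s n i,
    ∫⁻ ω, ENNReal.ofReal (Z i l ω * Z i l' ω) ∂P ≤ ENNReal.ofReal CZ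

/-- Integrable envelopes of the curve averages with moments of order `lam`. -/
structure IsCurveEnvelope (P : Measure Ω) (Z : ℕ → ι → Ω → ℝ) (s : ℕ → ℕ → Finset ι)
    (G : ℕ → Ω → ℝ) (lam : ℝ) (CG : ℝ) : Prop where
  nonneg : ∀ᵐ ω ∂P, ∀ i, 0 ≤ G i ω
  favg_le : ∀ᵐ ω ∂P, ∀ n, ∀ i < n, favg (s n i) (fun l => Z i l ω) ≤ G i ω
  sum_le : ∀ᵐ ω ∂P, ∃ C : ℝ, ∀ᶠ n : ℕ in atTop, ∑ i ∈ Finset.range n, G i ω ^ lam ≤ C * n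
  integrable : ∀ i, Integrable (fun ω => G i ω ^ lam) P
  integral_le : ∀ i, ∫ ω, G i ω ^ lam ∂P ≤ CG

/-- Since `log n / n ≤ 1` and the exponent is below one, `β ≥ log n / n`. Thus bounded
discretization errors, and variances that are `O(1)` in total, are absorbed by the rate; `n ≥ 3`
gives `log n > 1`. -/
theorem one_le_sumRate {β lam : ℝ} (hlam : 2 < lam) {n : ℕ} (hn : 3 ≤ n)
    (hβ : (Real.log n / n) ^ (1 - 2 / lam) ≤ β) : 1 ≤ n * β ∧ 1 ≤ √(n * β * Real.log n) := by
  have hn0 : (0 : ℝ) < n := by positivity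
  have hlog1 : 1 < Real.log n := by
    rw [Real.lt_log_iff_exp_lt hn0]
    exact Real.exp_one_lt_d9.trans (lt_of_lt_of_le (by norm_num) (by exact_mod_cast hn : (3 : ℝ)
        ≤ n))
  have hl0 : 0 < Real.log n / n := by positivity
  have hl1 : Real.log n / n ≤ 1 := by
    rw [div_le_one hn0]
    linarith [Real.log_le_sub_one_of_pos hn0]
  have h1 : Real.log n / n ≤ β := by
    refine le_trans ?_ hβ
    have : (1 - 2 / lam) ≤ 1 := by
      have : 0 < 2 / lam := by positivity
      linarith
    calc Real.log n / n = (Real.log n / n) ^ (1 : ℝ) := (rpow_one _).symm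
      _ ≤ _ := rpow_le_rpow_of_exponent_ge hl0 hl1 this
  rw [div_le_iff₀ hn0] at h1
  have h2 : 1 ≤ n * β := by nlinarith
  refine ⟨h2, Real.one_le_sqrt.2 ?_⟩
  nlinarith

variable [IsProbabilityMeasure P] [MeasurableSpace E]

/-- Almost sure uniform rate for kernel averages, indexed by a set of parameters that can be
approximated by a grid of polynomial size. -/
theorem ae_eventually_abs_sum_favg_le {𝓕 𝓩 𝓣 : ℕ → MeasurableSpace Ω}
    {tt : ℕ → ι → Ω → E} {y Z : ℕ → ι → Ω → ℝ} {CZ : ℝ} {s : ℕ → ℕ → Finset ι}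
    (hA : IsCurveArray P 𝓕 𝓩 𝓣 tt y Z CZ s)
    {G : ℕ → Ω → ℝ} {lam CG : ℝ} (hlam : 2 < lam) (hG : IsCurveEnvelope P Z s G lam CG)
    {β : ℕ → ℝ} (hβ : ∀ᶠ n : ℕ in atTop, (Real.log n / n) ^ (1 - 2 / lam) ≤ β n)
    {κ Θ : Type*} {S : Set Θ} {grid : ℕ → Finset κ} {N : ℕ} {Cg : ℝ}
    (hgrid : ∀ n, 1 ≤ n → ((grid n).card : ℝ) ≤ Cg * (n : ℝ) ^ N)
    {pt : ℕ → κ → Θ} (hpt : ∀ n, ∀ k ∈ grid n, pt n k ∈ S)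
    {φ : ℕ → Θ → E → ℝ} {D : ℕ → κ → E → ℝ} {M : ℝ}
    (hφm : ∀ n θ, Measurable (φ n θ)) (hDm : ∀ n k, Measurable (D n k))
    (hφM : ∀ n θ x, |φ n θ x| ≤ M) (hDM : ∀ n, ∀ k x, |D n k x| ≤ M)
    (hφD : ∀ n, 1 ≤ n → ∀ θ ∈ S, ∃ k ∈ grid n, ∀ x, |φ n θ x - φ n (pt n k) x| ≤ D n k x)
    {CD : ℝ} (hDint : ∀ n, 1 ≤ n → ∀ i < n, ∀ k ∈ grid n, ∀ l ∈ s n i,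
      ∫⁻ ω, ‖D n k (tt i l ω)‖ₑ ∂P ≤ ENNReal.ofReal (CD / n))
    {CV : ℝ} (hV : ∀ᶠ n : ℕ in atTop, ∀ θ ∈ S,
      ∑ i ∈ Finset.range n, ENNReal.ofReal (((s n i).card : ℝ)⁻¹ ^ 2) *
        ∑ l ∈ s n i, ∑ l' ∈ s n i, ∫⁻ ω, ‖φ n θ (tt i l ω) * φ n θ (tt i l' ω)‖ₑ ∂P
          ≤ ENNReal.ofReal (CV * (n * β n))) :
    ∀ᵐ ω ∂P, ∃ C : ℝ, ∀ᶠ n : ℕ in atTop, ∀ θ ∈ S,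
      |∑ i ∈ Finset.range n, (favg (s n i) (fun l => y i l ω * φ n θ (tt i l ω))
        - ∫ ω', favg (s n i) (fun l => y i l ω' * φ n θ (tt i l ω')) ∂P)| ≤ C * sumRate β n := by
  wlog hM : 0 ≤ M
  · rcases isEmpty_or_nonempty E with hE | ⟨⟨x⟩⟩
    · exact this hA hlam hG hβ hgrid hpt hφm hDm (M := 0) (fun n θ x => hE.elim x)
        (fun n k x => hE.elim x) hφD hDint hV le_rfl
    · rcases isEmpty_or_nonempty Θ with hT | ⟨⟨θ⟩⟩
      · exact Eventually.of_forall fun ω => ⟨0, Eventually.of_forall fun n θ => hT.elim θ⟩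
      · exact absurd ((abs_nonneg _).trans (hφM 0 θ x)) hM
  wlog hCD : 0 ≤ CD generalizing CD
  · refine this (CD := 0) (fun n hn i hi k hk l hl =>
      (hDint n hn i hi k hk l hl).trans (ENNReal.ofReal_le_ofReal ?_)) le_rfl
    rw [zero_div]
    exact div_nonpos_of_nonpos_of_nonneg (le_of_not_ge hCD) (Nat.cast_nonneg n)
  have hZ0 : ∀ᵐ ω ∂P, ∀ i l, 0 ≤ Z i l ω := by
    filter_upwards [hA.abs_le] with ω h i l using (abs_nonneg _).trans (h i l)
  have hZF : ∀ i l, Measurable[𝓕 i] (Z i l) := fun i l =>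
    (hA.measurable_envelope i l).mono (hA.envelope_le i) le_rfl
  have hZmeas : ∀ i l, Measurable (Z i l) := fun i l => (hZF i l).mono (hA.le i) le_rfl
  have hymeas : ∀ i l, Measurable (y i l) := fun i l =>
    (hA.measurable_response i l).mono (hA.le i) le_rfl
  have htF : ∀ i l, Measurable[𝓕 i] (tt i l) := fun i l =>
    (hA.measurable_design i l).mono (hA.design_le i) le_rfl
  have htmeas : ∀ i l, Measurable (tt i l) := fun i l => (htF i l).mono (hA.le i) le_rfl
  -- integrability of the envelopes
  have hZlint : ∀ n, ∀ i < n, ∀ l ∈ s n i,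
      ∫⁻ ω, ENNReal.ofReal (Z i l ω) ∂P ≤ ENNReal.ofReal (1 + CZ) := by
    intro n i hi l hl
    calc ∫⁻ ω, ENNReal.ofReal (Z i l ω) ∂P
        ≤ ∫⁻ ω, (1 + ENNReal.ofReal (Z i l ω * Z i l ω)) ∂P := by
          refine lintegral_mono fun ω => ?_
          rw [← ENNReal.ofReal_one, ← ENNReal.ofReal_add zero_le_one (mul_self_nonneg _)]
          exact ENNReal.ofReal_le_ofReal (by nlinarith [sq_nonneg (Z i l ω - 1)])
      _ = 1 + ∫⁻ ω, ENNReal.ofReal (Z i l ω * Z i l ω) ∂P := by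
          rw [lintegral_add_left measurable_const]; simp
      _ ≤ 1 + ENNReal.ofReal CZ := by gcongr; exact hA.moment_le n i hi l hl l hl
      _ = _ := by rw [ENNReal.ofReal_add zero_le_one hA.moment_nonneg, ENNReal.ofReal_one]
  have hZint : ∀ n, ∀ i < n, ∀ l ∈ s n i, Integrable (Z i l) P := by
    intro n i hi l hl
    refine ⟨(hZmeas i l).aestronglyMeasurable, ?_⟩
    rw [hasFiniteIntegral_iff_ofReal (by filter_upwards [hZ0] with ω h using h i l)]
    exact (hZlint n i hi l hl).trans_lt ENNReal.ofReal_lt_top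
  have hζint : ∀ n, ∀ i < n, ∀ (x : ι → Ω → ℝ) (g : E → ℝ), (∀ l, Measurable (x l)) →
      Measurable g → (∀ e, |g e| ≤ M) → (∀ᵐ ω ∂P, ∀ l, |x l ω| ≤ Z i l ω) →
      Integrable (fun ω => favg (s n i) fun l => x l ω * g (tt i l ω)) P := by
    intro n i hi x g hx hg hgM hxZ
    refine integrable_favg fun l hl => ((hZint n i hi l hl).mul_const M).mono'
      ((hx l).mul (hg.comp (htmeas i l))).aestronglyMeasurable ?_
    filter_upwards [hxZ] with ω hω
    rw [Real.norm_eq_abs, abs_mul]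
    exact mul_le_mul (hω l) (hgM _) (abs_nonneg _) ((abs_nonneg _).trans (hω l))
  have hZabs : ∀ i, ∀ᵐ ω ∂P, ∀ l, |Z i l ω| ≤ Z i l ω := by
    intro i
    filter_upwards [hZ0] with ω h l
    rw [abs_of_nonneg (h i l)]
  have hyabs : ∀ i, ∀ᵐ ω ∂P, ∀ l, |y i l ω| ≤ Z i l ω := by
    intro i
    filter_upwards [hA.abs_le] with ω h l using h i l
  -- the concentration bound, applied to the averages and to their increments
  have happly : ∀ (x : ℕ → ι → Ω → ℝ) (g : ℕ → κ → E → ℝ) (C' : ℝ),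
      (∀ i l, Measurable[𝓕 i] (x i l)) → (∀ n k, Measurable (g n k)) →
      (∀ n k e, |g n k e| ≤ M) → (∀ᵐ ω ∂P, ∀ i l, |x i l ω| ≤ Z i l ω) →
      (∀ᶠ n : ℕ in atTop, ∀ k ∈ grid n,
        ∑ i ∈ Finset.range n, ENNReal.ofReal (((s n i).card : ℝ)⁻¹ ^ 2) *
          ∑ l ∈ s n i, ∑ l' ∈ s n i, ∫⁻ ω, ‖g n k (tt i l ω) * g n k (tt i l' ω)‖ₑ ∂P
            ≤ ENNReal.ofReal (C' * (n * β n))) →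
      ∀ᵐ ω ∂P, ∃ C : ℝ, ∀ᶠ n : ℕ in atTop, ∀ k ∈ grid n,
        |∑ i ∈ Finset.range n, (favg (s n i) (fun l => x i l ω * g n k (tt i l ω))
          - ∫ ω', favg (s n i) (fun l => x i l ω' * g n k (tt i l ω')) ∂P)|
            ≤ C * sumRate β n := by
    intro x g C' hx hg hgM hxZ hV'
    have hxF : ∀ n i k, Measurable[𝓕 i]
        fun ω => favg (s n i) fun l => x i l ω * g n k (tt i l ω) := fun n i k =>
      measurable_favg fun l => (hx i l).mul ((hg n k).comp (htF i l))
    refine ae_eventually_abs_sum_le (P := P) (G := fun i ω => M * G i ω) (lam := lam)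
      (CG := M ^ lam * CG) (CV := CZ * C') hgrid (by linarith) hβ
      (Z := fun n i k ω => favg (s n i) fun l => x i l ω * g n k (tt i l ω))
      (fun n i k => (hxF n i k).mono (hA.le i) le_rfl) (fun n k => ?_) ?_ ?_ ?_ ?_ ?_
    · rw [iIndepFun_iff_iIndep]
      exact iIndep_of_iIndep_of_le hA.curve_indep fun i => (hxF n i k).comap_le
    · filter_upwards [hxZ, hG.favg_le] with ω h1 h2 n i hi k hk
      refine (abs_favg_le _ _).trans (le_trans (favg_mono (g := fun l => M * Z i l ω)
        fun l _ => ?_) ?_)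
      · rw [abs_mul, mul_comm]
        exact mul_le_mul (hgM _ _ _) (h1 i l) (abs_nonneg _) hM
      · rw [favg_const_mul]
        exact mul_le_mul_of_nonneg_left (h2 n i hi) hM
    · filter_upwards [hG.nonneg, hG.sum_le] with ω h0 ⟨C, hC⟩
      refine ⟨M ^ lam * C, ?_⟩
      filter_upwards [hC] with n hn
      simp only [Real.mul_rpow hM (h0 _)]
      rw [← Finset.mul_sum, mul_assoc]
      exact mul_le_mul_of_nonneg_left hn (rpow_nonneg hM _)
    · intro i
      refine ((hG.integrable i).const_mul (M ^ lam)).congr ?_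
      filter_upwards [hG.nonneg] with ω h0
      rw [Real.mul_rpow hM (h0 i)]
    · intro i
      have : ∫ ω, (M * G i ω) ^ lam ∂P = ∫ ω, M ^ lam * G i ω ^ lam ∂P := by
        refine integral_congr_ae ?_
        filter_upwards [hG.nonneg] with ω h0
        rw [Real.mul_rpow hM (h0 i)]
      rw [this, integral_const_mul]
      exact mul_le_mul_of_nonneg_left (hG.integral_le i) (rpow_nonneg hM _)
    · filter_upwards [hV'] with n hn k hk
      rw [mul_assoc, ENNReal.ofReal_mul hA.moment_nonneg]
      refine le_trans ?_ (mul_le_mul_right (hn k hk) _)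
      rw [Finset.mul_sum]
      refine Finset.sum_le_sum fun i hi => ?_
      refine lintegral_favg_sq_le ((hA.envelope_le i).trans (hA.le i))
        ((hA.design_le i).trans (hA.le i)) (hA.indep i) (hA.measurable_envelope i)
        (W := fun l ω => g n k (tt i l ω)) (fun l => (hg n k).comp (hA.measurable_design i l)) ?_
        (hA.moment_le n i (Finset.mem_range.1 hi))
      filter_upwards [hxZ] with ω h l using h i l
  have hcard : ∀ n i, ((s n i).card : ℝ)⁻¹ * (s n i).card ≤ 1 := fun n i => inv_mul_le_one
  have h1 := happly y (fun n k => φ n (pt n k)) CV hA.measurable_response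
    (fun n k => hφm n _) (fun n k => hφM n _) hA.abs_le (by
      filter_upwards [hV] with n hn k hk using hn _ (hpt n k hk))
  -- The dominating increments obey the same concentration bound. Their second moments are at most
  -- `M CD / n` per curve, because `|D| ≤ M` and one factor integrates to `CD / n`; over all curves
  -- this is `M CD`, and `n β ≥ 1`.
  have h2 := happly Z D (M * CD) hZF hDm hDM (by
      filter_upwards [hZ0] with ω h i l; rw [abs_of_nonneg (h i l)]) (by
      filter_upwards [hβ, eventually_ge_atTop 3] with n hn hn3 k hk
      have hn1 := (one_le_sumRate hlam hn3 hn).1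
      have hn0 : (0 : ℝ) < n := by positivity
      have hterm : ∀ i ∈ Finset.range n, ENNReal.ofReal (((s n i).card : ℝ)⁻¹ ^ 2) *
          ∑ l ∈ s n i, ∑ l' ∈ s n i, ∫⁻ ω, ‖D n k (tt i l ω) * D n k (tt i l' ω)‖ₑ ∂P
          ≤ ENNReal.ofReal (M * CD / n) := by
        intro i hi
        have hll : ∀ l ∈ s n i, ∀ l' ∈ s n i,
            ∫⁻ ω, ‖D n k (tt i l ω) * D n k (tt i l' ω)‖ₑ ∂P ≤ ENNReal.ofReal (M * CD / n) := by
          intro l hl l' _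
          calc ∫⁻ ω, ‖D n k (tt i l ω) * D n k (tt i l' ω)‖ₑ ∂P
              ≤ ∫⁻ ω, ENNReal.ofReal M * ‖D n k (tt i l ω)‖ₑ ∂P := by
                refine lintegral_mono fun ω => ?_
                rw [enorm_mul, mul_comm]
                refine mul_le_mul_left ?_ _
                rw [Real.enorm_eq_ofReal_abs]
                exact ENNReal.ofReal_le_ofReal (hDM n k _)
            _ = ENNReal.ofReal M * ∫⁻ ω, ‖D n k (tt i l ω)‖ₑ ∂P := by
                rw [lintegral_const_mul _ (by
                  exact measurable_enorm.comp ((hDm n k).comp (htmeas i l)))]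
            _ ≤ ENNReal.ofReal M * ENNReal.ofReal (CD / n) :=
                mul_le_mul_right (hDint n (by omega) i (Finset.mem_range.1 hi) k hk l hl) _
            _ = _ := by rw [← ENNReal.ofReal_mul hM, mul_div_assoc]
        refine (mul_le_mul_right (Finset.sum_le_sum fun l hl =>
          Finset.sum_le_sum fun l' hl' => hll l hl l' hl') _).trans ?_
        simp only [Finset.sum_const, nsmul_eq_mul]
        rw [← mul_assoc, ← mul_assoc, ← ENNReal.ofReal_natCast, ← ENNReal.ofReal_mul
            (by positivity),
          ← ENNReal.ofReal_mul (by positivity), ← ENNReal.ofReal_mul (by positivity)]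
        refine ENNReal.ofReal_le_ofReal ?_
        have e : ((s n i).card : ℝ)⁻¹ ^ 2 * (s n i).card * (s n i).card * (M * CD / n)
            = (((s n i).card : ℝ)⁻¹ * (s n i).card) ^ 2 * (M * CD / n) := by ring
        rw [e]
        exact mul_le_of_le_one_left (by positivity)
          (pow_le_one₀ (by positivity) (hcard n i))
      refine (Finset.sum_le_sum hterm).trans ?_
      rw [Finset.sum_const, Finset.card_range, nsmul_eq_mul, ← ENNReal.ofReal_natCast,
        ← ENNReal.ofReal_mul (by positivity)]
      refine ENNReal.ofReal_le_ofReal ?_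
      rw [mul_div_cancel₀ _ hn0.ne']
      exact le_mul_of_one_le_right (by positivity) hn1)
  filter_upwards [h1, h2, hA.abs_le] with ω ⟨C1, hC1⟩ ⟨C2, hC2⟩ habs
  -- `C1` is for the grid points and `C2` for the centred increments. The mean of the increments, at
  -- most `(1 + CZ) * CD` in total, enters twice: through the random oscillation and through the
  -- oscillation of the expectations. Here `1 + CZ` bounds the first moment of the envelope, by `Z ≤
  -- 1 + Z²`.
  refine ⟨C1 + C2 + 2 * ((1 + CZ) * CD), ?_⟩
  filter_upwards [hC1, hC2, hβ, eventually_ge_atTop 3] with n e1 e2 hn hn3 θ hθ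
  have hr1 : 1 ≤ sumRate β n := (one_le_sumRate hlam hn3 hn).2
  have hn0 : (0 : ℝ) < n := by positivity
  obtain ⟨k, hk, hkD⟩ := hφD n (by omega) θ hθ
  set ζ : ℕ → Ω → ℝ := fun i ω => favg (s n i) fun l => y i l ω * φ n θ (tt i l ω) with hζ
  set ζ' : ℕ → Ω → ℝ := fun i ω => favg (s n i) fun l => y i l ω * φ n (pt n k) (tt i l ω)
    with hζ'
  set η : ℕ → Ω → ℝ := fun i ω => favg (s n i) fun l => Z i l ω * D n k (tt i l ω) with hη
  have hζη : ∀ ω, (∀ i l, |y i l ω| ≤ Z i l ω) → ∀ i, |ζ i ω - ζ' i ω| ≤ η i ω := by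
    intro ω hω i
    simp only [hζ, hζ', hη, ← favg_sub]
    refine (abs_favg_le _ _).trans (favg_mono fun l _ => ?_)
    rw [← mul_sub, abs_mul]
    exact mul_le_mul (hω i l) (hkD _) (abs_nonneg _) ((abs_nonneg _).trans (hω i l))
  have iζ : ∀ i ∈ Finset.range n, Integrable (ζ i) P := fun i hi =>
    hζint n i (Finset.mem_range.1 hi) (y i) _ (hymeas i) (hφm n θ) (hφM n θ) (hyabs i)
  have iζ' : ∀ i ∈ Finset.range n, Integrable (ζ' i) P := fun i hi =>
    hζint n i (Finset.mem_range.1 hi) (y i) _ (hymeas i) (hφm n _) (hφM n _) (hyabs i)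
  have iη : ∀ i ∈ Finset.range n, Integrable (η i) P := fun i hi =>
    hζint n i (Finset.mem_range.1 hi) (Z i) _ (hZmeas i) (hDm n k) (hDM n k) (hZabs i)
  have hmean : ∀ i ∈ Finset.range n, |∫ ω', ζ i ω' ∂P - ∫ ω', ζ' i ω' ∂P| ≤ ∫ ω', η i ω' ∂P := by
    intro i hi
    rw [← integral_sub (iζ i hi) (iζ' i hi)]
    refine norm_integral_le_of_norm_le (f := fun ω' => ζ i ω' - ζ' i ω') (iη i hi) ?_
    filter_upwards [hA.abs_le] with ω' hω' using hζη ω' hω' i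
  have hD0 : ∀ x, 0 ≤ D n k x := fun x => (abs_nonneg _).trans (hkD x)
  have hηmean : ∀ i ∈ Finset.range n, ∫ ω', η i ω' ∂P ≤ (1 + CZ) * CD / n := by
    intro i hi
    have hi' := Finset.mem_range.1 hi
    have hl : ∀ l ∈ s n i, ∫ ω', Z i l ω' * D n k (tt i l ω') ∂P ≤ (1 + CZ) * CD / n := by
      intro l hl
      have hCZ := hA.moment_nonneg
      have hmeas : Measurable fun ω' => Z i l ω' * D n k (tt i l ω') :=
        (hZmeas i l).mul ((hDm n k).comp (htmeas i l))
      rw [integral_eq_lintegral_of_nonneg_ae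
        (by filter_upwards [hZ0] with ω' h using mul_nonneg (h i l) (hD0 _))
        hmeas.aestronglyMeasurable]
      refine ENNReal.toReal_le_of_le_ofReal (by positivity) ?_
      have e : ∀ᵐ ω' ∂P, ENNReal.ofReal (Z i l ω' * D n k (tt i l ω'))
          = ENNReal.ofReal (Z i l ω') * ‖D n k (tt i l ω')‖ₑ := by
        filter_upwards [hZ0] with ω' h
        rw [ENNReal.ofReal_mul (h i l), Real.enorm_of_nonneg (hD0 _)]
      rw [lintegral_congr_ae e,
        lintegral_mul_eq_lintegral_mul_lintegral_of_independent_measurableSpace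
          ((hA.envelope_le i).trans (hA.le i)) ((hA.design_le i).trans (hA.le i)) (hA.indep i)
          (f := fun ω => ENNReal.ofReal (Z i l ω)) (g := fun ω => ‖D n k (tt i l ω)‖ₑ)
          (ENNReal.measurable_ofReal.comp (hA.measurable_envelope i l))
          (measurable_enorm.comp ((hDm n k).comp (hA.measurable_design i l))),
        mul_div_assoc, ENNReal.ofReal_mul (by positivity)]
      exact mul_le_mul' (hZlint n i hi' l hl) (hDint n (by omega) i hi' k hk l hl)
    have hint : ∀ l ∈ s n i, Integrable (fun ω' => Z i l ω' * D n k (tt i l ω')) P := by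
      intro l hl
      refine ((hZint n i hi' l hl).mul_const M).mono'
        ((hZmeas i l).mul ((hDm n k).comp (htmeas i l))).aestronglyMeasurable ?_
      filter_upwards [hZabs i] with ω hω
      rw [Real.norm_eq_abs, abs_mul]
      exact mul_le_mul (hω l) (hDM n k _) (abs_nonneg _) ((abs_nonneg _).trans (hω l))
    simp only [hη]
    rw [integral_favg hint]
    have hCZ := hA.moment_nonneg
    exact (favg_mono hl).trans (favg_const_le _ (by positivity))
  have hηsum : ∑ i ∈ Finset.range n, ∫ ω', η i ω' ∂P ≤ (1 + CZ) * CD := by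
    refine (Finset.sum_le_sum hηmean).trans ?_
    rw [Finset.sum_const, Finset.card_range, nsmul_eq_mul, mul_div_cancel₀ _ hn0.ne']
  have b1 := e1 k hk
  have b2 := e2 k hk
  have split1 : ∑ i ∈ Finset.range n, (ζ i ω - ∫ ω', ζ i ω' ∂P)
      = ∑ i ∈ Finset.range n, (ζ' i ω - ∫ ω', ζ' i ω' ∂P)
        + ∑ i ∈ Finset.range n, (ζ i ω - ζ' i ω)
        - ∑ i ∈ Finset.range n, (∫ ω', ζ i ω' ∂P - ∫ ω', ζ' i ω' ∂P) := by
    rw [← Finset.sum_add_distrib, ← Finset.sum_sub_distrib]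
    exact Finset.sum_congr rfl fun i _ => by ring
  have b3 : |∑ i ∈ Finset.range n, (ζ i ω - ζ' i ω)| ≤
      ∑ i ∈ Finset.range n, (η i ω - ∫ ω', η i ω' ∂P) + ∑ i ∈ Finset.range n, ∫ ω', η i ω' ∂P := by
    rw [← Finset.sum_add_distrib]
    refine (Finset.abs_sum_le_sum_abs _ _).trans (Finset.sum_le_sum fun i _ => ?_)
    rw [sub_add_cancel]
    exact hζη ω habs i
  have b4 : |∑ i ∈ Finset.range n, (∫ ω', ζ i ω' ∂P - ∫ ω', ζ' i ω' ∂P)| ≤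
      ∑ i ∈ Finset.range n, ∫ ω', η i ω' ∂P :=
    (Finset.abs_sum_le_sum_abs _ _).trans (Finset.sum_le_sum hmean)
  have b5 : (1 + CZ) * CD ≤ (1 + CZ) * CD * sumRate β n :=
    le_mul_of_one_le_right (mul_nonneg (by linarith [hA.moment_nonneg]) hCD) hr1
  have b6 := (le_abs_self _).trans b2
  rw [split1]
  refine (abs_sub _ _).trans ((add_le_add_left (abs_add_le _ _) _).trans ?_)
  have : ∑ i ∈ Finset.range n, (η i ω - ∫ ω', η i ω' ∂P) ≤ C2 * sumRate β n := b6
  have b1' : |∑ i ∈ Finset.range n, (ζ' i ω - ∫ ω', ζ' i ω' ∂P)| ≤ C1 * sumRate β n := b1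
  linarith

end Averages

/-! ### Independence in the sampling model -/

/-- Induction on the finite subfamily: a new block is independent of the union of the previous ones
by the two-block statement, and that union carries the intersection of the earlier events. -/
theorem iIndep_iSup_of_pairwise_disjoint {Ω ι κ : Type*} {m : ι → MeasurableSpace Ω}
    [mΩ : MeasurableSpace Ω] {μ : Measure Ω} (h_le : ∀ i, m i ≤ mΩ) (h : iIndep m μ)
    {S : κ → Set ι} (hS : Pairwise fun k k' => Disjoint (S k) (S k')) :
    iIndep (fun k => ⨆ i ∈ S k, m i) μ := by
  classical
  have := h.isProbabilityMeasure
  rw [iIndep_iff]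
  intro s
  induction s using Finset.induction_on with
  | empty => intro f _; simp
  | insert k s hk ih =>
    intro f hf
    have hd : Disjoint (S k) (⋃ k' ∈ s, S k') := by
      simp only [disjoint_iUnion_right]
      exact fun k' hk' => hS fun h => hk (h ▸ hk')
    have hi := indep_iSup_of_disjoint h_le h hd
    rw [Finset.set_biInter_insert, Finset.prod_insert hk,
      ← ih fun i hi => hf i (Finset.mem_insert_of_mem hi)]
    refine (Indep_iff _ _ _).1 hi _ _ (hf k (Finset.mem_insert_self _ _)) ?_
    refine @Finset.measurableSet_biInter _ _ (⨆ i ∈ ⋃ k' ∈ s, S k', m i) _ s fun k' hk' => ?_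
    refine (iSup₂_le fun i hi => ?_ : (⨆ i ∈ S k', m i) ≤ ⨆ i ∈ ⋃ k' ∈ s, S k', m i) _
      (hf k' (Finset.mem_insert_of_mem hk'))
    exact le_iSup₂_of_le i (mem_biUnion hk' hi) le_rfl

/-! ### The σ-algebras of the sampling model and moments of the process -/

section Model

variable {Ω 𝒳 : Type*} [MeasurableSpace 𝒳] {Q : Measure 𝒳} {a b : ℝ} {X : 𝒳 → ℝ → ℝ}
  {fT : ℝ → ℝ} {ξ : ℕ → Ω → 𝒳} {T U : ℕ → ℕ → Ω → ℝ}

/-- The σ-algebras generated by the single variables `ξ i`, `T i j`, `U i j` of the model. -/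
@[reducible] def modelAlg (ξ : ℕ → Ω → 𝒳) (T U : ℕ → ℕ → Ω → ℝ) : ℕ ⊕
    (ℕ × ℕ ⊕ ℕ × ℕ) → MeasurableSpace Ω :=
  Sum.elim (fun i : ℕ => MeasurableSpace.comap (ξ i) inferInstance)
    (Sum.elim (fun p : ℕ × ℕ => MeasurableSpace.comap (T p.1 p.2) inferInstance)
      (fun p : ℕ × ℕ => MeasurableSpace.comap (U p.1 p.2) inferInstance))

/-- The σ-algebra generated by the variables of the model with labels in `S`. -/
@[reducible] def genAlg (ξ : ℕ → Ω → 𝒳) (T U : ℕ → ℕ → Ω → ℝ) (S : Set (ℕ ⊕ (ℕ × ℕ ⊕ ℕ × ℕ))) :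
    MeasurableSpace Ω := ⨆ p ∈ S, modelAlg ξ T U p

theorem genAlg_mono {S S' : Set (ℕ ⊕ (ℕ × ℕ ⊕ ℕ × ℕ))} (h : S ⊆ S') :
    genAlg ξ T U S ≤ genAlg ξ T U S' :=
  biSup_mono h

theorem measurable_genAlg_path {S : Set (ℕ ⊕ (ℕ × ℕ ⊕ ℕ × ℕ))} {i : ℕ} (h : Sum.inl i ∈ S) :
    Measurable[genAlg ξ T U S] (ξ i) :=
  Measurable.of_comap_le (le_iSup₂_of_le (Sum.inl i) h le_rfl)

theorem measurable_genAlg_design {S : Set (ℕ ⊕ (ℕ × ℕ ⊕ ℕ × ℕ))} {i j : ℕ}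
    (h : Sum.inr (Sum.inl (i, j)) ∈ S) : Measurable[genAlg ξ T U S] (T i j) :=
  Measurable.of_comap_le (le_iSup₂_of_le (Sum.inr (Sum.inl (i, j))) h le_rfl)

theorem measurable_genAlg_error {S : Set (ℕ ⊕ (ℕ × ℕ ⊕ ℕ × ℕ))} {i j : ℕ}
    (h : Sum.inr (Sum.inr (i, j)) ∈ S) : Measurable[genAlg ξ T U S] (U i j) :=
  Measurable.of_comap_le (le_iSup₂_of_le (Sum.inr (Sum.inr (i, j))) h le_rfl)

/-- The labels of all variables of curve `i`. -/
def curveIdx (i : ℕ) : Set (ℕ ⊕ (ℕ × ℕ ⊕ ℕ × ℕ)) :=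
  {p | Sum.elim id (Sum.elim Prod.fst Prod.fst) p = i}

/-- The labels of the design points of curve `i`. -/
def designIdx (i : ℕ) : Set (ℕ ⊕ (ℕ × ℕ ⊕ ℕ × ℕ)) := {p | ∃ j, p = Sum.inr (Sum.inl (i, j))}

/-- The labels of the path and the errors of curve `i`. -/
def noiseIdx (i : ℕ) : Set (ℕ ⊕ (ℕ × ℕ ⊕ ℕ × ℕ)) :=
  {p | p = Sum.inl i ∨ ∃ j, p = Sum.inr (Sum.inr (i, j))}

/-- The law of the design points. -/
noncomputable def designLaw (a b : ℝ) (fT : ℝ → ℝ) : Measure ℝ :=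
  (volume.restrict (Icc a b)).withDensity fun t => ENNReal.ofReal (fT t)

theorem le_designLaw {c : ℝ} (h : ∀ t ∈ Icc a b, c ≤ fT t) :
    ENNReal.ofReal c • volume.restrict (Icc a b) ≤ designLaw a b fT := by
  rw [← withDensity_const]
  refine withDensity_mono ?_
  filter_upwards [ae_restrict_mem measurableSet_Icc] with t ht
  exact ENNReal.ofReal_le_ofReal (h t ht)

theorem designLaw_le {M : ℝ} (h : ∀ t ∈ Icc a b, fT t ≤ M) :
    designLaw a b fT ≤ ENNReal.ofReal M • volume.restrict (Icc a b) := by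
  rw [← withDensity_const]
  refine withDensity_mono ?_
  filter_upwards [ae_restrict_mem measurableSet_Icc] with t ht
  exact ENNReal.ofReal_le_ofReal (h t ht)

theorem ae_mem_designLaw : ∀ᵐ t ∂designLaw a b fT, t ∈ Icc a b :=
  (withDensity_absolutelyContinuous _ _).ae_le (ae_restrict_mem measurableSet_Icc)

namespace IsSamplingModel

variable [mΩ : MeasurableSpace Ω] {P : Measure Ω}

theorem modelAlg_le (h : IsSamplingModel P Q a b X fT ξ T U) (p) : modelAlg ξ T U p ≤ mΩ := by
  rcases p with i | p | p
  · exact (h.realization i).measurable.comap_le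
  · exact (h.measurable_design p.1 p.2).comap_le
  · exact (h.measurable_error p.1 p.2).comap_le

theorem genAlg_le (h : IsSamplingModel P Q a b X fT ξ T U) (S) : genAlg ξ T U S ≤ mΩ :=
  iSup₂_le fun p _ => h.modelAlg_le p

theorem iIndep_modelAlg (h : IsSamplingModel P Q a b X fT ξ T U) : iIndep (modelAlg ξ T U) P :=
  h.independent

theorem indep_genAlg (h : IsSamplingModel P Q a b X fT ξ T U)
    {S S' : Set (ℕ ⊕ (ℕ × ℕ ⊕ ℕ × ℕ))} (hS : Disjoint S S') :
    Indep (genAlg ξ T U S) (genAlg ξ T U S') P :=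
  indep_iSup_of_disjoint h.modelAlg_le h.iIndep_modelAlg hS

theorem iIndep_curve (h : IsSamplingModel P Q a b X fT ξ T U) :
    iIndep (fun i => genAlg ξ T U (curveIdx i)) P := by
  refine iIndep_iSup_of_pairwise_disjoint h.modelAlg_le h.iIndep_modelAlg fun i i' hi => ?_
  exact Set.disjoint_left.2 fun p hp hp' => hi (hp.symm.trans hp')

theorem indep_noise_design (h : IsSamplingModel P Q a b X fT ξ T U) (i : ℕ) :
    Indep (genAlg ξ T U (noiseIdx i)) (genAlg ξ T U (designIdx i)) P := by
  refine h.indep_genAlg (Set.disjoint_left.2 ?_)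
  rintro p (rfl | ⟨j, rfl⟩) ⟨k, hk⟩ <;> simp at hk

theorem map_design (h : IsSamplingModel P Q a b X fT ξ T U) (i j : ℕ) :
    P.map (T i j) = designLaw a b fT := h.design_law i j

theorem isProbabilityMeasure_designLaw [IsProbabilityMeasure P]
    (h : IsSamplingModel P Q a b X fT ξ T U) : IsProbabilityMeasure (designLaw a b fT) := by
  rw [← h.map_design 0 0]
  exact Measure.isProbabilityMeasure_map (h.measurable_design 0 0).aemeasurable

theorem ae_mem_design (h : IsSamplingModel P Q a b X fT ξ T U) :
    ∀ᵐ ω ∂P, ∀ i j, T i j ω ∈ Icc a b := by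
  simp only [ae_all_iff]
  intro i j
  have := ae_mem_designLaw (a := a) (b := b) (fT := fT)
  rw [← h.map_design i j] at this
  exact ae_of_ae_map (h.measurable_design i j).aemeasurable this

theorem iIndepFun_design (h : IsSamplingModel P Q a b X fT ξ T U) (i : ℕ) :
    iIndepFun (T i) P := by
  rw [iIndepFun_iff_iIndep]
  exact h.iIndep_modelAlg.precomp (g := fun j => Sum.inr (Sum.inl (i, j)))
    fun j j' hj => by simpa using hj

theorem iIndepFun_error (h : IsSamplingModel P Q a b X fT ξ T U) (i : ℕ) :
    iIndepFun (U i) P := by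
  rw [iIndepFun_iff_iIndep]
  exact h.iIndep_modelAlg.precomp (g := fun j => Sum.inr (Sum.inr (i, j)))
    fun j j' hj => by simpa using hj

theorem iIndepFun_path (h : IsSamplingModel P Q a b X fT ξ T U) : iIndepFun ξ P := by
  rw [iIndepFun_iff_iIndep]
  exact h.iIndep_modelAlg.precomp (g := Sum.inl) Sum.inl_injective

theorem lintegral_design (h : IsSamplingModel P Q a b X fT ξ T U) (i j : ℕ) {g : ℝ → ℝ≥0∞}
    (hg : Measurable g) : ∫⁻ ω, g (T i j ω) ∂P = ∫⁻ t, g t ∂designLaw a b fT := by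
  rw [← h.map_design i j, lintegral_map hg (h.measurable_design i j)]

/-- The index set is a `Finset`, so repeated observation indices count once. All variance bounds
rest on this exponent. -/
theorem measure_forall_mem_design (h : IsSamplingModel P Q a b X fT ξ T U) (i : ℕ)
    {B : Set ℝ} (hB : MeasurableSet B) (F : Finset ℕ) :
    P {ω | ∀ j ∈ F, T i j ω ∈ B} = designLaw a b fT B ^ F.card := by
  have e := (iIndepFun_iff_measure_inter_preimage_eq_mul.1 (h.iIndepFun_design i)) F
    (sets := fun _ => B) fun _ _ => hB
  have e2 : {ω | ∀ j ∈ F, T i j ω ∈ B} = ⋂ j ∈ F, T i j ⁻¹' B := by ext; simp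
  rw [e2, e]
  have : ∀ j ∈ F, P (T i j ⁻¹' B) = designLaw a b fT B := fun j _ => by
    rw [← h.map_design i j, Measure.map_apply (h.measurable_design i j) hB]
  rw [Finset.prod_congr rfl this, Finset.prod_const]

/-- Two design points on a curve are independent of each other and of the path. -/
theorem map_path_design [IsProbabilityMeasure P] (h : IsSamplingModel P Q a b X fT ξ T U)
    (i : ℕ) {j k : ℕ} (hjk : j ≠ k) :
    P.map (fun ω => (ξ i ω, (T i j ω, T i k ω)))
      = Q.prod ((designLaw a b fT).prod (designLaw a b fT)) := by
  have h1 : IndepFun (T i j) (T i k) P := (h.iIndepFun_design i).indepFun hjk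
  have hm : Measurable fun ω => (T i j ω, T i k ω) :=
    (h.measurable_design i j).prodMk (h.measurable_design i k)
  have h2 : IndepFun (ξ i) (fun ω => (T i j ω, T i k ω)) P := by
    have hi := h.indep_noise_design i
    rw [IndepFun_iff_Indep]
    refine indep_of_indep_of_le_left (indep_of_indep_of_le_right hi ?_) ?_
    · exact Measurable.comap_le (Measurable.prodMk
        (measurable_genAlg_design ⟨j, rfl⟩) (measurable_genAlg_design ⟨k, rfl⟩))
    · exact Measurable.comap_le (measurable_genAlg_path (Or.inl rfl))
  rw [(indepFun_iff_map_prod_eq_prod_map_map (h.realization i).measurable.aemeasurable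
      hm.aemeasurable).1 h2, (h.realization i).map_eq,
    (indepFun_iff_map_prod_eq_prod_map_map (h.measurable_design i j).aemeasurable
      (h.measurable_design i k).aemeasurable).1 h1, h.map_design, h.map_design]

/-- Path and design points have a product law, so the path can be integrated out first with the
points frozen. -/
theorem integral_path_design_eq_zero [IsProbabilityMeasure P] [IsProbabilityMeasure Q]
    (h : IsSamplingModel P Q a b X fT ξ T U) (i : ℕ) {j k : ℕ} (hjk : j ≠ k)
    {F : 𝒳 × (ℝ × ℝ) → ℝ} (hF : Measurable F)
    (h0 : ∀ u ∈ Icc a b, ∀ v ∈ Icc a b, ∫ x, F (x, (u, v)) ∂Q = 0) :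
    ∫ ω, F (ξ i ω, (T i j ω, T i k ω)) ∂P = 0 := by
  have := h.isProbabilityMeasure_designLaw
  have hm : Measurable fun ω => (ξ i ω, (T i j ω, T i k ω)) :=
    (h.realization i).measurable.prodMk
      ((h.measurable_design i j).prodMk (h.measurable_design i k))
  have e := integral_map (μ := P) hm.aemeasurable hF.aestronglyMeasurable
  rw [← e, h.map_path_design i hjk]
  by_cases hint : Integrable F (Q.prod ((designLaw a b fT).prod (designLaw a b fT)))
  · rw [integral_prod_symm _ hint]
    refine integral_eq_zero_of_ae ?_
    have h1 : ∀ᵐ p ∂(designLaw a b fT).prod (designLaw a b fT), p.1 ∈ Icc a b :=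
      Measure.quasiMeasurePreserving_fst.ae ae_mem_designLaw
    have h2 : ∀ᵐ p ∂(designLaw a b fT).prod (designLaw a b fT), p.2 ∈ Icc a b :=
      Measure.quasiMeasurePreserving_snd.ae ae_mem_designLaw
    filter_upwards [h1, h2] with p hp1 hp2
    exact h0 p.1 hp1 p.2 hp2
  -- Without integrability the integral is zero by convention, so the statement needs no
  -- integrability assumption.
  · exact integral_undef hint

/-- The factor `W` may involve every variable of the model except this one error, hence is
independent of it, and the error has mean zero. In particular `W` may contain other errors of the
same curve. -/
theorem integral_error_mul_eq_zero (h : IsSamplingModel P Q a b X fT ξ T U) (i j : ℕ)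
    {W : Ω → ℝ} (hW : Measurable[genAlg ξ T U {Sum.inr (Sum.inr (i, j))}ᶜ] W) :
    ∫ ω, U i j ω * W ω ∂P = 0 := by
  have hind : IndepFun (U i j) W P := by
    rw [IndepFun_iff_Indep]
    refine indep_of_indep_of_le_left (indep_of_indep_of_le_right
      (h.indep_genAlg disjoint_compl_right) hW.comap_le) ?_
    exact Measurable.comap_le (measurable_genAlg_error (mem_singleton _))
  have := hind.integral_mul_eq_mul_integral (h.measurable_error i j).aestronglyMeasurable
    (hW.mono (h.genAlg_le _) le_rfl).aestronglyMeasurable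
  simp only [Pi.mul_apply] at this
  rw [this, h.error_mean i j, zero_mul]

end IsSamplingModel

/-! ### First and second moments of the process -/

/-- The second moment function `E (X s * X t)`. -/
noncomputable def secondMoment (Q : Measure 𝒳) (X : 𝒳 → ℝ → ℝ) (s t : ℝ) : ℝ :=
  covFun Q X s t + meanFun Q X s * meanFun Q X t

theorem measurable_meanFun [SFinite Q] (hX : Measurable (Function.uncurry X)) :
    Measurable (meanFun Q X) := by
  have : StronglyMeasurable (Function.uncurry fun t x => X x t) :=
    (hX.comp measurable_swap).stronglyMeasurable
  exact (this.integral_prod_right (ν := Q)).measurable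

theorem measurable_covFun [SFinite Q] (hX : Measurable (Function.uncurry X)) :
    Measurable fun p : ℝ × ℝ => covFun Q X p.1 p.2 := by
  have hm := measurable_meanFun (Q := Q) hX
  have hX1 : Measurable fun p : (ℝ × ℝ) × 𝒳 => X p.2 p.1.1 :=
    hX.comp (measurable_snd.prodMk (measurable_fst.comp measurable_fst))
  have hX2 : Measurable fun p : (ℝ × ℝ) × 𝒳 => X p.2 p.1.2 :=
    hX.comp (measurable_snd.prodMk (measurable_snd.comp measurable_fst))
  have : Measurable fun p : (ℝ × ℝ) × 𝒳 =>
      (X p.2 p.1.1 - meanFun Q X p.1.1) * (X p.2 p.1.2 - meanFun Q X p.1.2) := by fun_prop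
  exact (this.stronglyMeasurable.integral_prod_right' (ν := Q)).measurable

theorem measurable_secondMoment [SFinite Q] (hX : Measurable (Function.uncurry X)) :
    Measurable fun p : ℝ × ℝ => secondMoment Q X p.1 p.2 := by
  have hm := measurable_meanFun (Q := Q) hX
  have hc := measurable_covFun (Q := Q) hX
  unfold secondMoment
  fun_prop

theorem memLp_path [IsFiniteMeasure Q] (hX : Measurable (Function.uncurry X)) {p : ℝ}
    (hp : 2 ≤ p) (h : ∫⁻ x, pathSup a b X x ^ p ∂Q < ∞) {t : ℝ} (ht : t ∈ Icc a b) :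
    MemLp (fun x => X x t) 2 Q := by
  have hm : Measurable fun x => X x t := hX.comp (measurable_id.prodMk measurable_const)
  have hp0 : 0 < p := by linarith
  have : MemLp (fun x => X x t) (ENNReal.ofReal p) Q := by
    refine ⟨hm.aestronglyMeasurable, ?_⟩
    rw [eLpNorm_lt_top_iff_lintegral_rpow_enorm_lt_top (by simpa using hp0) ENNReal.ofReal_ne_top,
      ENNReal.toReal_ofReal hp0.le]
    refine (lintegral_mono fun x => ?_).trans_lt h
    exact ENNReal.rpow_le_rpow (le_iSup₂_of_le t ht le_rfl) hp0.le
  refine this.mono_exponent ?_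
  rw [show (2 : ℝ≥0∞) = ENNReal.ofReal 2 by simp]
  exact ENNReal.ofReal_le_ofReal hp

theorem integral_path_sub_mean [IsProbabilityMeasure Q] {t : ℝ}
    (h : MemLp (fun x => X x t) 2 Q) : ∫ x, (X x t - meanFun Q X t) ∂Q = 0 := by
  rw [integral_sub (h.integrable (by norm_num)) (integrable_const _)]
  simp [meanFun]

theorem integral_path_mul_sub_secondMoment [IsProbabilityMeasure Q] {s t : ℝ}
    (hs : MemLp (fun x => X x s) 2 Q) (ht : MemLp (fun x => X x t) 2 Q) :
    ∫ x, (X x s * X x t - secondMoment Q X s t) ∂Q = 0 := by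
  have hint : Integrable (fun x => X x s * X x t) Q := hs.integrable_mul ht
  have hc := covariance_eq_sub hs ht
  rw [integral_sub hint (integrable_const _)]
  simp only [secondMoment, covFun, meanFun, hc, integral_const, probReal_univ, one_smul,
    Pi.mul_apply]
  ring

end Model

/-! ### A maximal inequality for running averages -/

section Envelope

/-- The supremum of the running averages of `|u j|`. -/
noncomputable def avgSup (u : ℕ → ℝ) : ℝ≥0∞ := ⨆ m : ℕ, ENNReal.ofReal ((∑ j ∈ Finset.range m,
    |u j|) / m)

theorem measurable_avgSup : Measurable avgSup :=
  Measurable.iSup fun _ => ENNReal.measurable_ofReal.comp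
    ((Finset.measurable_sum _ fun j _ => (measurable_pi_apply j).abs).div_const _)

theorem rpow_average_le {q : ℝ} (hq : 1 ≤ q) (u : ℕ → ℝ) {m : ℕ} (hm : 0 < m) :
    ((∑ j ∈ Finset.range m, |u j|) / m) ^ q ≤ (∑ j ∈ Finset.range m, |u j| ^ q) / m := by
  have hm0 : (0 : ℝ) < m := by exact_mod_cast hm
  have h := Real.rpow_sum_le_const_mul_sum_rpow (s := Finset.range m) (f := u) hq
  rw [Finset.card_range] at h
  rw [Real.div_rpow (Finset.sum_nonneg fun j _ => abs_nonneg _) hm0.le, div_le_div_iff₀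
    (rpow_pos_of_pos hm0 _) hm0]
  have e : (m : ℝ) ^ q = (m : ℝ) ^ (q - 1) * m := by
    rw [← rpow_add_one hm0.ne', sub_add_cancel]
  rw [e]
  calc _ ≤ ((m : ℝ) ^ (q - 1) * ∑ i ∈ Finset.range m, |u i| ^ q) * m :=
        mul_le_mul_of_nonneg_right h hm0.le
    _ = _ := by ring

/-- An average of `m` nonnegative terms is at most twice the average over the next dyadic length.
Jensen moves the power `p / 2` inside, so only dyadic averages of `|u| ^ (p / 2)` remain; the
supremum of their squared deviations from `e` is bounded by the sum. -/
theorem avgSup_rpow_le {p : ℝ} (hp : 2 ≤ p) (u : ℕ → ℝ) (e : ℝ) :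
    avgSup u ^ p ≤ ENNReal.ofReal (8 * e ^ 2) + 8 * ∑' r : ℕ, ENNReal.ofReal
      (((∑ j ∈ Finset.range (2 ^ r), |u j| ^ (p / 2)) / (2 ^ r : ℕ) - e) ^ 2) := by
  have hp0 : 0 < p := by linarith
  rw [← ENNReal.le_rpow_inv_iff hp0]
  refine iSup_le fun m => ?_
  rw [ENNReal.le_rpow_inv_iff hp0]
  rcases Nat.eq_zero_or_pos m with rfl | hm
  · simp [ENNReal.zero_rpow_of_pos hp0]
  set v : ℕ → ℝ := fun j => |u j| ^ (p / 2)
  have hv : ∀ j, 0 ≤ v j := fun j => rpow_nonneg (abs_nonneg _) _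
  set r := Nat.clog 2 m
  have hmr : m ≤ 2 ^ r := Nat.le_pow_clog one_lt_two m
  have hrm : (2 ^ r : ℕ) ≤ 2 * m := by
    rcases Nat.eq_or_lt_of_le (Nat.succ_le_of_lt hm) with h1 | h1
    · simp [r, ← h1]
    · have h2 : 2 ^ (Nat.clog 2 m).pred < m := Nat.pow_pred_clog_lt_self one_lt_two h1
      have h3 : 0 < Nat.clog 2 m := Nat.clog_pos one_lt_two h1
      have h4 : r = (Nat.clog 2 m).pred + 1 := (Nat.succ_pred_eq_of_pos h3).symm
      rw [h4, pow_succ]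
      omega
  have hm0 : (0 : ℝ) < m := by exact_mod_cast hm
  set x := (∑ j ∈ Finset.range m, |u j|) / m
  have hx0 : 0 ≤ x := div_nonneg (Finset.sum_nonneg fun j _ => abs_nonneg _) hm0.le
  set A := (∑ j ∈ Finset.range (2 ^ r), v j) / (2 ^ r : ℕ) with hA
  have hr0 : (0 : ℝ) < (2 ^ r : ℕ) := by positivity
  have hxA : x ^ (p / 2) ≤ 2 * A := by
    refine (rpow_average_le (by linarith) u hm).trans ?_
    rw [hA, div_le_iff₀ hm0, mul_div_assoc', div_mul_eq_mul_div, le_div_iff₀ hr0]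
    have h1 : ∑ j ∈ Finset.range m, v j ≤ ∑ j ∈ Finset.range (2 ^ r), v j :=
      Finset.sum_le_sum_of_subset_of_nonneg (Finset.range_mono hmr) fun j _ _ => hv j
    have h2 : ((2 ^ r : ℕ) : ℝ) ≤ 2 * m := by exact_mod_cast hrm
    have h3 : 0 ≤ ∑ j ∈ Finset.range m, v j := Finset.sum_nonneg fun j _ => hv j
    calc (∑ j ∈ Finset.range m, v j) * ((2 ^ r : ℕ) : ℝ)
        ≤ (∑ j ∈ Finset.range (2 ^ r), v j) * (2 * m) := by gcongr
      _ = _ := by ring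
  -- `x ^ p ≤ (2 A)² = 4 A²`, and `A² ≤ 2 e² + 2 (A - e)²`.
  have hxp : x ^ p ≤ 8 * e ^ 2 + 8 * (A - e) ^ 2 := by
    have e1 : x ^ p = (x ^ (p / 2)) ^ 2 := by
      rw [← Real.rpow_natCast, ← Real.rpow_mul hx0]; congr 1; push_cast; ring
    rw [e1]
    have h0 : 0 ≤ x ^ (p / 2) := rpow_nonneg hx0 _
    nlinarith [sq_nonneg (A - 2 * e), sq_nonneg A]
  rw [ENNReal.ofReal_rpow_of_nonneg hx0 hp0.le]
  refine (ENNReal.ofReal_le_ofReal hxp).trans ?_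
  rw [ENNReal.ofReal_add (by positivity) (by positivity), ENNReal.ofReal_mul (by norm_num)
    (q := (A - e) ^ 2)]
  gcongr
  · simp
  · exact ENNReal.le_tsum (f := fun r : ℕ => ENNReal.ofReal
      (((∑ j ∈ Finset.range (2 ^ r), |u j| ^ (p / 2)) / (2 ^ r : ℕ) - e) ^ 2)) r

variable {Ω : Type*} [MeasurableSpace Ω] {P : Measure Ω}

theorem memLp_two_of_lintegral_rpow {V : Ω → ℝ} (hV : Measurable V) {p : ℝ} (hp : 2 ≤ p)
    (h : ∫⁻ ω, ‖V ω‖ₑ ^ p ∂P < ∞) : MemLp (fun ω => |V ω| ^ (p / 2)) 2 P := by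
  refine ⟨(hV.abs.pow_const _).aestronglyMeasurable, ?_⟩
  rw [eLpNorm_lt_top_iff_lintegral_rpow_enorm_lt_top (by norm_num) (by norm_num)]
  refine lt_of_eq_of_lt (lintegral_congr fun ω => ?_) h
  rw [Real.enorm_of_nonneg (rpow_nonneg (abs_nonneg _) _), Real.enorm_eq_ofReal_abs,
    ENNReal.ofReal_rpow_of_nonneg (rpow_nonneg (abs_nonneg _) _) (by norm_num),
    ENNReal.ofReal_rpow_of_nonneg (abs_nonneg _) (by linarith), ← Real.rpow_mul (abs_nonneg _)]
  congr 2
  simp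

/-- With `e` the mean of `|V 0| ^ (p / 2)`, the dyadic average of length `2 ^ r` has variance of
order `2 ^ (-r)`, a summable sequence. This replaces a maximal inequality for martingales: `p ≥ 2`
and square integrability of `|V| ^ (p / 2)` suffice. -/
theorem lintegral_avgSup_rpow_lt_top [IsProbabilityMeasure P] {V : ℕ → Ω → ℝ} (hm : ∀ j,
    Measurable (V j))
    (hind : iIndepFun V P) (hid : ∀ j, IdentDistrib (V j) (V 0) P P) {p : ℝ} (hp : 2 ≤ p)
    (h : ∫⁻ ω, ‖V 0 ω‖ₑ ^ p ∂P < ∞) : ∫⁻ ω, avgSup (fun j => V j ω) ^ p ∂P < ∞ := by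
  set v : ℕ → Ω → ℝ := fun j ω => |V j ω| ^ (p / 2) with hv
  have hgm : Measurable fun x : ℝ => |x| ^ (p / 2) := measurable_id.abs.pow_const _
  have hvm : ∀ j, Measurable (v j) := fun j => hgm.comp (hm j)
  have hvid : ∀ j, IdentDistrib (v j) (v 0) P P := fun j => (hid j).comp hgm
  have hv2 : ∀ j, MemLp (v j) 2 P := fun j =>
    (hvid j).memLp_iff.2 (memLp_two_of_lintegral_rpow (hm 0) hp h)
  set e := ∫ ω, v 0 ω ∂P
  have hvind : ∀ j k, j ≠ k → IndepFun (v j) (v k) P := fun j k hjk =>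
    (hind.indepFun hjk).comp hgm hgm
  refine lt_of_le_of_lt (lintegral_mono fun ω => avgSup_rpow_le hp (fun j => V j ω) e) ?_
  have hterm : ∀ r : ℕ, ∫⁻ ω, ENNReal.ofReal
      (((∑ j ∈ Finset.range (2 ^ r), v j ω) / (2 ^ r : ℕ) - e) ^ 2) ∂P
      = ENNReal.ofReal (variance (v 0) P * (1 / 2) ^ r) := by
    intro r
    set N := 2 ^ r with hN
    have hN0 : (0 : ℝ) < N := by positivity
    set S : Ω → ℝ := fun ω => (N : ℝ)⁻¹ * (∑ j ∈ Finset.range N, v j) ω with hS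
    have hS2 : MemLp S 2 P := (memLp_finsetSum' _ fun j _ => hv2 j).const_mul _
    have hSe : ∫ ω, S ω ∂P = e := by
      simp only [hS, Finset.sum_apply]
      rw [integral_const_mul, integral_finsetSum _ fun j _ => (hv2 j).integrable (by norm_num)]
      have : ∀ j ∈ Finset.range N, ∫ ω, v j ω ∂P = e := fun j _ => (hvid j).integral_eq
      rw [Finset.sum_congr rfl this, Finset.sum_const, Finset.card_range, nsmul_eq_mul,
        inv_mul_cancel_left₀ hN0.ne']
    have hvar : variance S P = variance (v 0) P * (1 / 2) ^ r := by
      rw [hS, variance_const_mul, IndepFun.variance_sum (fun j _ => hv2 j)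
        fun j _ k _ hjk => hvind j k hjk]
      have : ∀ j ∈ Finset.range N, variance (v j) P = variance (v 0) P :=
        fun j _ => (hvid j).variance_eq
      rw [Finset.sum_congr rfl this, Finset.sum_const, Finset.card_range, nsmul_eq_mul]
      have : ((1 : ℝ) / 2) ^ r = (N : ℝ)⁻¹ := by rw [hN]; simp
      rw [this]
      field_simp
    rw [← hvar, hS2.ofReal_variance_eq, evariance]
    refine lintegral_congr fun ω => ?_
    rw [hSe, ← enorm_pow, Real.enorm_of_nonneg (sq_nonneg _)]
    congr 2
    simp only [hS, Finset.sum_apply]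
    rw [div_eq_inv_mul]
  have hmeas : ∀ r : ℕ, Measurable fun ω => ENNReal.ofReal
      (((∑ j ∈ Finset.range (2 ^ r), v j ω) / (2 ^ r : ℕ) - e) ^ 2) := fun r =>
    ENNReal.measurable_ofReal.comp ((((Finset.measurable_sum _ fun j _
        => hvm j).div_const _).sub_const
      _).pow_const 2)
  rw [lintegral_add_left measurable_const, lintegral_const_mul _ (Measurable.tsum hmeas),
    lintegral_tsum fun r => (hmeas r).aemeasurable]
  simp only [hterm]
  refine ENNReal.add_lt_top.2 ⟨by
    rw [lintegral_const, measure_univ, mul_one]; exact ENNReal.ofReal_lt_top,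
    ENNReal.mul_lt_top (by norm_num) ?_⟩
  exact ((summable_geometric_two).mul_left _).tsum_ofReal_lt_top

theorem ae_eventually_sum_le_of_identDistrib {Y : ℕ → Ω → ℝ} (hint : Integrable (Y 0) P)
    (hind : Pairwise fun i j => IndepFun (Y i) (Y j) P)
    (hid : ∀ i, IdentDistrib (Y i) (Y 0) P P) :
    ∀ᵐ ω ∂P, ∃ C : ℝ, ∀ᶠ n : ℕ in atTop, ∑ i ∈ Finset.range n, Y i ω ≤ C * n := by
  filter_upwards [strong_law_ae_real Y hint hind hid] with ω h
  refine ⟨∫ ω', Y 0 ω' ∂P + 1, ?_⟩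
  filter_upwards [h.eventually (gt_mem_nhds (lt_add_one _)), eventually_gt_atTop 0] with n h1 h2
  have : (0 : ℝ) < n := by exact_mod_cast h2
  rw [div_lt_iff₀ this] at h1
  exact h1.le

theorem rpow_add_three_le {x y z p : ℝ} (hx : 0 ≤ x) (hy : 0 ≤ y) (hz : 0 ≤ z) (hp : 0 ≤ p) :
    (x + y + z) ^ p ≤ 3 ^ p * (x ^ p + y ^ p + z ^ p) := by
  have hx' := rpow_nonneg hx p
  have hy' := rpow_nonneg hy p
  have hz' := rpow_nonneg hz p
  have h3 : (0 : ℝ) ≤ 3 ^ p := by positivity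
  have key : ∀ w, 0 ≤ w → x ≤ w → y ≤ w → z ≤ w → (x + y + z) ^ p ≤ 3 ^ p * w ^ p := by
    intro w hw h1 h2 h4
    rw [← Real.mul_rpow (by norm_num) hw]
    exact rpow_le_rpow (by positivity) (by linarith) hp
  rcases le_total x y with h | h <;> rcases le_total y z with h' | h' <;>
    rcases le_total x z with h'' | h''
  all_goals first
    | exact (key x hx (by linarith) (by linarith) (by linarith)).trans
        (mul_le_mul_of_nonneg_left (by linarith) h3)
    | exact (key y hy (by linarith) (by linarith) (by linarith)).trans
        (mul_le_mul_of_nonneg_left (by linarith) h3)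
    | exact (key z hz (by linarith) (by linarith) (by linarith)).trans
        (mul_le_mul_of_nonneg_left (by linarith) h3)

end Envelope

/-! ### Integrable envelopes for the responses of a curve -/

section ModelEnvelope

variable {Ω 𝒳 : Type*} [mΩ : MeasurableSpace Ω] [MeasurableSpace 𝒳]
  {P : Measure Ω} {Q : Measure 𝒳} {a b : ℝ} {X : 𝒳 → ℝ → ℝ} {fT : ℝ → ℝ}
  {ξ : ℕ → Ω → 𝒳} {T U : ℕ → ℕ → Ω → ℝ}

/-- A measurable real version of the supremum of `|X t|` over `[a, b]`. -/
noncomputable def pathBound (Q : Measure 𝒳) (a b : ℝ) (X : 𝒳 → ℝ → ℝ)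
    (h : AEMeasurable (pathSup a b X) Q) (x : 𝒳) : ℝ :=
  (h.mk _ x).toReal

theorem measurable_pathBound (h : AEMeasurable (pathSup a b X) Q) :
    Measurable (pathBound Q a b X h) := h.measurable_mk.ennreal_toReal

theorem ae_pathBound_eq (h : AEMeasurable (pathSup a b X) Q) {p : ℝ} (hp : 0 < p)
    (hfin : ∫⁻ x, pathSup a b X x ^ p ∂Q < ∞) :
    ∀ᵐ x ∂Q, ENNReal.ofReal (pathBound Q a b X h x) = pathSup a b X x := by
  filter_upwards [h.ae_eq_mk, ae_lt_top' (h.pow_const p) hfin.ne] with x h1 h2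
  have h3 : pathSup a b X x ≠ ∞ := fun h3 => by
    rw [h3, ENNReal.top_rpow_of_pos hp] at h2
    exact lt_irrefl _ h2
  rw [pathBound, ← h1, ENNReal.ofReal_toReal h3]

theorem integrable_pathBound_rpow (h : AEMeasurable (pathSup a b X) Q) {p : ℝ} (hp : 0 < p)
    (hfin : ∫⁻ x, pathSup a b X x ^ p ∂Q < ∞) :
    Integrable (fun x => pathBound Q a b X h x ^ p) Q := by
  refine ⟨((measurable_pathBound h).pow_const p).aestronglyMeasurable, ?_⟩
  have h0 : 0 ≤ᵐ[Q] fun x => pathBound Q a b X h x ^ p :=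
    Eventually.of_forall fun x => rpow_nonneg ENNReal.toReal_nonneg _
  rw [hasFiniteIntegral_iff_ofReal h0]
  refine lt_of_eq_of_lt (lintegral_congr_ae ?_) hfin
  filter_upwards [ae_pathBound_eq h hp hfin] with x hx
  have h1 : 0 ≤ pathBound Q a b X h x := ENNReal.toReal_nonneg
  rw [← hx, ENNReal.ofReal_rpow_of_nonneg h1 hp.le]

namespace IsSamplingModel

/-- An envelope of the response `Y i j` that is independent of the design. -/
noncomputable def noiseBound (h : IsSamplingModel P Q a b X fT ξ T U) (c : ℝ) (i j : ℕ) (ω : Ω) :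
    ℝ := pathBound Q a b X h.aemeasurable_pathSup (ξ i ω) + |U i j ω| + c

/-- An envelope of all the averages of `noiseBound` over initial segments of curve `i`. -/
noncomputable def curveBound (h : IsSamplingModel P Q a b X fT ξ T U) (c : ℝ) (i : ℕ) (ω : Ω) :
    ℝ := pathBound Q a b X h.aemeasurable_pathSup (ξ i ω)
      + (avgSup fun j => U i j ω).toReal + c

theorem ae_abs_path_le (h : IsSamplingModel P Q a b X fT ξ T U) {p : ℝ} (hp : 0 < p)
    (hfin : ∫⁻ x, pathSup a b X x ^ p ∂Q < ∞) :
    ∀ᵐ ω ∂P, ∀ i, ∀ t ∈ Icc a b,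
      |X (ξ i ω) t| ≤ pathBound Q a b X h.aemeasurable_pathSup (ξ i ω) := by
  rw [ae_all_iff]
  intro i
  filter_upwards [(h.realization i).quasiMeasurePreserving.ae
    (ae_pathBound_eq h.aemeasurable_pathSup hp hfin)] with ω hω t ht
  have h1 : ‖X (ξ i ω) t‖ₑ ≤ pathSup a b X (ξ i ω) :=
    le_iSup₂ (f := fun t (_ : t ∈ Icc a b) => ‖X (ξ i ω) t‖ₑ) t ht
  rw [← hω, Real.enorm_eq_ofReal_abs] at h1
  exact (ENNReal.ofReal_le_ofReal_iff ENNReal.toReal_nonneg).1 h1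

theorem pathBound_nonneg (h : IsSamplingModel P Q a b X fT ξ T U) (x : 𝒳) :
    0 ≤ pathBound Q a b X h.aemeasurable_pathSup x := ENNReal.toReal_nonneg

/-- Both error sequences have as law the infinite product of the common error law. The whole
sequence is needed because the envelope is a functional of all errors on the curve. -/
theorem identDistrib_errors (h : IsSamplingModel P Q a b X fT ξ T U) (i : ℕ) :
    IdentDistrib (fun ω j => U i j ω) (fun ω j => U 0 j ω) P P := by
  refine ⟨(measurable_pi_lambda _ fun j => h.measurable_error i j).aemeasurable,
    (measurable_pi_lambda _ fun j => h.measurable_error 0 j).aemeasurable, ?_⟩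
  rw [(h.iIndepFun_error i).map_fun_eq_infinitePi_map (h.measurable_error i),
    (h.iIndepFun_error 0).map_fun_eq_infinitePi_map (h.measurable_error 0)]
  congr 1
  ext1 j
  rw [(h.error_identDistrib i j).map_eq, (h.error_identDistrib 0 j).map_eq]

theorem lintegral_avgSup_lt_top [IsProbabilityMeasure P] (h : IsSamplingModel P Q a b X fT ξ T U)
    {p : ℝ} (hp : 2 ≤ p)
    (hmom : MomentCondition P Q a b X U p) (i : ℕ) :
    ∫⁻ ω, avgSup (fun j => U i j ω) ^ p ∂P < ∞ :=
  lintegral_avgSup_rpow_lt_top (h.measurable_error i) (h.iIndepFun_error i)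
    (fun j => (h.error_identDistrib i j).trans (h.error_identDistrib i 0).symm) hp (hmom.1 i 0)

theorem measurable_avgSup_error (h : IsSamplingModel P Q a b X fT ξ T U) (i : ℕ) :
    Measurable fun ω => avgSup fun j => U i j ω :=
  measurable_avgSup.comp (measurable_pi_lambda _ fun j => h.measurable_error i j)

theorem ae_avgSup_lt_top [IsProbabilityMeasure P] (h : IsSamplingModel P Q a b X fT ξ T U) {p : ℝ}
    (hp : 2 ≤ p)
    (hmom : MomentCondition P Q a b X U p) : ∀ᵐ ω ∂P, ∀ i, avgSup (fun j => U i j ω) < ∞ := by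
  rw [ae_all_iff]
  intro i
  filter_upwards [ae_lt_top ((h.measurable_avgSup_error i).pow_const p)
    (h.lintegral_avgSup_lt_top hp hmom i).ne] with ω hω
  by_contra h1
  rw [not_lt_top_iff.1 h1, ENNReal.top_rpow_of_pos (by linarith)] at hω
  exact lt_irrefl _ hω

theorem integrable_avgSup_rpow [IsProbabilityMeasure P] (h : IsSamplingModel P Q a b X fT ξ T U)
    {p : ℝ} (hp : 2 ≤ p)
    (hmom : MomentCondition P Q a b X U p) (i : ℕ) :
    Integrable (fun ω => (avgSup fun j => U i j ω).toReal ^ p) P := by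
  refine ⟨((h.measurable_avgSup_error i).ennreal_toReal.pow_const p).aestronglyMeasurable, ?_⟩
  rw [hasFiniteIntegral_iff_ofReal (Eventually.of_forall fun x =>
    rpow_nonneg ENNReal.toReal_nonneg _)]
  refine lt_of_eq_of_lt (lintegral_congr_ae ?_) (h.lintegral_avgSup_lt_top hp hmom i)
  filter_upwards [h.ae_avgSup_lt_top hp hmom] with ω hω
  rw [← ENNReal.ofReal_rpow_of_nonneg ENNReal.toReal_nonneg (by linarith),
    ENNReal.ofReal_toReal (hω i).ne]

theorem curveBound_rpow_le (h : IsSamplingModel P Q a b X fT ξ T U) {c : ℝ} (hc : 0 ≤ c) {p : ℝ}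
    (hp : 0 ≤ p) (i : ℕ) (ω : Ω) :
    h.curveBound c i ω ^ p ≤ 3 ^ p * (pathBound Q a b X h.aemeasurable_pathSup (ξ i ω) ^ p
      + (avgSup fun j => U i j ω).toReal ^ p + c ^ p) :=
  rpow_add_three_le ENNReal.toReal_nonneg ENNReal.toReal_nonneg hc hp

theorem curveBound_nonneg (h : IsSamplingModel P Q a b X fT ξ T U) {c : ℝ} (hc : 0 ≤ c)
    (i : ℕ) (ω : Ω) : 0 ≤ h.curveBound c i ω :=
  add_nonneg (add_nonneg ENNReal.toReal_nonneg ENNReal.toReal_nonneg) hc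

theorem noiseBound_ge (h : IsSamplingModel P Q a b X fT ξ T U) (c : ℝ)
    (i j : ℕ) (ω : Ω) : c ≤ h.noiseBound c i j ω := by
  have := h.pathBound_nonneg (ξ i ω)
  have := abs_nonneg (U i j ω)
  unfold noiseBound
  linarith

theorem measurable_curveBound (h : IsSamplingModel P Q a b X fT ξ T U)
    (c : ℝ) (i : ℕ) :
    Measurable (h.curveBound c i) :=
  (((measurable_pathBound h.aemeasurable_pathSup).comp (h.realization i).measurable).add
    (h.measurable_avgSup_error i).ennreal_toReal).add_const c

theorem integrable_pathBound_realization (h : IsSamplingModel P Q a b X fT ξ T U) {p : ℝ}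
    (hp : 0 < p) (hmom : MomentCondition P Q a b X U p) (i : ℕ) :
    Integrable (fun ω => pathBound Q a b X h.aemeasurable_pathSup (ξ i ω) ^ p) P :=
  (h.realization i).integrable_comp_of_integrable
    (integrable_pathBound_rpow h.aemeasurable_pathSup hp hmom.2)

theorem integral_pathBound_realization (h : IsSamplingModel P Q a b X fT ξ T U) (p : ℝ) (i : ℕ) :
    ∫ ω, pathBound Q a b X h.aemeasurable_pathSup (ξ i ω) ^ p ∂P
      = ∫ x, pathBound Q a b X h.aemeasurable_pathSup x ^ p ∂Q := by
  have e := integral_map (μ := P) (h.realization i).measurable.aemeasurable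
    ((measurable_pathBound h.aemeasurable_pathSup).pow_const p).aestronglyMeasurable
  rw [(h.realization i).map_eq] at e
  exact e.symm

theorem integrable_curveBound_rpow [IsProbabilityMeasure P]
    (h : IsSamplingModel P Q a b X fT ξ T U) {c : ℝ} (hc : 0 ≤ c)
    {p : ℝ} (hp : 2 ≤ p) (hmom : MomentCondition P Q a b X U p) (i : ℕ) :
    Integrable (fun ω => h.curveBound c i ω ^ p) P := by
  refine ((((h.integrable_pathBound_realization (by linarith) hmom i).add
    (h.integrable_avgSup_rpow hp hmom i)).add (integrable_const (c ^ p))).const_mul (3 ^ p)).mono'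
    ((h.measurable_curveBound c i).pow_const p).aestronglyMeasurable ?_
  filter_upwards with ω
  rw [Real.norm_eq_abs, abs_of_nonneg (rpow_nonneg (h.curveBound_nonneg hc i ω) _)]
  exact h.curveBound_rpow_le hc (by linarith) i ω

theorem integral_curveBound_rpow_le [IsProbabilityMeasure P]
    (h : IsSamplingModel P Q a b X fT ξ T U) {c : ℝ} (hc : 0 ≤ c)
    {p : ℝ} (hp : 2 ≤ p) (hmom : MomentCondition P Q a b X U p) (i : ℕ) :
    ∫ ω, h.curveBound c i ω ^ p ∂P
      ≤ 3 ^ p * (∫ x, pathBound Q a b X h.aemeasurable_pathSup x ^ p ∂Q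
        + ∫ ω, (avgSup fun j => U 0 j ω).toReal ^ p ∂P + c ^ p) := by
  have i1 := h.integrable_pathBound_realization (by linarith) hmom i
  have i2 := h.integrable_avgSup_rpow hp hmom i
  have i3 : Integrable (fun ω => pathBound Q a b X h.aemeasurable_pathSup (ξ i ω) ^ p
      + (avgSup fun j => U i j ω).toReal ^ p) P := i1.add i2
  have e : ∫ ω, (avgSup fun j => U i j ω).toReal ^ p ∂P
      = ∫ ω, (avgSup fun j => U 0 j ω).toReal ^ p ∂P :=
    ((h.identDistrib_errors i).comp (u := fun u => (avgSup u).toReal ^ p)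
      (measurable_avgSup.ennreal_toReal.pow_const p)).integral_eq
  refine (integral_mono (h.integrable_curveBound_rpow hc hp hmom i)
    ((i3.add (integrable_const (c ^ p))).const_mul (3 ^ p))
    fun ω => h.curveBound_rpow_le hc (by linarith) i ω).trans ?_
  simp only [Pi.add_apply]
  rw [integral_const_mul, integral_add i3 (integrable_const _), integral_add i1 i2,
    h.integral_pathBound_realization, e]
  simp

/-- The strong law applies separately to the path suprema and to the maximal error averages, each
identically distributed and independent over the curves; `rpow_add_three_le` recombines them. -/
theorem ae_sum_curveBound_rpow_le [IsProbabilityMeasure P]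
    (h : IsSamplingModel P Q a b X fT ξ T U) {c : ℝ} (hc : 0 ≤ c)
    {p : ℝ} (hp : 2 ≤ p) (hmom : MomentCondition P Q a b X U p) :
    ∀ᵐ ω ∂P, ∃ C : ℝ, ∀ᶠ n : ℕ in atTop,
      ∑ i ∈ Finset.range n, h.curveBound c i ω ^ p ≤ C * n := by
  have hSm : Measurable fun x => pathBound Q a b X h.aemeasurable_pathSup x ^ p :=
    (measurable_pathBound h.aemeasurable_pathSup).pow_const p
  have hAm : Measurable fun u : ℕ → ℝ => (avgSup u).toReal ^ p :=
    measurable_avgSup.ennreal_toReal.pow_const p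
  have hξid : ∀ i, IdentDistrib (ξ i) (ξ 0) P P := fun i =>
    ⟨(h.realization i).measurable.aemeasurable, (h.realization 0).measurable.aemeasurable, by
      rw [(h.realization i).map_eq, (h.realization 0).map_eq]⟩
  have h1 := ae_eventually_sum_le_of_identDistrib
    (Y := fun i ω => pathBound Q a b X h.aemeasurable_pathSup (ξ i ω) ^ p)
    (h.integrable_pathBound_realization (by linarith) hmom 0)
    (fun i j hij => (h.iIndepFun_path.indepFun hij).comp hSm hSm)
    (fun i => (hξid i).comp hSm)
  have h2 := ae_eventually_sum_le_of_identDistrib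
    (Y := fun i ω => (avgSup fun j => U i j ω).toReal ^ p) (h.integrable_avgSup_rpow hp hmom 0)
    (fun i j hij => by
      have hi : IndepFun (fun ω k => U i k ω) (fun ω k => U j k ω) P := by
        rw [IndepFun_iff_Indep]
        have hm : ∀ i, Measurable[genAlg ξ T U (curveIdx i)] fun ω k => U i k ω := fun i =>
          @measurable_pi_lambda _ _ _ (genAlg ξ T U (curveIdx i)) _ _
            fun k => measurable_genAlg_error rfl
        exact indep_of_indep_of_le_left (indep_of_indep_of_le_right
          (h.iIndep_curve.indep hij) (hm j).comap_le) (hm i).comap_le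
      exact hi.comp hAm hAm)
    (fun i => (h.identDistrib_errors i).comp hAm)
  filter_upwards [h1, h2] with ω ⟨C1, e1⟩ ⟨C2, e2⟩
  refine ⟨3 ^ p * (C1 + C2 + c ^ p), ?_⟩
  filter_upwards [e1, e2] with n b1 b2
  calc ∑ i ∈ Finset.range n, h.curveBound c i ω ^ p
      ≤ ∑ i ∈ Finset.range n, 3 ^ p * (pathBound Q a b X h.aemeasurable_pathSup (ξ i ω) ^ p
        + (avgSup fun j => U i j ω).toReal ^ p + c ^ p) :=
        Finset.sum_le_sum fun i _ => h.curveBound_rpow_le hc (by linarith) i ω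
    _ = 3 ^ p * (∑ i ∈ Finset.range n, pathBound Q a b X h.aemeasurable_pathSup (ξ i ω) ^ p
        + ∑ i ∈ Finset.range n, (avgSup fun j => U i j ω).toReal ^ p + n * c ^ p) := by
        rw [← Finset.mul_sum, Finset.sum_add_distrib, Finset.sum_add_distrib, Finset.sum_const,
          Finset.card_range, nsmul_eq_mul]
    _ ≤ 3 ^ p * (C1 * n + C2 * n + n * c ^ p) := by gcongr
    _ = _ := by ring

theorem ae_favg_noiseBound_le [IsProbabilityMeasure P] (h : IsSamplingModel P Q a b X fT ξ T U)
    {c : ℝ} (hc : 0 ≤ c)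
    {p : ℝ} (hp : 2 ≤ p) (hmom : MomentCondition P Q a b X U p) :
    ∀ᵐ ω ∂P, ∀ i m, favg (Finset.range m) (fun j => h.noiseBound c i j ω) ≤ h.curveBound c i ω := by
  filter_upwards [h.ae_avgSup_lt_top hp hmom] with ω hω i m
  rcases Nat.eq_zero_or_pos m with rfl | hm
  · simpa [favg] using h.curveBound_nonneg hc i ω
  have hne : (Finset.range m).Nonempty := Finset.nonempty_range_iff.2 hm.ne'
  have h1 : (∑ j ∈ Finset.range m, |U i j ω|) / m ≤ (avgSup fun j => U i j ω).toReal := by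
    rw [← ENNReal.ofReal_le_iff_le_toReal (hω i).ne]
    exact le_iSup (fun m : ℕ => ENNReal.ofReal ((∑ j ∈ Finset.range m, |U i j ω|) / m)) m
  unfold noiseBound curveBound
  rw [favg_add, favg_add, favg_const hne, favg_const hne]
  have h2 : favg (Finset.range m) (fun j => |U i j ω|) = (∑ j ∈ Finset.range m, |U i j ω|) / m := by
    rw [favg, Finset.card_range, inv_mul_eq_div]
  linarith

/-- Adding the diagonal turns the sum over pairs into a square of a sum. The normalization changes
from `m²` to `m² - m`, which costs at most a factor two when `m ≥ 2`; for smaller `m` there are no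
pairs. -/
theorem ae_favg_offDiag_noiseBound_le [IsProbabilityMeasure P]
    (h : IsSamplingModel P Q a b X fT ξ T U) {c : ℝ} (hc : 0 ≤ c)
    {p : ℝ} (hp : 2 ≤ p) (hmom : MomentCondition P Q a b X U p) :
    ∀ᵐ ω ∂P, ∀ i m, favg (Finset.range m).offDiag
      (fun l => h.noiseBound c i l.1 ω * h.noiseBound c i l.2 ω) ≤ 2 * h.curveBound c i ω ^ 2 := by
  filter_upwards [h.ae_favg_noiseBound_le hc hp hmom] with ω hω i m
  have hH : ∀ j, 0 ≤ h.noiseBound c i j ω := fun j => hc.trans (h.noiseBound_ge c i j ω)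
  rcases Nat.lt_or_ge m 2 with hm | hm
  · have : (Finset.range m).offDiag = ∅ := by
      interval_cases m <;> simp
    rw [this]
    simp only [favg, Finset.sum_empty, mul_zero]
    positivity
  have hm0 : (2 : ℝ) ≤ m := by exact_mod_cast hm
  set S := ∑ j ∈ Finset.range m, h.noiseBound c i j ω with hS
  have hS0 : 0 ≤ S := Finset.sum_nonneg fun j _ => hH j
  have h1 : ∑ l ∈ (Finset.range m).offDiag, h.noiseBound c i l.1 ω * h.noiseBound c i l.2 ω
      ≤ S ^ 2 := by
    rw [sq, hS, Finset.sum_mul_sum, ← Finset.sum_product']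
    exact Finset.sum_le_sum_of_subset_of_nonneg (fun l hl => by
      rw [Finset.mem_offDiag] at hl; exact Finset.mem_product.2 ⟨hl.1, hl.2.1⟩)
      fun l _ _ => mul_nonneg (hH _) (hH _)
  have hcard : (((Finset.range m).offDiag.card : ℕ) : ℝ) = m * m - m := by
    rw [Finset.offDiag_card, Finset.card_range, Nat.cast_sub (Nat.le_mul_self m)]
    push_cast; ring
  have h2 : S ≤ m * h.curveBound c i ω := by
    have := hω i m
    rw [favg, Finset.card_range, inv_mul_le_iff₀ (by linarith)] at this
    exact this
  have hpos : (0 : ℝ) < m * m - m := by nlinarith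
  rw [favg, hcard, inv_mul_le_iff₀ hpos]
  have h3 : S ^ 2 ≤ (m * h.curveBound c i ω) ^ 2 := pow_le_pow_left₀ hS0 h2 2
  have h4 : (m : ℝ) ^ 2 ≤ 2 * (m * m - m) := by nlinarith
  calc _ ≤ S ^ 2 := h1
    _ ≤ (m : ℝ) ^ 2 * h.curveBound c i ω ^ 2 := by rw [← mul_pow]; exact h3
    _ ≤ 2 * (m * m - m) * h.curveBound c i ω ^ 2 := by gcongr
    _ = _ := by ring

/-- Fourth moments of the envelopes. -/
theorem exists_lintegral_noiseBound_pow_four_le [IsProbabilityMeasure P]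
    (h : IsSamplingModel P Q a b X fT ξ T U)
    (c : ℝ) {p : ℝ} (hp : 4 ≤ p) (hmom : MomentCondition P Q a b X U p) :
    ∃ C, 0 ≤ C ∧ ∀ i j, ∫⁻ ω, ENNReal.ofReal (h.noiseBound c i j ω ^ 4) ∂P ≤ ENNReal.ofReal C := by
  have hp0 : 0 < p := by linarith
  have hUm : Measurable fun u : ℝ => |u| ^ p := measurable_id.abs.pow_const _
  have hUint : ∀ i j, Integrable (fun ω => |U i j ω| ^ p) P := by
    intro i j
    refine ⟨(hUm.comp (h.measurable_error i j)).aestronglyMeasurable, ?_⟩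
    rw [hasFiniteIntegral_iff_ofReal (Eventually.of_forall fun x => rpow_nonneg (abs_nonneg _) _)]
    refine lt_of_eq_of_lt (lintegral_congr fun ω => ?_) (hmom.1 i j)
    rw [Real.enorm_eq_ofReal_abs, ENNReal.ofReal_rpow_of_nonneg (abs_nonneg _) hp0.le]
  have hU : ∀ i j, ∫ ω, |U i j ω| ^ p ∂P = ∫ ω, |U 0 0 ω| ^ p ∂P := fun i j =>
    ((h.error_identDistrib i j).comp hUm).integral_eq
  have h4 : ∀ x : ℝ, 0 ≤ x → x ^ 4 ≤ 1 + x ^ p := by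
    intro x hx
    rcases le_total x 1 with h1 | h1
    · have := pow_le_one₀ hx h1 (n := 4)
      have := rpow_nonneg hx p
      linarith
    · have : x ^ (4 : ℝ) ≤ x ^ p := rpow_le_rpow_of_exponent_le h1 hp
      rw [show (4 : ℝ) = ((4 : ℕ) : ℝ) by norm_num, rpow_natCast] at this
      linarith
  set CX := ∫ x, pathBound Q a b X h.aemeasurable_pathSup x ^ p ∂Q
  set CU := ∫ ω, |U 0 0 ω| ^ p ∂P
  have hCX : 0 ≤ CX := integral_nonneg fun x => rpow_nonneg ENNReal.toReal_nonneg _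
  have hCU : 0 ≤ CU := integral_nonneg fun x => rpow_nonneg (abs_nonneg _) _
  -- `27 = 3³` comes from `(x + y + c)⁴ ≤ 27 (x⁴ + y⁴ + c⁴)`; the `2` from `x⁴ ≤ 1 + x ^ p`, used
  -- for the path and for the error.
  refine ⟨27 * (CX + CU + (2 + c ^ 4)), by positivity, fun i j => ?_⟩
  have i1 := h.integrable_pathBound_realization hp0 hmom i
  have i2 : Integrable (fun ω => pathBound Q a b X h.aemeasurable_pathSup (ξ i ω) ^ p
      + |U i j ω| ^ p) P := i1.add (hUint i j)
  have i3 : Integrable (fun ω => 27 * (pathBound Q a b X h.aemeasurable_pathSup (ξ i ω) ^ p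
      + |U i j ω| ^ p + (2 + c ^ 4))) P := (i2.add (integrable_const _)).const_mul 27
  have e : ∫ ω, 27 * (pathBound Q a b X h.aemeasurable_pathSup (ξ i ω) ^ p
      + |U i j ω| ^ p + (2 + c ^ 4)) ∂P = 27 * (CX + CU + (2 + c ^ 4)) := by
    rw [integral_const_mul, integral_add i2 (integrable_const _), integral_add i1 (hUint i j),
      h.integral_pathBound_realization, hU]
    simp [CX, CU]
  rw [← e, ofReal_integral_eq_lintegral_ofReal i3 (Eventually.of_forall fun ω => by
    have := rpow_nonneg (h.pathBound_nonneg (ξ i ω)) p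
    have := rpow_nonneg (abs_nonneg (U i j ω)) p
    positivity)]
  refine lintegral_mono fun ω => ENNReal.ofReal_le_ofReal ?_
  have hx := h.pathBound_nonneg (ξ i ω)
  have hy := abs_nonneg (U i j ω)
  have hx4 := h4 _ hx
  have hy4 := h4 _ hy
  unfold noiseBound
  set x := pathBound Q a b X h.aemeasurable_pathSup (ξ i ω)
  set y := |U i j ω|
  have hq : (x + y + c) ^ 4 ≤ 27 * (x ^ 4 + y ^ 4 + c ^ 4) := by
    have s1 : (x + y + c) ^ 2 ≤ 3 * (x ^ 2 + y ^ 2 + c ^ 2) := by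
      nlinarith [sq_nonneg (x - y), sq_nonneg (x - c), sq_nonneg (y - c)]
    have s2 : (x ^ 2 + y ^ 2 + c ^ 2) ^ 2 ≤ 3 * (x ^ 4 + y ^ 4 + c ^ 4) := by
      nlinarith [sq_nonneg (x ^ 2 - y ^ 2), sq_nonneg (x ^ 2 - c ^ 2), sq_nonneg (y ^ 2 - c ^ 2)]
    have s3 : ((x + y + c) ^ 2) ^ 2 ≤ (3 * (x ^ 2 + y ^ 2 + c ^ 2)) ^ 2 :=
      pow_le_pow_left₀ (sq_nonneg _) s1 2
    nlinarith
  linarith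

end IsSamplingModel

end ModelEnvelope

/-! ### Grids and kernel windows -/

section Windows

/-- The integral of a function minus its translate by `Δ` telescopes to two boundary integrals over
intervals of length `Δ`. The bound does not involve `h`, so the same grid works for every bandwidth.
-/
theorem integral_increment_le {ψ : ℝ → ℝ} {M : ℝ} (hψ : Monotone ψ) (hM : ∀ x, |ψ x| ≤ M)
    {h Δ : ℝ} (hh : 0 < h) (hΔ : 0 ≤ Δ) (p a b : ℝ) :
    ∫ x in a..b, (ψ ((x - p) / h) - ψ ((x - (p + Δ)) / h)) ≤ 2 * M * Δ := by
  set g : ℝ → ℝ := fun x => ψ ((x - p) / h) with hg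
  have hgm : Monotone g := fun x y hxy => hψ (by gcongr)
  have hgi : ∀ x y, IntervalIntegrable g volume x y := fun x y =>
    (hgm.monotoneOn _).intervalIntegrable
  have e : ∀ x, ψ ((x - (p + Δ)) / h) = g (x - Δ) := fun x => by
    simp only [hg]; congr 2; ring
  have hgi' : IntervalIntegrable (fun x => g (x - Δ)) volume a b := by
    have : Monotone fun x => g (x - Δ) := fun x y hxy => hgm (by linarith)
    exact (this.monotoneOn _).intervalIntegrable
  simp only [e]
  rw [intervalIntegral.integral_sub (hgi a b) hgi', intervalIntegral.integral_comp_sub_right,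
    intervalIntegral.integral_interval_sub_interval_comm' (hgi _ _) (hgi _ _) (hgi _ _)]
  have hb : ∀ x y : ℝ, |∫ u in x..y, g u| ≤ M * |y - x| := fun x y => by
    rw [← Real.norm_eq_abs]
    exact intervalIntegral.norm_integral_le_of_norm_le_const fun u _ => hM _
  have h1 := (abs_le.1 (hb (b - Δ) b)).2
  have h2 := (abs_le.1 (hb (a - Δ) a)).1
  rw [sub_sub_cancel, abs_of_nonneg hΔ] at h1 h2
  linarith

/-- The `k`-th point of the equidistant grid of mesh `(b - a) / n`. -/
noncomputable def gridPoint (a b : ℝ) (n k : ℕ) : ℝ := a + k * ((b - a) / n)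

theorem gridPoint_mem {a b : ℝ} (hab : a < b) {n k : ℕ} (hk : k ≤ n) :
    gridPoint a b n k ∈ Icc a b := by
  have h0 : 0 < b - a := sub_pos.2 hab
  rcases Nat.eq_zero_or_pos n with rfl | hn
  · simp [gridPoint, hab.le]
  have hn0 : (0 : ℝ) < n := by exact_mod_cast hn
  have hk' : (k : ℝ) ≤ n := by exact_mod_cast hk
  refine ⟨by unfold gridPoint; linarith [show 0 ≤ (k : ℝ) * ((b - a) / n) by positivity], ?_⟩
  have : (k : ℝ) * ((b - a) / n) ≤ n * ((b - a) / n) := by gcongr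
  rw [mul_div_cancel₀ _ hn0.ne'] at this
  unfold gridPoint
  linarith

theorem exists_gridPoint {a b : ℝ} (hab : a < b) {n : ℕ} (hn : 1 ≤ n) {t : ℝ}
    (ht : t ∈ Icc a b) : ∃ k ∈ Finset.range (n + 1), gridPoint a b n k ≤ t ∧
      t ≤ gridPoint a b n k + (b - a) / n := by
  have h0 : 0 < b - a := sub_pos.2 hab
  have hn0 : (0 : ℝ) < n := by exact_mod_cast hn
  have hΔ : 0 < (b - a) / n := by positivity
  have hx : 0 ≤ (t - a) / ((b - a) / n) := div_nonneg (sub_nonneg.2 ht.1) hΔ.le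
  refine ⟨⌊(t - a) / ((b - a) / n)⌋₊, ?_, ?_, ?_⟩
  · rw [Finset.mem_range, Nat.lt_succ_iff]
    refine Nat.floor_le_of_le ?_
    rw [div_le_iff₀ hΔ, mul_div_cancel₀ _ hn0.ne']
    linarith [ht.2]
  · have := Nat.floor_le hx
    rw [le_div_iff₀ hΔ] at this
    unfold gridPoint
    linarith
  · have := Nat.lt_floor_add_one ((t - a) / ((b - a) / n))
    rw [div_lt_iff₀ hΔ] at this
    unfold gridPoint
    linarith

/-- The increment of `ψ` that dominates the oscillation of a rescaled kernel over a grid cell. -/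
noncomputable def cellIncrement (ψ : ℝ → ℝ) (a b h : ℝ) (n k : ℕ) (x : ℝ) : ℝ :=
  ψ ((x - gridPoint a b n k) / h) - ψ ((x - (gridPoint a b n k + (b - a) / n)) / h)

theorem measurable_cellIncrement {ψ : ℝ → ℝ} (hψ : Monotone ψ) (a b h : ℝ) (n k : ℕ) :
    Measurable (cellIncrement ψ a b h n k) := by
  have := hψ.measurable
  unfold cellIncrement
  fun_prop

theorem abs_cellIncrement_le {ψ : ℝ → ℝ} {M : ℝ} (hM : ∀ x, |ψ x| ≤ M) (a b h : ℝ) (n k : ℕ)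
    (x : ℝ) : |cellIncrement ψ a b h n k x| ≤ 2 * M := by
  refine (abs_sub _ _).trans ?_
  linarith [hM ((x - gridPoint a b n k) / h), hM ((x - (gridPoint a b n k + (b - a) / n)) / h)]

theorem cellIncrement_nonneg {ψ : ℝ → ℝ} (hψ : Monotone ψ) {a b h : ℝ} (hab : a < b) (hh : 0 < h)
    (n k : ℕ) (x : ℝ) : 0 ≤ cellIncrement ψ a b h n k x := by
  have h0 : 0 ≤ (b - a) / n := div_nonneg (sub_pos.2 hab).le (Nat.cast_nonneg _)
  exact sub_nonneg.2 (hψ (by gcongr; linarith))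

/-- Moving the evaluation point within a cell moves the kernel argument to the left, so monotonicity
of `ψ` allows the far end of the cell to replace `t`. -/
theorem abs_sub_le_cellIncrement {k ψ : ℝ → ℝ} (hψ : Monotone ψ)
    (hk : ∀ x y, x ≤ y → |k x - k y| ≤ ψ y - ψ x) {a b h t : ℝ} (hh : 0 < h) {n l : ℕ}
    (h1 : gridPoint a b n l ≤ t) (h2 : t ≤ gridPoint a b n l + (b - a) / n) (x : ℝ) :
    |k ((x - t) / h) - k ((x - gridPoint a b n l) / h)| ≤ cellIncrement ψ a b h n l x := by
  refine (hk _ _ (by gcongr)).trans ?_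
  exact sub_le_sub_left (hψ (by gcongr)) _

/-- The weight of `x` when the points of `F` have already been counted. -/
noncomputable def freshWeight (F : Finset ℕ) (q : ℝ≥0∞) (x : ℕ) : ℝ≥0∞ := if x ∈ F then 1 else q

/-- Adding an index multiplies the window probability by `q` only if the index is new. Writing this
as a weight lets the sums over coinciding and distinct indices be carried out together. -/
theorem pow_card_insert (F : Finset ℕ) (q : ℝ≥0∞) (x : ℕ) :
    q ^ (insert x F).card = q ^ F.card * freshWeight F q x := by
  unfold freshWeight
  split_ifs with h
  · rw [Finset.insert_eq_of_mem h, mul_one]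
  · rw [Finset.card_insert_of_notMem h, pow_succ]

theorem sum_freshWeight_le (F : Finset ℕ) (q : ℝ≥0∞) (m : ℕ) :
    ∑ x ∈ Finset.range m, freshWeight F q x ≤ F.card + m * q := by
  have h : ∀ x ∈ Finset.range m, freshWeight F q x ≤ (if x ∈ F then 1 else 0) + q := by
    intro x _
    unfold freshWeight
    split_ifs <;> simp
  refine (Finset.sum_le_sum h).trans ?_
  rw [Finset.sum_add_distrib, Finset.sum_const, Finset.card_range, nsmul_eq_mul,
    Finset.sum_ite_mem, Finset.sum_const, nsmul_eq_mul, mul_one]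
  gcongr
  exact Finset.inter_subset_right

end Windows

/-! ### Window probabilities and second moments for one curve -/

section ModelWindows

variable {Ω 𝒳 : Type*} [mΩ : MeasurableSpace Ω] [MeasurableSpace 𝒳]
  {P : Measure Ω} {Q : Measure 𝒳} {a b : ℝ} {X : 𝒳 → ℝ → ℝ} {fT : ℝ → ℝ}
  {ξ : ℕ → Ω → 𝒳} {T U : ℕ → ℕ → Ω → ℝ}

theorem designLaw_window_le {MT : ℝ} (hMT : ∀ t ∈ Icc a b, fT t ≤ MT) (h0 : 0 ≤ MT) {h : ℝ}
    (t : ℝ) :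
    designLaw a b fT (Icc (t - h) (t + h)) ≤ ENNReal.ofReal (2 * MT * h) := by
  refine (designLaw_le hMT _).trans ?_
  rw [Measure.smul_apply, smul_eq_mul]
  calc ENNReal.ofReal MT * volume.restrict (Icc a b) (Icc (t - h) (t + h))
      ≤ ENNReal.ofReal MT * volume (Icc (t - h) (t + h)) := by
        gcongr; exact Measure.restrict_le_self
    _ = _ := by
        rw [Real.volume_Icc, ← ENNReal.ofReal_mul h0]; congr 1; ring

namespace IsSamplingModel

theorem lintegral_cellIncrement_le (hmod : IsSamplingModel P Q a b X fT ξ T U) (hab : a < b)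
    {MT : ℝ} (hMT : ∀ t ∈ Icc a b, fT t ≤ MT) (h0 : 0 ≤ MT) {ψ : ℝ → ℝ} {M : ℝ} (hψ : Monotone ψ)
    (hM : ∀ x, |ψ x| ≤ M) {h : ℝ} (hh : 0 < h) (n k i j : ℕ) :
    ∫⁻ ω, ‖cellIncrement ψ a b h n k (T i j ω)‖ₑ ∂P
      ≤ ENNReal.ofReal (2 * MT * M * (b - a) / n) := by
  have hm := measurable_cellIncrement hψ a b h n k
  have hΔ : 0 ≤ (b - a) / n := div_nonneg (sub_pos.2 hab).le (Nat.cast_nonneg _)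
  rw [hmod.lintegral_design i j hm.enorm]
  refine (lintegral_mono' (designLaw_le hMT) le_rfl).trans ?_
  rw [lintegral_smul_measure, smul_eq_mul]
  have e : ∫⁻ t in Icc a b, ‖cellIncrement ψ a b h n k t‖ₑ
      = ENNReal.ofReal (∫ t in Icc a b, cellIncrement ψ a b h n k t) := by
    rw [ofReal_integral_eq_lintegral_ofReal]
    · exact lintegral_congr fun t => Real.enorm_of_nonneg (cellIncrement_nonneg hψ hab hh n k t)
    · exact Integrable.of_bound hm.aestronglyMeasurable (2 * M)
        (Eventually.of_forall fun x => abs_cellIncrement_le hM a b h n k x)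
    · exact Eventually.of_forall fun t => cellIncrement_nonneg hψ hab hh n k t
  rw [e, ← ENNReal.ofReal_mul h0]
  refine ENNReal.ofReal_le_ofReal ?_
  rw [integral_Icc_eq_integral_Ioc, ← intervalIntegral.integral_of_le hab.le]
  have := integral_increment_le hψ hM hh hΔ (gridPoint a b n k) a b
  calc _ ≤ MT * (2 * M * ((b - a) / n)) := by gcongr; exact this
    _ = _ := by ring

/-- The integrand is bounded and lives on the event that all points indexed by `F` fall into the
window, so its integral is of the order of a window probability to the number of distinct points. -/
theorem lintegral_enorm_le_of_window (hmod : IsSamplingModel P Q a b X fT ξ T U) (i : ℕ)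
    {B : Set ℝ} (hB : MeasurableSet B) (F : Finset ℕ) {f : Ω → ℝ} {C : ℝ} (hfC : ∀ ω, |f ω| ≤ C)
    (hf : ∀ ω, (∃ j ∈ F, T i j ω ∉ B) → f ω = 0) :
    ∫⁻ ω, ‖f ω‖ₑ ∂P ≤ ENNReal.ofReal C * designLaw a b fT B ^ F.card := by
  rw [← hmod.measure_forall_mem_design i hB F]
  have hms : MeasurableSet {ω | ∀ j ∈ F, T i j ω ∈ B} := by
    have : {ω | ∀ j ∈ F, T i j ω ∈ B} = ⋂ j ∈ F, T i j ⁻¹' B := by ext; simp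
    rw [this]
    exact Finset.measurableSet_biInter _ fun j _ => hmod.measurable_design i j hB
  rw [← lintegral_indicator_const hms]
  refine lintegral_mono fun ω => ?_
  by_cases hω : ∀ j ∈ F, T i j ω ∈ B
  · rw [indicator_of_mem (by exact hω), Real.enorm_eq_ofReal_abs]
    exact ENNReal.ofReal_le_ofReal (hfC ω)
  · push Not at hω
    rw [hf ω hω]
    simp

/-- The second moments of the kernel averages over one curve. -/
theorem sum_lintegral_window_le (hmod : IsSamplingModel P Q a b X fT ξ T U) (i m : ℕ)
    {B : Set ℝ} (hB : MeasurableSet B) {q : ℝ} (hq : 0 ≤ q)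
    (hBq : designLaw a b fT B ≤ ENNReal.ofReal q) {φ : ℝ → ℝ} {M : ℝ} (hM : ∀ x, |φ x| ≤ M)
    (hφ : ∀ x, x ∉ B → φ x = 0) :
    ENNReal.ofReal (((Finset.range m).card : ℝ)⁻¹ ^ 2) * ∑ l ∈ Finset.range m,
        ∑ l' ∈ Finset.range m,
      ∫⁻ ω, ‖φ (T i l ω) * φ (T i l' ω)‖ₑ ∂P ≤ ENNReal.ofReal (M ^ 2 * (q * (m : ℝ)⁻¹
        + q ^ 2)) := by
  have hM0 : 0 ≤ M := (abs_nonneg _).trans (hM 0)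
  rcases Nat.eq_zero_or_pos m with rfl | hm
  · simp
  have hm0 : (0 : ℝ) < m := by exact_mod_cast hm
  have h1 : ∀ l l', ∫⁻ ω, ‖φ (T i l ω) * φ (T i l' ω)‖ₑ ∂P
      ≤ ENNReal.ofReal (M ^ 2 * q) * freshWeight {l} (ENNReal.ofReal q) l' := by
    intro l l'
    refine (hmod.lintegral_enorm_le_of_window i hB (insert l' {l}) (C := M ^ 2) (fun ω => ?_)
      ?_).trans ?_
    · rw [abs_mul, sq]; gcongr <;> exact hM _
    · rintro ω ⟨j, hj, hjB⟩
      simp only [Finset.mem_insert, Finset.mem_singleton] at hj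
      rcases hj with rfl | rfl <;> simp [hφ _ hjB]
    · calc _ ≤ ENNReal.ofReal (M ^ 2) * ENNReal.ofReal q ^ (insert l' {l} :
        Finset ℕ).card := by gcongr
        _ = _ := by
          rw [pow_card_insert, Finset.card_singleton, pow_one, ENNReal.ofReal_mul (by positivity),
            mul_assoc]
  have h2 : ∀ l, ∑ l' ∈ Finset.range m, ∫⁻ ω, ‖φ (T i l ω) * φ (T i l' ω)‖ₑ ∂P
      ≤ ENNReal.ofReal (M ^ 2 * q * (1 + m * q)) := by
    intro l
    refine (Finset.sum_le_sum fun l' _ => h1 l l').trans ?_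
    rw [← Finset.mul_sum, ENNReal.ofReal_mul (p := M ^ 2 * q) (by positivity)]
    gcongr
    refine (sum_freshWeight_le _ _ _).trans ?_
    rw [ENNReal.ofReal_add zero_le_one (by positivity), ENNReal.ofReal_mul (by positivity)]
    simp
  calc _ ≤ ENNReal.ofReal (((Finset.range m).card : ℝ)⁻¹ ^ 2) *
        ∑ l ∈ Finset.range m, ENNReal.ofReal (M ^ 2 * q * (1 + m * q)) := by
        gcongr with l; exact h2 l
    _ = _ := by
        rw [Finset.sum_const, Finset.card_range, nsmul_eq_mul, ← ENNReal.ofReal_natCast,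
          ← ENNReal.ofReal_mul (by positivity), ← ENNReal.ofReal_mul (by positivity)]
        congr 1
        field_simp

/-- The second moments of the kernel averages over the pairs of one curve. -/
theorem sum_lintegral_window_pair_le (hmod : IsSamplingModel P Q a b X fT ξ T U) (i : ℕ) {m : ℕ}
    (hm : 2 ≤ m) {B : Set ℝ} (hB : MeasurableSet B) {q : ℝ} (hq : 0 ≤ q)
    (hBq : designLaw a b fT B ≤ ENNReal.ofReal q) {φ : ℝ × ℝ → ℝ} {M : ℝ} (hM : ∀ x, |φ x| ≤ M)
    (hφ : ∀ x, (x.1 ∉ B ∨ x.2 ∉ B) → φ x = 0) :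
    ENNReal.ofReal (((Finset.range m).offDiag.card : ℝ)⁻¹ ^ 2) *
      ∑ l ∈ (Finset.range m).offDiag, ∑ l' ∈ (Finset.range m).offDiag,
      ∫⁻ ω, ‖φ (T i l.1 ω, T i l.2 ω) * φ (T i l'.1 ω, T i l'.2 ω)‖ₑ ∂P
        ≤ ENNReal.ofReal (M ^ 2 * (16 * q ^ 2 * ((m : ℝ) ^ 2)⁻¹ + 4 * q ^ 4)) := by
  have hM0 : 0 ≤ M := (abs_nonneg _).trans (hM 0)
  have hm0 : (2 : ℝ) ≤ m := by exact_mod_cast hm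
  have h1 : ∀ l ∈ (Finset.range m).offDiag, ∀ l' ∈ (Finset.range m).offDiag,
      ∫⁻ ω, ‖φ (T i l.1 ω, T i l.2 ω) * φ (T i l'.1 ω, T i l'.2 ω)‖ₑ ∂P
      ≤ ENNReal.ofReal (M ^ 2 * q ^ 2) * (freshWeight {l.1, l.2} (ENNReal.ofReal q) l'.1
          * freshWeight {l.1, l.2} (ENNReal.ofReal q) l'.2) := by
    intro l hl l' hl'
    rw [Finset.mem_offDiag] at hl hl'
    refine (hmod.lintegral_enorm_le_of_window i hB (insert l'.1 (insert l'.2 {l.1, l.2}))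
      (C := M ^ 2) (fun ω => ?_) ?_).trans ?_
    · rw [abs_mul, sq]; gcongr <;> exact hM _
    · rintro ω ⟨j, hj, hjB⟩
      simp only [Finset.mem_insert, Finset.mem_singleton] at hj
      rcases hj with rfl | rfl | rfl | rfl
      · rw [hφ (T i l'.1 ω, T i l'.2 ω) (Or.inl hjB), mul_zero]
      · rw [hφ (T i l'.1 ω, T i l'.2 ω) (Or.inr hjB), mul_zero]
      · rw [hφ (T i l.1 ω, T i l.2 ω) (Or.inl hjB), zero_mul]
      · rw [hφ (T i l.1 ω, T i l.2 ω) (Or.inr hjB), zero_mul]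
    · calc _ ≤ ENNReal.ofReal (M ^ 2) *
            ENNReal.ofReal q ^ (insert l'.1 (insert l'.2 {l.1, l.2}) : Finset ℕ).card := by gcongr
        _ = _ := by
          -- The two indices of the pair `l'` differ, so whether the first is fresh does not depend
          -- on the second; the weight becomes a product and the sum over pairs a square.
          have e : freshWeight (insert l'.2 {l.1, l.2}) (ENNReal.ofReal q) l'.1
              = freshWeight {l.1, l.2} (ENNReal.ofReal q) l'.1 := by
            unfold freshWeight
            simp only [Finset.mem_insert, hl'.2.2, false_or]
          rw [pow_card_insert, pow_card_insert, Finset.card_pair hl.2.2, e,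
            ENNReal.ofReal_mul (by positivity), ENNReal.ofReal_pow hq]
          ring
  have h2 : ∀ l ∈ (Finset.range m).offDiag, ∑ l' ∈ (Finset.range m).offDiag,
      ∫⁻ ω, ‖φ (T i l.1 ω, T i l.2 ω) * φ (T i l'.1 ω, T i l'.2 ω)‖ₑ ∂P
      ≤ ENNReal.ofReal (M ^ 2 * q ^ 2 * (2 + m * q) ^ 2) := by
    intro l hl
    refine (Finset.sum_le_sum fun l' hl' => h1 l hl l' hl').trans ?_
    rw [Finset.mem_offDiag] at hl
    rw [← Finset.mul_sum, ENNReal.ofReal_mul (p := M ^ 2 * q ^ 2) (by positivity)]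
    gcongr
    calc _ ≤ ∑ l' ∈ Finset.range m ×ˢ Finset.range m,
          freshWeight {l.1, l.2} (ENNReal.ofReal q) l'.1
          * freshWeight {l.1, l.2} (ENNReal.ofReal q) l'.2 :=
          Finset.sum_le_sum_of_subset fun l hl => by
            rw [Finset.mem_offDiag] at hl; exact Finset.mem_product.2 ⟨hl.1, hl.2.1⟩
      _ = (∑ x ∈ Finset.range m, freshWeight {l.1, l.2} (ENNReal.ofReal q) x) ^ 2 := by
          rw [Finset.sum_product, sq, Finset.sum_mul_sum]
      _ ≤ (2 + m * ENNReal.ofReal q) ^ 2 := by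
          gcongr
          refine (sum_freshWeight_le _ _ _).trans ?_
          rw [Finset.card_pair hl.2.2]
          simp
      _ = _ := by
          rw [ENNReal.ofReal_pow (by positivity), ENNReal.ofReal_add zero_le_two (by positivity),
            ENNReal.ofReal_mul (by positivity)]
          simp
  have hcard : (((Finset.range m).offDiag.card : ℕ) : ℝ) = m * m - m := by
    rw [Finset.offDiag_card, Finset.card_range, Nat.cast_sub (Nat.le_mul_self m)]
    push_cast; ring
  have hc0 : (m : ℝ) ^ 2 / 2 ≤ m * m - m := by nlinarith
  have hc1 : (0 : ℝ) < (m : ℝ) ^ 2 / 2 := by positivity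
  set N : ℝ := (m : ℝ) * m - m with hN
  have hNpos : 0 < N := hc1.trans_le hc0
  calc _ ≤ ENNReal.ofReal (N⁻¹ ^ 2) * ∑ l ∈ (Finset.range m).offDiag,
          ENNReal.ofReal (M ^ 2 * q ^ 2 * (2 + m * q) ^ 2) := by
        rw [hcard]; gcongr with l hl; exact h2 l hl
    _ = ENNReal.ofReal (N⁻¹ * (M ^ 2 * q ^ 2 * (2 + m * q) ^ 2)) := by
        rw [Finset.sum_const, nsmul_eq_mul, ← ENNReal.ofReal_natCast, hcard,
          ← ENNReal.ofReal_mul (by positivity), ← ENNReal.ofReal_mul (by positivity)]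
        congr 1
        field_simp
    _ ≤ _ := by
        refine ENNReal.ofReal_le_ofReal ?_
        have h3 : N⁻¹ ≤ 2 * ((m : ℝ) ^ 2)⁻¹ := by
          have := inv_anti₀ hc1 hc0
          rwa [inv_div, div_eq_mul_inv] at this
        -- The contribution of pairs that share exactly one index, of order `q³ / m`, is absorbed
        -- into `q² / m²` and `q⁴` by the arithmetic-geometric mean inequality.
        have h4 : (2 + (m : ℝ) * q) ^ 2 ≤ 8 + 2 * (m * q) ^ 2 := by
          nlinarith [sq_nonneg (2 - (m : ℝ) * q)]
        calc N⁻¹ * (M ^ 2 * q ^ 2 * (2 + m * q) ^ 2)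
            ≤ 2 * ((m : ℝ) ^ 2)⁻¹ * (M ^ 2 * q ^ 2 * (8 + 2 * (m * q) ^ 2)) := by gcongr
          _ = _ := by field_simp; ring

end IsSamplingModel

end ModelWindows

/-! ### The observations as arrays of curves -/

section Arrays

variable {Ω 𝒳 : Type*} [mΩ : MeasurableSpace Ω] [MeasurableSpace 𝒳]
  {P : Measure Ω} {Q : Measure 𝒳} {a b : ℝ} {X : 𝒳 → ℝ → ℝ} {fT : ℝ → ℝ}
  {ξ : ℕ → Ω → 𝒳} {T U : ℕ → ℕ → Ω → ℝ}

/-- Supplies the constant `c` added to the envelopes. It is at least one so that the constant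
response `1` is dominated too, and the second moment is compared with `c ^ 2` because pairs are
dominated by products of two envelopes. The covariance is bounded by its Taylor expansion at `(a,
a)`. -/
theorem exists_bound_of_smooth (hab : a < b) (hmean : MeanSmoothness a b (meanFun Q X))
    (hcov : CovSmoothness a b (covFun Q X)) :
    ∃ c, 1 ≤ c ∧ (∀ t ∈ Icc a b, |meanFun Q X t| ≤ c) ∧
      ∀ s ∈ Icc a b, ∀ t ∈ Icc a b, |secondMoment Q X s t| ≤ c ^ 2 := by
  have ha : a ∈ Icc a b := left_mem_Icc.2 hab.le
  obtain ⟨f', f'', M, hf⟩ := hmean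
  have hM : 0 ≤ M := (abs_nonneg _).trans (hf a ha).2.2
  set μ := meanFun Q X with hμ
  have hd : ∀ t ∈ Icc a b, |t - a| ≤ b - a := fun t ht => by
    rw [abs_of_nonneg (by linarith [ht.1])]; linarith [ht.2]
  obtain ⟨c₁, hc₁⟩ : ∃ c, ∀ t ∈ Icc a b, |μ t| ≤ c := by
    have hcont : ContinuousOn μ (Icc a b) := fun t ht => (hf t ht).1.continuousWithinAt
    exact (isCompact_Icc.exists_bound_of_continuousOn hcont)
  obtain ⟨F₁, F₂, F₁₁, F₁₂, F₂₁, F₂₂, M', hF⟩ := hcov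
  have hM' : 0 ≤ M' := (abs_nonneg _).trans (hF a ha a ha).2.2.2.2.2.2.1
  obtain ⟨c₂, hc₂⟩ : ∃ c, ∀ s ∈ Icc a b, ∀ t ∈ Icc a b, |covFun Q X s t| ≤ c := by
    refine ⟨|covFun Q X a a| + |F₁ a a| * (b - a) + |F₂ a a| * (b - a)
      + M' * ((b - a) + (b - a)) ^ 2, fun s hs t ht => ?_⟩
    have := abs_sub_taylor_le_of_partials (fun s hs t ht => (hF s hs t ht).1)
      (fun s hs t ht => (hF s hs t ht).2.1) (fun s hs t ht => (hF s hs t ht).2.2.1)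
      (fun s hs t ht => (hF s hs t ht).2.2.2.1) (fun s hs t ht => (hF s hs t ht).2.2.2.2.2.1)
      (fun s hs t ht => (hF s hs t ht).2.2.2.2.2.2.1)
      (fun s hs t ht => (hF s hs t ht).2.2.2.2.2.2.2.1)
      (fun s hs t ht => (hF s hs t ht).2.2.2.2.2.2.2.2.2) ha ha hs ht
    have h1 : |F₁ a a * (s - a)| ≤ |F₁ a a| * (b - a) := by
      rw [abs_mul]; gcongr; exact hd s hs
    have h2 : |F₂ a a * (t - a)| ≤ |F₂ a a| * (b - a) := by
      rw [abs_mul]; gcongr; exact hd t ht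
    have h3 : M' * (|s - a| + |t - a|) ^ 2 ≤ M' * ((b - a) + (b - a)) ^ 2 := by
      gcongr; exacts [hd s hs, hd t ht]
    have h4 := abs_le.1 this
    have h5 := abs_le.1 h1
    have h6 := abs_le.1 h2
    have h7 := neg_abs_le (covFun Q X a a)
    have h8 := le_abs_self (covFun Q X a a)
    rw [abs_le]
    constructor <;> linarith [h4.1, h4.2, h5.1, h5.2, h6.1, h6.2]
  have p1 : 0 ≤ c₁ := (abs_nonneg _).trans (hc₁ a ha)
  have p2 : 0 ≤ c₂ := (abs_nonneg _).trans (hc₂ a ha a ha)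
  refine ⟨1 + c₁ + c₂, by linarith, fun t ht => by linarith [hc₁ t ht], fun s hs t ht => ?_⟩
  have h1 : |μ s * μ t| ≤ c₁ * c₁ := by
    rw [abs_mul]; gcongr; exacts [hc₁ s hs, hc₁ t ht]
  unfold secondMoment
  refine (abs_add_le _ _).trans ?_
  have := hc₂ s hs t ht
  rw [← hμ]
  nlinarith

namespace IsSamplingModel

theorem measurable_noiseBound (h : IsSamplingModel P Q a b X fT ξ T U) (c : ℝ) (i j : ℕ) :
    Measurable[genAlg ξ T U (noiseIdx i)] (h.noiseBound c i j) := by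
  have h1 : Measurable[genAlg ξ T U (noiseIdx i)] (ξ i) := measurable_genAlg_path (Or.inl rfl)
  have h2 : Measurable[genAlg ξ T U (noiseIdx i)] (U i j) :=
    measurable_genAlg_error (Or.inr ⟨j, rfl⟩)
  exact (((measurable_pathBound h.aemeasurable_pathSup).comp h1).add
    (continuous_abs.measurable.comp h2)).add_const c

theorem measurable_observation (h : IsSamplingModel P Q a b X fT ξ T U)
    {S : Set (ℕ ⊕ (ℕ × ℕ ⊕ ℕ × ℕ))} {i j : ℕ} (h1 : Sum.inl i ∈ S)
    (h2 : Sum.inr (Sum.inl (i, j)) ∈ S) :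
    Measurable[genAlg ξ T U S] fun ω => X (ξ i ω) (T i j ω) :=
  h.measurable_process.comp ((measurable_genAlg_path h1).prodMk (measurable_genAlg_design h2))

/-- Products of two envelopes are dominated by fourth powers. -/
theorem exists_moment_bounds (h : IsSamplingModel P Q a b X fT ξ T U) [IsProbabilityMeasure P]
    {c : ℝ} (hc : 1 ≤ c) {p : ℝ} (hp : 4 ≤ p) (hmom : MomentCondition P Q a b X U p) :
    ∃ C, 0 ≤ C ∧
      (∀ i j k, ∫⁻ ω, ENNReal.ofReal (h.noiseBound c i j ω * h.noiseBound c i k ω) ∂P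
        ≤ ENNReal.ofReal C) ∧
      ∀ i j k j' k', ∫⁻ ω, ENNReal.ofReal ((h.noiseBound c i j ω * h.noiseBound c i k ω)
        * (h.noiseBound c i j' ω * h.noiseBound c i k' ω)) ∂P ≤ ENNReal.ofReal C := by
  obtain ⟨C, hC, hb⟩ := h.exists_lintegral_noiseBound_pow_four_le c hp hmom
  have hH1 : ∀ i j ω, 1 ≤ h.noiseBound c i j ω := fun i j ω => hc.trans (h.noiseBound_ge c i j ω)
  have hHm : ∀ i j, Measurable fun ω => ENNReal.ofReal (h.noiseBound c i j ω ^ 4) := fun i j =>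
    ENNReal.measurable_ofReal.comp
      (((h.measurable_noiseBound c i j).mono (h.genAlg_le _) le_rfl).pow_const 4)
  have key : ∀ i j k j' k', ∫⁻ ω, ENNReal.ofReal ((h.noiseBound c i j ω * h.noiseBound c i k ω)
        * (h.noiseBound c i j' ω * h.noiseBound c i k' ω)) ∂P ≤ ENNReal.ofReal (4 * C) := by
    intro i j k j' k'
    have h4 : ENNReal.ofReal (4 * C) = ENNReal.ofReal C + ENNReal.ofReal C + ENNReal.ofReal C
        + ENNReal.ofReal C := by
      rw [← ENNReal.ofReal_add hC hC, ← ENNReal.ofReal_add (by positivity) hC,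
        ← ENNReal.ofReal_add (by positivity) hC]
      congr 1; ring
    calc _ ≤ ∫⁻ ω, (ENNReal.ofReal (h.noiseBound c i j ω ^ 4)
          + ENNReal.ofReal (h.noiseBound c i k ω ^ 4) + ENNReal.ofReal (h.noiseBound c i j' ω ^ 4)
          + ENNReal.ofReal (h.noiseBound c i k' ω ^ 4)) ∂P := by
          refine lintegral_mono fun ω => ?_
          have h1 := hH1 i j ω
          have h2 := hH1 i k ω
          have h3 := hH1 i j' ω
          have h4 := hH1 i k' ω
          set x := h.noiseBound c i j ω
          set y := h.noiseBound c i k ω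
          set z := h.noiseBound c i j' ω
          set w := h.noiseBound c i k' ω
          rw [← ENNReal.ofReal_add (by positivity) (by positivity),
            ← ENNReal.ofReal_add (by positivity) (by positivity),
            ← ENNReal.ofReal_add (by positivity) (by positivity)]
          refine ENNReal.ofReal_le_ofReal ?_
          nlinarith [sq_nonneg (x * y - z * w), sq_nonneg (x ^ 2 - y ^ 2),
            sq_nonneg (z ^ 2 - w ^ 2), sq_nonneg (x * y + z * w), sq_nonneg (x ^ 2),
            sq_nonneg (y ^ 2), sq_nonneg (z ^ 2), sq_nonneg (w ^ 2)]
      _ ≤ _ := by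
          rw [lintegral_add_right _ (hHm i k'), lintegral_add_right _ (hHm i j'),
            lintegral_add_right _ (hHm i k), h4]
          gcongr <;> exact hb _ _
  refine ⟨4 * C, by positivity, fun i j k => ?_, key⟩
  refine le_trans (lintegral_mono fun ω => ENNReal.ofReal_le_ofReal ?_) (key i j k j k)
  have h1 := hH1 i j ω
  have h2 := hH1 i k ω
  exact le_mul_of_one_le_right (by positivity) (by nlinarith)

theorem integrable_of_abs_le_noiseBound (h : IsSamplingModel P Q a b X fT ξ T U)
    [IsProbabilityMeasure P] {c : ℝ} (hc : 1 ≤ c) {p : ℝ} (hp : 4 ≤ p)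
    (hmom : MomentCondition P Q a b X U p) (i j k : ℕ) {M : ℝ} {f : Ω → ℝ} (hf : Measurable f)
    (hfH : ∀ᵐ ω ∂P, |f ω| ≤ M * (h.noiseBound c i j ω * h.noiseBound c i k ω)) :
    Integrable f P := by
  obtain ⟨C, -, hb, -⟩ := h.exists_moment_bounds hc hp hmom
  have hHm : ∀ j, Measurable (h.noiseBound c i j) := fun j =>
    (h.measurable_noiseBound c i j).mono (h.genAlg_le _) le_rfl
  have hi : Integrable (fun ω => h.noiseBound c i j ω * h.noiseBound c i k ω) P := by
    refine ⟨((hHm j).mul (hHm k)).aestronglyMeasurable, ?_⟩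
    have h0 : 0 ≤ᵐ[P] fun ω => h.noiseBound c i j ω * h.noiseBound c i k ω :=
      Eventually.of_forall fun ω => mul_nonneg
        ((zero_le_one.trans hc).trans (h.noiseBound_ge c i j ω))
        ((zero_le_one.trans hc).trans (h.noiseBound_ge c i k ω))
    rw [hasFiniteIntegral_iff_ofReal h0]
    exact (hb i j k).trans_lt ENNReal.ofReal_lt_top
  exact (hi.const_mul M).mono' hf.aestronglyMeasurable hfH

/-- A family of responses that is dominated by the envelopes. -/
theorem exists_isCurveArray (h : IsSamplingModel P Q a b X fT ξ T U) [IsProbabilityMeasure P]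
    {c : ℝ} (hc : 1 ≤ c) {p : ℝ} (hp : 4 ≤ p) (hmom : MomentCondition P Q a b X U p)
    {y : ℕ → ℕ → Ω → ℝ} (hy : ∀ i j, Measurable[genAlg ξ T U (curveIdx i)] (y i j))
    (hyH : ∀ᵐ ω ∂P, ∀ i j, |y i j ω| ≤ h.noiseBound c i j ω) (s : ℕ → ℕ → Finset ℕ) :
    ∃ CZ, IsCurveArray P (fun i => genAlg ξ T U (curveIdx i)) (fun i => genAlg ξ T U (noiseIdx i))
      (fun i => genAlg ξ T U (designIdx i)) T y (h.noiseBound c) CZ s := by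
  obtain ⟨C, hC, hb, -⟩ := h.exists_moment_bounds hc hp hmom
  refine ⟨C, fun i => h.genAlg_le _, h.iIndep_curve, fun i => genAlg_mono ?_,
    fun i => genAlg_mono ?_, h.indep_noise_design, hy, h.measurable_noiseBound c,
    fun i j => measurable_genAlg_design (S := designIdx i) ⟨j, rfl⟩, hyH, hC, fun n i _ l _ l' _
        => hb i l l'⟩
  · rintro q (rfl | ⟨j, rfl⟩) <;> rfl
  · rintro q ⟨j, rfl⟩; rfl

theorem exists_isCurveArray_pair (h : IsSamplingModel P Q a b X fT ξ T U) [IsProbabilityMeasure P]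
    {c : ℝ} (hc : 1 ≤ c) {p : ℝ} (hp : 4 ≤ p) (hmom : MomentCondition P Q a b X U p)
    {y : ℕ → ℕ × ℕ → Ω → ℝ} (hy : ∀ i l, Measurable[genAlg ξ T U (curveIdx i)] (y i l))
    (hyH : ∀ᵐ ω ∂P, ∀ i l, |y i l ω| ≤ h.noiseBound c i l.1 ω * h.noiseBound c i l.2 ω)
    (s : ℕ → ℕ → Finset (ℕ × ℕ)) :
    ∃ CZ, IsCurveArray P (fun i => genAlg ξ T U (curveIdx i)) (fun i => genAlg ξ T U (noiseIdx i))
      (fun i => genAlg ξ T U (designIdx i)) (fun i l ω => (T i l.1 ω, T i l.2 ω)) y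
      (fun i l ω => h.noiseBound c i l.1 ω * h.noiseBound c i l.2 ω) CZ s := by
  obtain ⟨C, hC, -, hb⟩ := h.exists_moment_bounds hc hp hmom
  refine ⟨C, fun i => h.genAlg_le _, h.iIndep_curve, fun i => genAlg_mono ?_,
    fun i => genAlg_mono ?_, h.indep_noise_design, hy,
    fun i l => (h.measurable_noiseBound c i l.1).mul (h.measurable_noiseBound c i l.2),
    fun i l => (measurable_genAlg_design (S := designIdx i) ⟨l.1, rfl⟩).prodMk
      (measurable_genAlg_design (S := designIdx i) ⟨l.2, rfl⟩),
    hyH, hC, fun n i _ l _ l' _ => hb i l.1 l.2 l'.1 l'.2⟩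
  · rintro q (rfl | ⟨j, rfl⟩) <;> rfl
  · rintro q ⟨j, rfl⟩; rfl

theorem exists_isCurveEnvelope (h : IsSamplingModel P Q a b X fT ξ T U) [IsProbabilityMeasure P]
    {c : ℝ} (hc : 0 ≤ c) {lam : ℝ} (hlam : 2 < lam) (hmom : MomentCondition P Q a b X U lam)
    (m : ℕ → ℕ → ℕ) :
    ∃ CG, IsCurveEnvelope P (h.noiseBound c) (fun n i => Finset.range (m n i)) (h.curveBound c)
      lam CG := by
  refine ⟨_, Eventually.of_forall fun ω i => h.curveBound_nonneg hc i ω, ?_,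
    h.ae_sum_curveBound_rpow_le hc hlam.le hmom, h.integrable_curveBound_rpow hc hlam.le hmom,
    h.integral_curveBound_rpow_le hc hlam.le hmom⟩
  filter_upwards [h.ae_favg_noiseBound_le hc hlam.le hmom] with ω hω n i _
  exact hω i (m n i)

theorem exists_isCurveEnvelope_pair (h : IsSamplingModel P Q a b X fT ξ T U)
    [IsProbabilityMeasure P] {c : ℝ} (hc : 0 ≤ c) {lam : ℝ} (hlam : 2 < lam)
    (hmom : MomentCondition P Q a b X U (2 * lam)) (m : ℕ → ℕ → ℕ) :
    ∃ CG, IsCurveEnvelope P (fun i (l : ℕ × ℕ) ω => h.noiseBound c i l.1 ω * h.noiseBound c i l.2 ω)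
      (fun n i => (Finset.range (m n i)).offDiag) (fun i ω => 2 * h.curveBound c i ω ^ 2)
      lam CG := by
  have hp : 2 ≤ 2 * lam := by linarith
  have e : ∀ i ω, (2 * h.curveBound c i ω ^ 2) ^ lam = 2 ^ lam * h.curveBound c i ω ^
      (2 * lam) := by
    intro i ω
    rw [mul_rpow zero_le_two (sq_nonneg _), rpow_mul (h.curveBound_nonneg hc i ω)]
    norm_num
  have h2 : (0 : ℝ) ≤ 2 ^ lam := by positivity
  refine ⟨2 ^ lam * (3 ^ (2 * lam) * (∫ x, pathBound Q a b X h.aemeasurable_pathSup x ^ (2 * lam) ∂Q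
        + ∫ ω, (avgSup fun j => U 0 j ω).toReal ^ (2 * lam) ∂P + c ^ (2 * lam))),
    Eventually.of_forall fun ω i => by positivity, ?_, ?_, fun i => ?_, fun i => ?_⟩
  · filter_upwards [h.ae_favg_offDiag_noiseBound_le hc hp hmom] with ω hω n i _
    exact hω i (m n i)
  · filter_upwards [h.ae_sum_curveBound_rpow_le hc hp hmom] with ω ⟨C, hC⟩
    refine ⟨2 ^ lam * C, ?_⟩
    filter_upwards [hC] with n hn
    simp only [e]
    rw [← Finset.mul_sum, mul_assoc]
    gcongr
  · simp only [e]
    exact (h.integrable_curveBound_rpow hc hp hmom i).const_mul _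
  · simp only [e]
    rw [integral_const_mul]
    gcongr
    exact h.integral_curveBound_rpow_le hc hp hmom i

/-! #### Centred responses -/

/-- The responses centred at the mean function. -/
noncomputable def centered (Q : Measure 𝒳) (X : 𝒳 → ℝ → ℝ) (ξ : ℕ → Ω → 𝒳)
    (T U : ℕ → ℕ → Ω → ℝ) (i j : ℕ) (ω : Ω) : ℝ :=
  observation X ξ T U ω i j - meanFun Q X (T i j ω)

/-- The products of two responses centred at the second moment function. -/
noncomputable def centeredPair (Q : Measure 𝒳) (X : 𝒳 → ℝ → ℝ) (ξ : ℕ → Ω → 𝒳)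
    (T U : ℕ → ℕ → Ω → ℝ) (i : ℕ) (l : ℕ × ℕ) (ω : Ω) : ℝ :=
  observation X ξ T U ω i l.1 * observation X ξ T U ω i l.2
    - secondMoment Q X (T i l.1 ω) (T i l.2 ω)

theorem measurable_centered (h : IsSamplingModel P Q a b X fT ξ T U) [SFinite Q] (i j : ℕ) :
    Measurable[genAlg ξ T U (curveIdx i)] (centered Q X ξ T U i j) := by
  have h1 : Measurable[genAlg ξ T U (curveIdx i)] fun ω => X (ξ i ω) (T i j ω) :=
    h.measurable_observation rfl rfl
  have h2 : Measurable[genAlg ξ T U (curveIdx i)] (U i j) := measurable_genAlg_error rfl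
  have h3 : Measurable[genAlg ξ T U (curveIdx i)] (T i j) := measurable_genAlg_design rfl
  exact (h1.add h2).sub ((measurable_meanFun h.measurable_process).comp h3)

theorem measurable_centeredPair (h : IsSamplingModel P Q a b X fT ξ T U) [SFinite Q] (i : ℕ)
    (l : ℕ × ℕ) : Measurable[genAlg ξ T U (curveIdx i)] (centeredPair Q X ξ T U i l) := by
  have h1 : ∀ j, Measurable[genAlg ξ T U (curveIdx i)] fun ω => X (ξ i ω) (T i j ω) :=
    fun j => h.measurable_observation rfl rfl
  have h2 : ∀ j, Measurable[genAlg ξ T U (curveIdx i)] (U i j) :=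
    fun j => measurable_genAlg_error rfl
  have h3 : ∀ j, Measurable[genAlg ξ T U (curveIdx i)] (T i j) :=
    fun j => measurable_genAlg_design rfl
  exact (((h1 l.1).add (h2 l.1)).mul ((h1 l.2).add (h2 l.2))).sub
    ((measurable_secondMoment h.measurable_process).comp ((h3 l.1).prodMk (h3 l.2)))

theorem ae_abs_centered_le (h : IsSamplingModel P Q a b X fT ξ T U) {c p : ℝ} (hp : 0 < p)
    (hfin : ∫⁻ x, pathSup a b X x ^ p ∂Q < ∞) (hc : ∀ t ∈ Icc a b, |meanFun Q X t| ≤ c) :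
    ∀ᵐ ω ∂P, ∀ i j, |centered Q X ξ T U i j ω| ≤ h.noiseBound c i j ω := by
  filter_upwards [h.ae_abs_path_le hp hfin, h.ae_mem_design] with ω h1 h2 i j
  refine (abs_sub _ _).trans ?_
  exact add_le_add ((abs_add_le _ _).trans (add_le_add (h1 i _ (h2 i j)) le_rfl)) (hc _ (h2 i j))

theorem ae_abs_centeredPair_le (h : IsSamplingModel P Q a b X fT ξ T U) {c p : ℝ} (hp : 0 < p)
    (hfin : ∫⁻ x, pathSup a b X x ^ p ∂Q < ∞) (hc0 : 0 ≤ c)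
    (hc : ∀ s ∈ Icc a b, ∀ t ∈ Icc a b, |secondMoment Q X s t| ≤ c ^ 2) :
    ∀ᵐ ω ∂P, ∀ i l, |centeredPair Q X ξ T U i l ω|
      ≤ h.noiseBound c i l.1 ω * h.noiseBound c i l.2 ω := by
  filter_upwards [h.ae_abs_path_le hp hfin, h.ae_mem_design] with ω h1 h2 i l
  refine (abs_sub _ _).trans ?_
  have hY : ∀ j, |observation X ξ T U ω i j|
      ≤ pathBound Q a b X h.aemeasurable_pathSup (ξ i ω) + |U i j ω| := fun j =>
    (abs_add_le _ _).trans (add_le_add (h1 i _ (h2 i j)) le_rfl)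
  have h3 := hc _ (h2 i l.1) _ (h2 i l.2)
  have h4 := hY l.1
  have h5 := hY l.2
  have h6 := h.pathBound_nonneg (ξ i ω)
  rw [abs_mul]
  unfold noiseBound
  set S := pathBound Q a b X h.aemeasurable_pathSup (ξ i ω)
  have h7 := abs_nonneg (U i l.1 ω)
  have h8 := abs_nonneg (U i l.2 ω)
  have h9 : |observation X ξ T U ω i l.1| * |observation X ξ T U ω i l.2|
      ≤ (S + |U i l.1 ω|) * (S + |U i l.2 ω|) := by gcongr
  have h10 : 0 ≤ c * (S + |U i l.1 ω| + (S + |U i l.2 ω|)) := by positivity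
  nlinarith

theorem integral_centered_mul_eq_zero (h : IsSamplingModel P Q a b X fT ξ T U)
    [IsProbabilityMeasure P] [IsProbabilityMeasure Q] {c : ℝ} (hc1 : 1 ≤ c) {p : ℝ} (hp : 4 ≤ p)
    (hmom : MomentCondition P Q a b X U p) (hc : ∀ t ∈ Icc a b, |meanFun Q X t| ≤ c)
    {φ : ℝ → ℝ} (hφ : Measurable φ) {M : ℝ} (hM : ∀ x, |φ x| ≤ M) (i j : ℕ) :
    ∫ ω, centered Q X ξ T U i j ω * φ (T i j ω) ∂P = 0 := by
  have hμ := measurable_meanFun (Q := Q) h.measurable_process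
  have hT := h.measurable_design i j
  have hU := h.measurable_error i j
  have hX := h.measurable_process
  have hξ := (h.realization i).measurable
  have hM0 : 0 ≤ M := (abs_nonneg _).trans (hM 0)
  have hXm : Measurable fun ω => X (ξ i ω) (T i j ω) := hX.comp (hξ.prodMk hT)
  have e : ∀ ω, centered Q X ξ T U i j ω * φ (T i j ω)
      = (X (ξ i ω) (T i j ω) - meanFun Q X (T i j ω)) * φ (T i j ω)
        + U i j ω * φ (T i j ω) := fun ω => by unfold centered observation; ring
  have hH : ∀ ω, 1 ≤ h.noiseBound c i j ω := fun ω => hc1.trans (h.noiseBound_ge c i j ω)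
  have hdom : ∀ {x ω}, |x| ≤ h.noiseBound c i j ω →
      |x * φ (T i j ω)| ≤ M * (h.noiseBound c i j ω * h.noiseBound c i j ω) := by
    intro x ω hx
    have := hH ω
    rw [abs_mul, mul_comm]
    gcongr
    · exact hM _
    · exact hx.trans (le_mul_of_one_le_right (by linarith) this)
  have i1 : Integrable (fun ω => (X (ξ i ω) (T i j ω) - meanFun Q X (T i j ω)) * φ
      (T i j ω)) P := by
    refine h.integrable_of_abs_le_noiseBound hc1 hp hmom i j j (M := M)
      ((hXm.sub (hμ.comp hT)).mul (hφ.comp hT)) ?_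
    filter_upwards [h.ae_abs_path_le (by linarith) hmom.2, h.ae_mem_design] with ω h1 h2
    refine hdom ((abs_sub _ _).trans ?_)
    have := abs_nonneg (U i j ω)
    have := h1 i _ (h2 i j)
    have := hc _ (h2 i j)
    unfold noiseBound
    linarith
  have i2 : Integrable (fun ω => U i j ω * φ (T i j ω)) P := by
    refine h.integrable_of_abs_le_noiseBound hc1 hp hmom i j j (M := M) (hU.mul (hφ.comp hT)) ?_
    refine Eventually.of_forall fun ω => hdom ?_
    have := h.pathBound_nonneg (ξ i ω)
    unfold noiseBound
    linarith
  simp only [e]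
  rw [integral_add i1 i2, h.integral_error_mul_eq_zero i j
    (W := fun ω => φ (T i j ω)) (hφ.comp (measurable_genAlg_design (by simp))), add_zero]
  -- Only one design point occurs; the point with index `j + 1` is a dummy second coordinate.
  refine h.integral_path_design_eq_zero i (Nat.succ_ne_self j).symm
    (F := fun z => (X z.1 z.2.1 - meanFun Q X z.2.1) * φ z.2.1) ?_ fun u hu v _ => ?_
  · have : Measurable fun z : 𝒳 × (ℝ × ℝ) => X z.1 z.2.1 :=
      hX.comp (measurable_fst.prodMk (measurable_fst.comp measurable_snd))
    fun_prop
  · simp only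
    rw [integral_mul_const, integral_path_sub_mean (memLp_path hX (by linarith) hmom.2 hu),
        zero_mul]

theorem integral_centeredPair_mul_eq_zero (h : IsSamplingModel P Q a b X fT ξ T U)
    [IsProbabilityMeasure P] [IsProbabilityMeasure Q] {c : ℝ} (hc1 : 1 ≤ c) {p : ℝ} (hp : 4 ≤ p)
    (hmom : MomentCondition P Q a b X U p)
    (hc : ∀ s ∈ Icc a b, ∀ t ∈ Icc a b, |secondMoment Q X s t| ≤ c ^ 2)
    {φ : ℝ × ℝ → ℝ} (hφ : Measurable φ) {M : ℝ} (hM : ∀ x, |φ x| ≤ M) (i : ℕ) {l : ℕ × ℕ}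
    (hl : l.1 ≠ l.2) :
    ∫ ω, centeredPair Q X ξ T U i l ω * φ (T i l.1 ω, T i l.2 ω) ∂P = 0 := by
  obtain ⟨j, k⟩ := l
  have hjk : j ≠ k := hl
  simp only
  have hC := measurable_secondMoment (Q := Q) h.measurable_process
  have hT := h.measurable_design i
  have hU := h.measurable_error i
  have hX := h.measurable_process
  have hξ := (h.realization i).measurable
  have hM0 : 0 ≤ M := (abs_nonneg _).trans (hM 0)
  have hXm : ∀ j, Measurable fun ω => X (ξ i ω) (T i j ω) := fun j => hX.comp (hξ.prodMk (hT j))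
  have hTT : Measurable fun ω => (T i j ω, T i k ω) := (hT j).prodMk (hT k)
  -- The errors are peeled off one at a time. The first is multiplied by everything else including
  -- `U i k`, which is allowed since `j ≠ k`; then `U i k` multiplies only path and design. What is
  -- left is the centred product of path values.
  have e : ∀ ω, centeredPair Q X ξ T U i (j, k) ω * φ (T i j ω, T i k ω)
      = (X (ξ i ω) (T i j ω) * X (ξ i ω) (T i k ω) - secondMoment Q X (T i j ω) (T i k ω))
          * φ (T i j ω, T i k ω)
        + U i j ω * ((X (ξ i ω) (T i k ω) + U i k ω) * φ (T i j ω, T i k ω))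
        + U i k ω * (X (ξ i ω) (T i j ω) * φ (T i j ω, T i k ω)) :=
    fun ω => by simp only [centeredPair, observation]; ring
  have hdom : ∀ {x ω}, |x| ≤ h.noiseBound c i j ω * h.noiseBound c i k ω →
      |x * φ (T i j ω, T i k ω)| ≤ M * (h.noiseBound c i j ω * h.noiseBound c i k ω) := by
    intro x ω hx
    rw [abs_mul, mul_comm]
    gcongr
    exact hM _
  have i1 : Integrable (fun ω => (X (ξ i ω) (T i j ω) * X (ξ i ω) (T i k ω)
      - secondMoment Q X (T i j ω) (T i k ω)) * φ (T i j ω, T i k ω)) P := by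
    refine h.integrable_of_abs_le_noiseBound hc1 hp hmom i j k (M := M)
      ((((hXm j).mul (hXm k)).sub (hC.comp hTT)).mul (hφ.comp hTT)) ?_
    filter_upwards [h.ae_abs_path_le (by linarith) hmom.2, h.ae_mem_design] with ω h1 h2
    refine hdom ((abs_sub _ _).trans ?_)
    have h3 := hc _ (h2 i j) _ (h2 i k)
    have h4 := abs_nonneg (U i j ω)
    have h5 := abs_nonneg (U i k ω)
    have h6 := h.pathBound_nonneg (ξ i ω)
    have h7 : |X (ξ i ω) (T i j ω) * X (ξ i ω) (T i k ω)|
        ≤ pathBound Q a b X h.aemeasurable_pathSup (ξ i ω)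
          * pathBound Q a b X h.aemeasurable_pathSup (ξ i ω) := by
      rw [abs_mul]; gcongr; exacts [h1 i _ (h2 i j), h1 i _ (h2 i k)]
    unfold noiseBound
    set S := pathBound Q a b X h.aemeasurable_pathSup (ξ i ω)
    have : 0 ≤ S * |U i j ω| + S * |U i k ω| + |U i j ω| * |U i k ω|
      + c * (2 * S + |U i j ω| + |U i k ω|) := by positivity
    nlinarith
  have i2 : Integrable (fun ω => U i j ω * ((X (ξ i ω) (T i k ω) + U i k ω)
      * φ (T i j ω, T i k ω))) P := by
    refine h.integrable_of_abs_le_noiseBound hc1 hp hmom i j k (M := M)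
      ((hU j).mul (((hXm k).add (hU k)).mul (hφ.comp hTT))) ?_
    filter_upwards [h.ae_abs_path_le (by linarith) hmom.2, h.ae_mem_design] with ω h1 h2
    rw [← mul_assoc]
    refine hdom ?_
    have h6 := h.pathBound_nonneg (ξ i ω)
    have h7 := h1 i _ (h2 i k)
    rw [abs_mul]
    unfold noiseBound
    gcongr
    · linarith
    · refine (abs_add_le _ _).trans ?_
      linarith
  have i3 : Integrable (fun ω => U i k ω * (X (ξ i ω) (T i j ω) * φ (T i j ω, T i k ω))) P := by
    refine h.integrable_of_abs_le_noiseBound hc1 hp hmom i j k (M := M)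
      ((hU k).mul ((hXm j).mul (hφ.comp hTT))) ?_
    filter_upwards [h.ae_abs_path_le (by linarith) hmom.2, h.ae_mem_design] with ω h1 h2
    rw [← mul_assoc]
    refine hdom ?_
    have h6 := h.pathBound_nonneg (ξ i ω)
    have h7 := h1 i _ (h2 i j)
    rw [abs_mul, mul_comm]
    unfold noiseBound
    gcongr
    · linarith [abs_nonneg (U i j ω)]
    · linarith
  simp only [e]
  have e12 := integral_add (i1.add i2) i3
  simp only [Pi.add_apply] at e12
  rw [e12, integral_add i1 i2]
  have hTm : ∀ {S : Set (ℕ ⊕ (ℕ × ℕ ⊕ ℕ × ℕ))}, Sum.inr (Sum.inl (i, j)) ∈ S →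
      Sum.inr (Sum.inl (i, k)) ∈ S →
      Measurable[genAlg ξ T U S] fun ω => φ (T i j ω, T i k ω) := fun h1 h2 =>
    hφ.comp ((measurable_genAlg_design h1).prodMk (measurable_genAlg_design h2))
  have z2 := h.integral_error_mul_eq_zero i j
    (W := fun ω => (X (ξ i ω) (T i k ω) + U i k ω) * φ (T i j ω, T i k ω))
    (((h.measurable_observation (by simp) (by simp)).add
      (measurable_genAlg_error (by simp [hjk.symm]))).mul (hTm (by simp) (by simp)))
  have z3 := h.integral_error_mul_eq_zero i k
    (W := fun ω => X (ξ i ω) (T i j ω) * φ (T i j ω, T i k ω))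
    ((h.measurable_observation (by simp) (by simp)).mul (hTm (by simp) (by simp)))
  rw [z2, z3, add_zero, add_zero]
  refine h.integral_path_design_eq_zero i hjk
    (F := fun z => (X z.1 z.2.1 * X z.1 z.2.2 - secondMoment Q X z.2.1 z.2.2) * φ z.2) ?_
    fun u hu v hv => ?_
  · have m1 : Measurable fun z : 𝒳 × (ℝ × ℝ) => X z.1 z.2.1 :=
      hX.comp (measurable_fst.prodMk (measurable_fst.comp measurable_snd))
    have m2 : Measurable fun z : 𝒳 × (ℝ × ℝ) => X z.1 z.2.2 :=
      hX.comp (measurable_fst.prodMk (measurable_snd.comp measurable_snd))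
    exact ((m1.mul m2).sub (hC.comp measurable_snd)).mul (hφ.comp measurable_snd)
  · simp only
    rw [integral_mul_const, integral_path_mul_sub_secondMoment
      (memLp_path hX (by linarith) hmom.2 hu) (memLp_path hX (by linarith) hmom.2 hv), zero_mul]

end IsSamplingModel

end Arrays

/-! ### Uniform deviations of kernel averages -/

section Rates

theorem harmonicMean_nonneg (n : ℕ) (m : ℕ → ℕ) (k : ℕ) : 0 ≤ harmonicMean n m k := by
  unfold harmonicMean; positivity

theorem mul_div_harmonicMean {n : ℕ} (hn : 1 ≤ n) (m : ℕ → ℕ) (k : ℕ) (x : ℝ) :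
    n * (x / harmonicMean n m k) = x * ∑ i ∈ Finset.range n, ((m i : ℝ) ^ k)⁻¹ := by
  have : (n : ℝ) ≠ 0 := by exact_mod_cast (by omega : n ≠ 0)
  unfold harmonicMean
  rw [div_inv_eq_mul]
  field_simp

/-- The variance factor `h² + h / γ₁` of the univariate kernel averages. -/
noncomputable def meanFactor (m : ℕ → ℕ → ℕ) (h : ℕ → ℝ) (n : ℕ) : ℝ :=
  h n ^ 2 + h n / harmonicMean n (m n) 1

/-- The variance factor `h⁴ + h³ / γ₁ + h² / γ₂` of the bivariate kernel averages. -/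
noncomputable def covFactor (m : ℕ → ℕ → ℕ) (h : ℕ → ℝ) (n : ℕ) : ℝ :=
  h n ^ 4 + h n ^ 3 / harmonicMean n (m n) 1 + h n ^ 2 / harmonicMean n (m n) 2

theorem meanFactor_pos {m : ℕ → ℕ → ℕ} {h : ℕ → ℝ} {n : ℕ} (hh : 0 < h n) :
    0 < meanFactor m h n :=
  add_pos_of_pos_of_nonneg (by positivity) (div_nonneg hh.le (harmonicMean_nonneg _ _ _))

theorem covFactor_pos {m : ℕ → ℕ → ℕ} {h : ℕ → ℝ} {n : ℕ} (hh : 0 < h n) :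
    0 < covFactor m h n :=
  add_pos_of_pos_of_nonneg (add_pos_of_pos_of_nonneg (by positivity)
    (div_nonneg (by positivity) (harmonicMean_nonneg _ _ _)))
    (div_nonneg (by positivity) (harmonicMean_nonneg _ _ _))

/-- Of the convergence to zero only this domination is used: it is the condition under which the
truncation level is compatible with the variance factor. -/
theorem MeanBandwidthCondition.eventually_le {m : ℕ → ℕ → ℕ} {h : ℕ → ℝ} {lam : ℝ}
    (hb : MeanBandwidthCondition m h lam) :
    ∀ᶠ n : ℕ in atTop, (Real.log n / n) ^ (1 - 2 / lam) ≤ meanFactor m h n := by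
  filter_upwards [hb.2.2.eventually (gt_mem_nhds zero_lt_one)] with n hn
  have := (inv_mul_lt_iff₀ (meanFactor_pos (m := m) (hb.1 n))).1 hn
  linarith

theorem CovBandwidthCondition.eventually_le {m : ℕ → ℕ → ℕ} {h : ℕ → ℝ} {lam : ℝ}
    (hb : CovBandwidthCondition m h lam) :
    ∀ᶠ n : ℕ in atTop, (Real.log n / n) ^ (1 - 2 / lam) ≤ covFactor m h n := by
  filter_upwards [hb.2.2.eventually (gt_mem_nhds zero_lt_one)] with n hn
  have := (inv_mul_lt_iff₀ (covFactor_pos (m := m) (hb.1 n))).1 hn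
  linarith

/-- Pulling `n h` out of the square root turns the variance factor into that of `δ`. The factor `n`
is removed by averaging over curves and `h` by normalizing the kernel. -/
theorem sumRate_meanFactor {m : ℕ → ℕ → ℕ} {h : ℕ → ℝ} {n : ℕ} (hn : 1 ≤ n) (hh : 0 < h n) :
    sumRate (meanFactor m h) n = n * (h n * delta₁ n (m n) (h n)) := by
  have hn0 : (0 : ℝ) < n := by exact_mod_cast hn
  unfold sumRate delta₁ meanFactor
  rw [← mul_assoc, ← Real.sqrt_sq (mul_pos hn0 hh).le, ← Real.sqrt_mul (sq_nonneg _)]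
  congr 1
  have h2 := hh.ne'
  rw [mul_inv, div_eq_mul_inv]
  field_simp

theorem sumRate_covFactor {m : ℕ → ℕ → ℕ} {h : ℕ → ℝ} {n : ℕ} (hn : 1 ≤ n) (hh : 0 < h n) :
    sumRate (covFactor m h) n = n * (h n ^ 2 * delta₂ n (m n) (h n)) := by
  have hn0 : (0 : ℝ) < n := by exact_mod_cast hn
  unfold sumRate delta₂ covFactor
  rw [← mul_assoc, ← Real.sqrt_sq (mul_pos hn0 (pow_pos hh 2)).le, ← Real.sqrt_mul (sq_nonneg _)]
  congr 1
  have h2 := hh.ne'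
  rw [mul_inv, mul_inv, div_eq_mul_inv, div_eq_mul_inv]
  field_simp

end Rates

/-! ### Averages over curves as linear functionals -/

section CurveAverage

variable {ι : Type*}

/-- The average over the curves of the averages over the index sets `s i`. -/
noncomputable def curveAvg (n : ℕ) (s : ℕ → Finset ι) : (ℕ × ι → ℝ) →ₗ[ℝ] ℝ where
  toFun f := (n : ℝ)⁻¹ * ∑ i ∈ Finset.range n, favg (s i) fun l => f (i, l)
  map_add' f g := by
    simp only [Pi.add_apply, favg_add, Finset.sum_add_distrib, mul_add]
  map_smul' c f := by
    simp only [Pi.smul_apply, smul_eq_mul, favg_const_mul, ← Finset.mul_sum, RingHom.id_apply]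
    ring

theorem curveAvg_apply (n : ℕ) (s : ℕ → Finset ι) (f : ℕ × ι → ℝ) :
    curveAvg n s f = (n : ℝ)⁻¹ * ∑ i ∈ Finset.range n, favg (s i) fun l => f (i, l) := rfl

theorem curveAvg_mono {n : ℕ} {s : ℕ → Finset ι} {f g : ℕ × ι → ℝ}
    (h : ∀ i < n, ∀ l ∈ s i, f (i, l) ≤ g (i, l)) : curveAvg n s f ≤ curveAvg n s g :=
  mul_le_mul_of_nonneg_left (Finset.sum_le_sum fun i hi =>
    favg_mono (h i (Finset.mem_range.1 hi))) (by positivity)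

theorem abs_curveAvg_sub_le {n : ℕ} (hn : 1 ≤ n) {s : ℕ → Finset ι} {f : ℕ × ι → ℝ} {e B : ℝ}
    {g : ℕ → ℝ} (hg : ∀ i < n, g i = e)
    (h : |∑ i ∈ Finset.range n, (favg (s i) (fun l => f (i, l)) - g i)| ≤ n * B) :
    |curveAvg n s f - e| ≤ B := by
  have hn0 : (0 : ℝ) < n := by exact_mod_cast hn
  have h1 : curveAvg n s f - e
      = (n : ℝ)⁻¹ * ∑ i ∈ Finset.range n, (favg (s i) (fun l => f (i, l)) - g i) := by
    rw [Finset.sum_sub_distrib, Finset.sum_congr rfl (fun i hi => hg i (Finset.mem_range.1 hi)),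
      Finset.sum_const, Finset.card_range, nsmul_eq_mul, mul_sub, inv_mul_cancel_left₀ hn0.ne']
    rfl
  rw [h1, abs_mul, abs_of_nonneg (by positivity), inv_mul_le_iff₀ hn0]
  exact h

end CurveAverage

/-! ### Uniform deviations in the sampling model -/

section Deviations

variable {Ω 𝒳 : Type*} [mΩ : MeasurableSpace Ω] [MeasurableSpace 𝒳]
  {P : Measure Ω} {Q : Measure 𝒳} {a b : ℝ} {X : 𝒳 → ℝ → ℝ} {fT : ℝ → ℝ}
  {ξ : ℕ → Ω → 𝒳} {T U : ℕ → ℕ → Ω → ℝ}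

namespace IsSamplingModel

theorem ae_eventually_sum_favg_le (h : IsSamplingModel P Q a b X fT ξ T U) [IsProbabilityMeasure P]
    (hab : a < b) {MT : ℝ} (hMT0 : 0 ≤ MT) (hMT : ∀ t ∈ Icc a b, fT t ≤ MT) {c : ℝ} (hc : 1 ≤ c)
    {p : ℝ} (hp : 4 ≤ p) (hmom : MomentCondition P Q a b X U p) {lam : ℝ} (hlam : 2 < lam)
    (hmomlam : MomentCondition P Q a b X U lam) {m : ℕ → ℕ → ℕ} {bw : ℕ → ℝ}
    (hband : MeanBandwidthCondition m bw lam)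
    {y : ℕ → ℕ → Ω → ℝ} (hy : ∀ i j, Measurable[genAlg ξ T U (curveIdx i)] (y i j))
    (hyH : ∀ᵐ ω ∂P, ∀ i j, |y i j ω| ≤ h.noiseBound c i j ω)
    {k : ℝ → ℝ} {M : ℝ} (hk : HasModulus k M) (hk0 : ∀ u, u ∉ Icc (-1 : ℝ) 1 → k u = 0) :
    ∀ᵐ ω ∂P, ∃ C : ℝ, ∀ᶠ n : ℕ in atTop, ∀ t ∈ Icc a b,
      |∑ i ∈ Finset.range n, (favg (Finset.range (m n i))
          (fun j => y i j ω * k ((T i j ω - t) / bw n))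
        - ∫ ω', favg (Finset.range (m n i)) (fun j => y i j ω' * k ((T i j ω' - t) / bw n)) ∂P)|
        ≤ C * sumRate (meanFactor m bw) n := by
  have hM0 := hk.nonneg
  have hkm := hk.measurable
  obtain ⟨hkM, ψ, hψ, hψM, hkψ⟩ := hk
  obtain ⟨CZ, hA⟩ := h.exists_isCurveArray hc hp hmom hy hyH fun n i => Finset.range (m n i)
  obtain ⟨CG, hG⟩ := h.exists_isCurveEnvelope (zero_le_one.trans hc) hlam hmomlam m
  have hbw := hband.1
  refine ae_eventually_abs_sum_favg_le hA hlam hG hband.eventually_le (S := Icc a b)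
    (grid := fun n => Finset.range (n + 1)) (N := 1) (Cg := 2) (fun n hn => ?_)
    (pt := gridPoint a b) (fun n k hk => gridPoint_mem hab (Nat.lt_succ_iff.1
        (Finset.mem_range.1 hk)))
    (φ := fun n t x => k ((x - t) / bw n))
    (D := fun n l => cellIncrement ψ a b (bw n) n l) (M := 2 * M)
    (fun n t => hkm.comp ((measurable_id.sub_const t).div_const _))
    (fun n l => measurable_cellIncrement hψ a b (bw n) n l)
    (fun n t x => (hkM _).trans (by linarith))
    (fun n l x => abs_cellIncrement_le hψM a b (bw n) n l x) (fun n hn t ht => ?_)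
    (CD := 2 * MT * M * (b - a))
    (fun n hn i _ l _ j _ => h.lintegral_cellIncrement_le hab hMT hMT0 hψ hψM (hbw n) n l i j)
    (CV := M ^ 2 * (2 * MT + 4 * MT ^ 2)) ?_
  · have : (1 : ℝ) ≤ n := by exact_mod_cast hn
    rw [Finset.card_range]
    push_cast
    linarith
  · obtain ⟨l, hl, h1, h2⟩ := exists_gridPoint hab hn ht
    exact ⟨l, hl, abs_sub_le_cellIncrement hψ hkψ (hbw n) h1 h2⟩
  · filter_upwards [eventually_ge_atTop 1] with n hn t _
    have hh := hbw n
    have hz : ∀ x, x ∉ Icc (t - bw n) (t + bw n) → k ((x - t) / bw n) = 0 := by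
      intro x hx
      refine hk0 _ fun hx' => hx ⟨?_, ?_⟩
      · have := (le_div_iff₀ hh).1 hx'.1; linarith
      · have := (div_le_iff₀ hh).1 hx'.2; linarith
    refine (Finset.sum_le_sum fun i _ => h.sum_lintegral_window_le i (m n i) measurableSet_Icc
      (q := 2 * MT * bw n) (by positivity) (designLaw_window_le hMT hMT0 t)
      (φ := fun x => k ((x - t) / bw n)) (fun x => hkM _) hz).trans ?_
    rw [← ENNReal.ofReal_sum_of_nonneg fun i _ => by positivity]
    refine ENNReal.ofReal_le_ofReal ?_
    have e := mul_div_harmonicMean hn (m n) 1 (bw n)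
    simp only [pow_one] at e
    rw [meanFactor, mul_add (n : ℝ), e, ← Finset.mul_sum, Finset.sum_add_distrib, ← Finset.mul_sum,
      Finset.sum_const, Finset.card_range, nsmul_eq_mul, mul_assoc (M ^ 2)]
    have hS : 0 ≤ ∑ i ∈ Finset.range n, ((m n i : ℝ))⁻¹ := Finset.sum_nonneg fun i _
        => by positivity
    set S := ∑ i ∈ Finset.range n, ((m n i : ℝ))⁻¹
    have : 0 ≤ 4 * MT ^ 2 * (bw n * S) + 2 * MT * (n * bw n ^ 2) := by positivity
    refine mul_le_mul_of_nonneg_left ?_ (by positivity)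
    linarith

theorem ae_eventually_sum_favg_pair_le (h : IsSamplingModel P Q a b X fT ξ T U)
    [IsProbabilityMeasure P] (hab : a < b) {MT : ℝ} (hMT0 : 0 ≤ MT)
    (hMT : ∀ t ∈ Icc a b, fT t ≤ MT) {c : ℝ} (hc : 1 ≤ c) {lam : ℝ} (hlam : 2 < lam)
    (hmom : MomentCondition P Q a b X U (2 * lam)) {m : ℕ → ℕ → ℕ}
    (hm : ∀ n i, i < n → 2 ≤ m n i) {bw : ℕ → ℝ} (hband : CovBandwidthCondition m bw lam)
    {y : ℕ → ℕ × ℕ → Ω → ℝ} (hy : ∀ i l, Measurable[genAlg ξ T U (curveIdx i)] (y i l))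
    (hyH : ∀ᵐ ω ∂P, ∀ i l, |y i l ω| ≤ h.noiseBound c i l.1 ω * h.noiseBound c i l.2 ω)
    {k₁ k₂ : ℝ → ℝ} {M : ℝ} (hk₁ : HasModulus k₁ M) (hk₂ : HasModulus k₂ M)
    (hk₁0 : ∀ u, u ∉ Icc (-1 : ℝ) 1 → k₁ u = 0) (hk₂0 : ∀ u, u ∉ Icc (-1 : ℝ) 1 → k₂ u = 0) :
    ∀ᵐ ω ∂P, ∃ C : ℝ, ∀ᶠ n : ℕ in atTop, ∀ θ ∈ Icc a b ×ˢ Icc a b,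
      |∑ i ∈ Finset.range n, (favg (Finset.range (m n i)).offDiag
          (fun l => y i l ω * (k₁ ((T i l.1 ω - θ.1) / bw n) * k₂ ((T i l.2 ω - θ.2) / bw n)))
        - ∫ ω', favg (Finset.range (m n i)).offDiag (fun l =>
          y i l ω' * (k₁ ((T i l.1 ω' - θ.1) / bw n) * k₂ ((T i l.2 ω' - θ.2) / bw n))) ∂P)|
        ≤ C * sumRate (covFactor m bw) n := by
  have hM0 := hk₁.nonneg
  have hkm₁ := hk₁.measurable
  have hkm₂ := hk₂.measurable
  obtain ⟨hkM₁, ψ₁, hψ₁, hψM₁, hkψ₁⟩ := hk₁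
  obtain ⟨hkM₂, ψ₂, hψ₂, hψM₂, hkψ₂⟩ := hk₂
  obtain ⟨CZ, hA⟩ := h.exists_isCurveArray_pair hc (by linarith) hmom hy hyH
    fun n i => (Finset.range (m n i)).offDiag
  obtain ⟨CG, hG⟩ := h.exists_isCurveEnvelope_pair (zero_le_one.trans hc) hlam hmom m
  have hbw := hband.1
  have hD₁ := fun n (l : ℕ) => measurable_cellIncrement hψ₁ a b (bw n) n l
  have hD₂ := fun n (l : ℕ) => measurable_cellIncrement hψ₂ a b (bw n) n l
  have hφM : ∀ (n : ℕ) (θ x : ℝ × ℝ),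
      |k₁ ((x.1 - θ.1) / bw n) * k₂ ((x.2 - θ.2) / bw n)| ≤ M ^ 2 := fun n θ x => by
    rw [abs_mul, sq]; gcongr <;> [exact hkM₁ _; exact hkM₂ _]
  refine ae_eventually_abs_sum_favg_le hA hlam hG hband.eventually_le (S := Icc a b ×ˢ Icc a b)
    (grid := fun n => Finset.range (n + 1) ×ˢ Finset.range (n + 1)) (N := 2) (Cg := 4)
    (fun n hn => ?_) (pt := fun n κ => (gridPoint a b n κ.1, gridPoint a b n κ.2))
    (fun n κ hκ => ?_)
    (φ := fun n θ x => k₁ ((x.1 - θ.1) / bw n) * k₂ ((x.2 - θ.2) / bw n))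
    (D := fun n κ x => M * (cellIncrement ψ₁ a b (bw n) n κ.1 x.1
      + cellIncrement ψ₂ a b (bw n) n κ.2 x.2)) (M := 4 * M ^ 2)
    (fun n θ => (hkm₁.comp ((measurable_fst.sub_const _).div_const _)).mul
      (hkm₂.comp ((measurable_snd.sub_const _).div_const _)))
    (fun n κ => (((hD₁ n κ.1).comp measurable_fst).add
      ((hD₂ n κ.2).comp measurable_snd)).const_mul M)
    (fun n θ x => (hφM n θ x).trans (by nlinarith))
    (fun n κ x => ?_) (fun n hn θ hθ => ?_)
    (CD := 4 * MT * M ^ 2 * (b - a)) (fun n hn i _ κ _ l _ => ?_)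
    (CV := M ^ 4 * (256 * MT ^ 2 + 1024 * MT ^ 4)) ?_
  · have : (1 : ℝ) ≤ n := by exact_mod_cast hn
    rw [Finset.card_product, Finset.card_range]
    push_cast
    nlinarith
  · rw [Finset.mem_product, Finset.mem_range, Finset.mem_range] at hκ
    exact ⟨gridPoint_mem hab (Nat.lt_succ_iff.1 hκ.1), gridPoint_mem hab (Nat.lt_succ_iff.1 hκ.2)⟩
  · rw [abs_mul, abs_of_nonneg hM0]
    have h1 := abs_cellIncrement_le hψM₁ a b (bw n) n κ.1 x.1
    have h2 := abs_cellIncrement_le hψM₂ a b (bw n) n κ.2 x.2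
    calc _ ≤ M * (2 * M + 2 * M) := by gcongr; exact (abs_add_le _ _).trans (add_le_add h1 h2)
      _ = _ := by ring
  · obtain ⟨l₁, hl₁, h1, h2⟩ := exists_gridPoint hab hn hθ.1
    obtain ⟨l₂, hl₂, h3, h4⟩ := exists_gridPoint hab hn hθ.2
    refine ⟨(l₁, l₂), Finset.mem_product.2 ⟨hl₁, hl₂⟩, fun x => ?_⟩
    have d1 := abs_sub_le_cellIncrement hψ₁ hkψ₁ (hbw n) h1 h2 x.1
    have d2 := abs_sub_le_cellIncrement hψ₂ hkψ₂ (hbw n) h3 h4 x.2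
    simp only
    set A := k₁ ((x.1 - θ.1) / bw n)
    set B := k₂ ((x.2 - θ.2) / bw n)
    set A' := k₁ ((x.1 - gridPoint a b n l₁) / bw n)
    set B' := k₂ ((x.2 - gridPoint a b n l₂) / bw n)
    have e : A * B - A' * B' = (A - A') * B + A' * (B - B') := by ring
    rw [e]
    refine (abs_add_le _ _).trans ?_
    rw [abs_mul, abs_mul]
    have b1 : |B| ≤ M := hkM₂ _
    have b2 : |A'| ≤ M := hkM₁ _
    have n1 := (abs_nonneg _).trans d1
    calc _ ≤ cellIncrement ψ₁ a b (bw n) n l₁ x.1 * M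
          + M * cellIncrement ψ₂ a b (bw n) n l₂ x.2 := by gcongr
      _ = _ := by ring
  · have i1 := h.lintegral_cellIncrement_le hab hMT hMT0 hψ₁ hψM₁ (hbw n) n κ.1 i l.1
    have i2 := h.lintegral_cellIncrement_le hab hMT hMT0 hψ₂ hψM₂ (hbw n) n κ.2 i l.2
    have hba : 0 ≤ b - a := (sub_pos.2 hab).le
    calc _ ≤ ∫⁻ ω, ENNReal.ofReal M * (‖cellIncrement ψ₁ a b (bw n) n κ.1 (T i l.1 ω)‖ₑ
          + ‖cellIncrement ψ₂ a b (bw n) n κ.2 (T i l.2 ω)‖ₑ) ∂P := by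
          refine lintegral_mono fun ω => ?_
          rw [enorm_mul, Real.enorm_of_nonneg hM0]
          gcongr
          exact enorm_add_le _ _
      _ ≤ ENNReal.ofReal M * (ENNReal.ofReal (2 * MT * M * (b - a) / n)
          + ENNReal.ofReal (2 * MT * M * (b - a) / n)) := by
          have e1 := ((hD₁ n κ.1).comp (h.measurable_design i l.1)).enorm
          simp only [Function.comp_apply] at e1
          rw [lintegral_const_mul' _ _ ENNReal.ofReal_ne_top, lintegral_add_left e1]
          gcongr
      _ = _ := by
          rw [← ENNReal.ofReal_add (by positivity) (by positivity), ← ENNReal.ofReal_mul hM0]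
          congr 1
          ring
  · filter_upwards [eventually_ge_atTop 1] with n hn θ _
    have hh := hbw n
    -- One window for both coordinates, so that all design points of two pairs can be tested against
    -- the same set; this costs a factor two in the probability, hence `4 * MT * bw n`.
    set B := Icc (θ.1 - bw n) (θ.1 + bw n) ∪ Icc (θ.2 - bw n) (θ.2 + bw n) with hB
    have hz : ∀ t x, x ∉ Icc (t - bw n) (t + bw n) → (x - t) / bw n ∉ Icc (-1 : ℝ) 1 := by
      intro t x hx hx'
      refine hx ⟨?_, ?_⟩
      · have := (le_div_iff₀ hh).1 hx'.1; linarith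
      · have := (div_le_iff₀ hh).1 hx'.2; linarith
    have hBq : designLaw a b fT B ≤ ENNReal.ofReal (4 * MT * bw n) := by
      refine (measure_union_le _ _).trans ((add_le_add (designLaw_window_le hMT hMT0 θ.1)
        (designLaw_window_le hMT hMT0 θ.2)).trans_eq ?_)
      rw [← ENNReal.ofReal_add (by positivity) (by positivity)]
      congr 1; ring
    refine (Finset.sum_le_sum fun i hi => h.sum_lintegral_window_pair_le i
      (hm n i (Finset.mem_range.1 hi)) (measurableSet_Icc.union measurableSet_Icc)
      (q := 4 * MT * bw n) (by positivity) hBq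
      (φ := fun x => k₁ ((x.1 - θ.1) / bw n) * k₂ ((x.2 - θ.2) / bw n)) (hφM n θ) ?_).trans ?_
    · rintro x (hx | hx)
      · rw [hk₁0 _ (hz _ _ fun hx' => hx (Or.inl hx')), zero_mul]
      · rw [hk₂0 _ (hz _ _ fun hx' => hx (Or.inr hx')), mul_zero]
    rw [← ENNReal.ofReal_sum_of_nonneg fun i _ => by positivity]
    refine ENNReal.ofReal_le_ofReal ?_
    have e := mul_div_harmonicMean hn (m n) 2 (bw n ^ 2)
    have e' := mul_div_harmonicMean hn (m n) 1 (bw n ^ 3)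
    rw [covFactor, mul_add (n : ℝ), mul_add (n : ℝ), e, e', ← Finset.mul_sum,
      Finset.sum_add_distrib, ← Finset.mul_sum, Finset.sum_const, Finset.card_range, nsmul_eq_mul,
      ← pow_mul, mul_assoc (M ^ 4)]
    have hS : 0 ≤ ∑ i ∈ Finset.range n, ((m n i : ℝ) ^ 2)⁻¹ :=
      Finset.sum_nonneg fun i _ => by positivity
    have hS' : 0 ≤ ∑ i ∈ Finset.range n, ((m n i : ℝ) ^ 1)⁻¹ :=
      Finset.sum_nonneg fun i _ => by positivity
    set S := ∑ i ∈ Finset.range n, ((m n i : ℝ) ^ 2)⁻¹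
    set S' := ∑ i ∈ Finset.range n, ((m n i : ℝ) ^ 1)⁻¹
    refine mul_le_mul_of_nonneg_left ?_ (by positivity)
    -- The slack of the comparison. The variance bound has no `h³ / γ₁` term, so that part of the
    -- variance factor is entirely slack.
    have p1 : 0 ≤ 1024 * MT ^ 4 * (bw n ^ 2 * S) + 256 * MT ^ 2 * (n * bw n ^ 4)
      + (256 * MT ^ 2 + 1024 * MT ^ 4) * (bw n ^ 3 * S') := by positivity
    linear_combination p1

end IsSamplingModel

end Deviations

/-! ### The rates tend to zero -/

section RateLimits

theorem inv_harmonicMean_nonneg (n : ℕ) (m : ℕ → ℕ) (k : ℕ) : 0 ≤ (harmonicMean n m k)⁻¹ :=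
  inv_nonneg.2 (harmonicMean_nonneg n m k)

theorem inv_harmonicMean_le_one {n : ℕ} {m : ℕ → ℕ} (hm : ∀ i < n, 1 ≤ m i) (k : ℕ) :
    (harmonicMean n m k)⁻¹ ≤ 1 := by
  rcases Nat.eq_zero_or_pos n with rfl | hn
  · simp [harmonicMean]
  have hn0 : (0 : ℝ) < n := by exact_mod_cast hn
  unfold harmonicMean
  rw [inv_inv, inv_mul_le_iff₀ hn0, mul_one]
  refine (Finset.sum_le_card_nsmul _ _ 1 fun i hi => ?_).trans (by simp)
  have : (1 : ℝ) ≤ m i := by exact_mod_cast hm i (Finset.mem_range.1 hi)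
  exact inv_le_one_of_one_le₀ (one_le_pow₀ this)

theorem tendsto_log_div : Tendsto (fun n : ℕ => Real.log n / n) atTop (𝓝 0) :=
  (Real.isLittleO_log_id_atTop.tendsto_div_nhds_zero).comp tendsto_natCast_atTop_atTop

theorem tendsto_log_div_rpow {lam : ℝ} (hlam : 0 < lam) :
    Tendsto (fun n : ℕ => (Real.log n / n) ^ (2 / lam)) atTop (𝓝 0) := by
  have h := tendsto_log_div.rpow_const (p := 2 / lam) (Or.inr (by positivity))
  rwa [Real.zero_rpow (by positivity)] at h

/-- Splitting `L` as `L ^ (2 / lam) * L ^ (1 - 2 / lam)` trades the bandwidth condition for a small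
positive power of `log n / n`. -/
theorem div_le_of_rpow_le {L lam g C : ℝ} (hL : 0 < L) (hg : 0 < g)
    (h : L ^ (1 - 2 / lam) ≤ C * g) : L / g ≤ C * L ^ (2 / lam) := by
  rw [div_le_iff₀ hg]
  have e : L = L ^ (2 / lam) * L ^ (1 - 2 / lam) := by
    rw [← rpow_add hL]; simp
  calc L = L ^ (2 / lam) * L ^ (1 - 2 / lam) := e
    _ ≤ L ^ (2 / lam) * (C * g) := by gcongr
    _ = _ := by ring

theorem tendsto_sqrt_of_eventually_le {f g : ℕ → ℝ} (hg : Tendsto g atTop (𝓝 0))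
    (h : ∀ᶠ n in atTop, f n ≤ g n) : Tendsto (fun n => √(f n)) atTop (𝓝 0) := by
  have h1 : Tendsto (fun n => √(g n)) atTop (𝓝 0) := by
    have := (Real.continuous_sqrt.tendsto 0).comp hg
    rwa [Real.sqrt_zero] at this
  exact tendsto_of_tendsto_of_tendsto_of_le_of_le' tendsto_const_nhds h1
    (Eventually.of_forall fun n => Real.sqrt_nonneg _) (h.mono fun n hn => Real.sqrt_le_sqrt hn)

/-- Since `1 / γ₁ ≤ 1` and `h < 1`, the variance factor is at most `2 h`, so the bandwidth condition
yields `(log n / n) / h ≤ 2 (log n / n) ^ (2 / lam)`. Convergence of `δ` to zero is what makes the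
empirical Gram matrices eventually invertible. -/
theorem MeanBandwidthCondition.tendsto_delta {m : ℕ → ℕ → ℕ} {h : ℕ → ℝ} {lam : ℝ}
    (hm : ∀ n i, i < n → 2 ≤ m n i) (hlam : 0 < lam) (hb : MeanBandwidthCondition m h lam) :
    Tendsto (fun n => delta₁ n (m n) (h n)) atTop (𝓝 0) := by
  have hlim : Tendsto (fun n : ℕ => Real.log n / n + 2 * (Real.log n / n) ^ (2 / lam)) atTop
      (𝓝 0) := by
    simpa using tendsto_log_div.add ((tendsto_log_div_rpow hlam).const_mul 2)
  refine tendsto_sqrt_of_eventually_le hlim ?_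
  filter_upwards [hb.eventually_le, hb.2.1.eventually (gt_mem_nhds zero_lt_one),
    eventually_ge_atTop 2] with n h1 h2 h3
  have hn : (2 : ℝ) ≤ n := by exact_mod_cast h3
  have hL : 0 < Real.log n / n := div_pos (Real.log_pos (by linarith)) (by linarith)
  have hh := hb.1 n
  have hγ0 := inv_harmonicMean_nonneg n (m n) 1
  have hγ1 := inv_harmonicMean_le_one (fun i hi => one_le_two.trans (hm n i hi)) 1
  set γ := (harmonicMean n (m n) 1)⁻¹
  have h4 : meanFactor m h n ≤ 2 * h n := by
    unfold meanFactor
    rw [div_eq_mul_inv]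
    nlinarith [mul_le_mul_of_nonneg_left hγ1 hh.le]
  have h5 := div_le_of_rpow_le hL hh (h1.trans h4)
  rw [mul_inv, mul_div_assoc]
  calc (1 + (h n)⁻¹ * γ) * (Real.log n / n) ≤ (1 + (h n)⁻¹ * 1) * (Real.log n / n) := by gcongr
    _ = Real.log n / n + (Real.log n / n) / h n := by rw [div_eq_mul_inv _ (h n)]; ring
    _ ≤ _ := by linarith

theorem CovBandwidthCondition.tendsto_delta {m : ℕ → ℕ → ℕ} {h : ℕ → ℝ} {lam : ℝ}
    (hm : ∀ n i, i < n → 2 ≤ m n i) (hlam : 0 < lam) (hb : CovBandwidthCondition m h lam) :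
    Tendsto (fun n => delta₂ n (m n) (h n)) atTop (𝓝 0) := by
  have hlim : Tendsto (fun n : ℕ => Real.log n / n + 2 * (3 * (Real.log n / n) ^ (2 / lam))) atTop
      (𝓝 0) := by
    simpa using tendsto_log_div.add (((tendsto_log_div_rpow hlam).const_mul 3).const_mul 2)
  refine tendsto_sqrt_of_eventually_le hlim ?_
  filter_upwards [hb.eventually_le, hb.2.1.eventually (gt_mem_nhds zero_lt_one),
    eventually_ge_atTop 2] with n h1 h2 h3
  have hn : (2 : ℝ) ≤ n := by exact_mod_cast h3
  have hL : 0 < Real.log n / n := div_pos (Real.log_pos (by linarith)) (by linarith)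
  have hh := hb.1 n
  have hγ0 := inv_harmonicMean_nonneg n (m n) 1
  have hγ1 := inv_harmonicMean_le_one (fun i hi => one_le_two.trans (hm n i hi)) 1
  have hγ0' := inv_harmonicMean_nonneg n (m n) 2
  have hγ1' := inv_harmonicMean_le_one (fun i hi => one_le_two.trans (hm n i hi)) 2
  set γ := (harmonicMean n (m n) 1)⁻¹
  set γ' := (harmonicMean n (m n) 2)⁻¹
  have hsq : h n ^ 2 ≤ h n := by nlinarith
  have hp3 : h n ^ 3 ≤ h n ^ 2 := pow_le_pow_of_le_one hh.le h2.le (by norm_num)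
  have hp4 : h n ^ 4 ≤ h n ^ 2 := pow_le_pow_of_le_one hh.le h2.le (by norm_num)
  have h4 : covFactor m h n ≤ 3 * h n ^ 2 := by
    unfold covFactor
    rw [div_eq_mul_inv, div_eq_mul_inv]
    nlinarith [mul_le_mul_of_nonneg_left hγ1 (pow_pos hh 3).le,
      mul_le_mul_of_nonneg_left hγ1' (pow_pos hh 2).le]
  have h5 := div_le_of_rpow_le hL (pow_pos hh 2) (h1.trans h4)
  have h6 : (h n)⁻¹ ≤ (h n ^ 2)⁻¹ := inv_anti₀ (pow_pos hh 2) hsq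
  rw [mul_inv, mul_inv, mul_div_assoc]
  calc (1 + (h n)⁻¹ * γ + (h n ^ 2)⁻¹ * γ') * (Real.log n / n)
      ≤ (1 + (h n ^ 2)⁻¹ * 1 + (h n ^ 2)⁻¹ * 1) * (Real.log n / n) := by gcongr
    _ = Real.log n / n + 2 * ((Real.log n / n) / h n ^ 2) := by
        rw [div_eq_mul_inv _ (h n ^ 2)]; ring
    _ ≤ _ := by linarith

end RateLimits

/-! ### Local moments of the design -/

section LocalMoments

variable {Ω 𝒳 : Type*} [mΩ : MeasurableSpace Ω] [MeasurableSpace 𝒳]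
  {P : Measure Ω} {Q : Measure 𝒳} {a b : ℝ} {X : 𝒳 → ℝ → ℝ} {fT : ℝ → ℝ}
  {ξ : ℕ → Ω → 𝒳} {T U : ℕ → ℕ → Ω → ℝ} {K : ℝ → ℝ}

/-- The local moment `h⁻¹ E k_r((T - s) / h)` of the design, with `k_r(u) = u ^ r K(u)`. -/
noncomputable def localMoment (a b : ℝ) (fT K : ℝ → ℝ) (h : ℝ) (r : ℕ) (s : ℝ) : ℝ :=
  h⁻¹ * ∫ x, kernelMoment K r ((x - s) / h) ∂designLaw a b fT

theorem KernelCondition.kernelMoment_eq_zero (hK : KernelCondition K) (r : ℕ) (u : ℝ)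
    (hu : u ∉ Icc (-1 : ℝ) 1) : kernelMoment K r u = 0 := by
  rw [kernelMoment, hK.support u hu, mul_zero]

theorem exists_localMoment_bounds (hK : KernelCondition K) [IsFiniteMeasure (designLaw a b fT)]
    (hd : DensityCondition a b fT) (hab : a < b) :
    ∃ c C, 0 < c ∧ 0 ≤ C ∧ ∀ s ∈ Icc a b, ∀ h, 0 < h → h ≤ (b - a) / 2 →
      localMoment a b fT K h 0 s ≤ C ∧ ∀ α β : ℝ, c * (α ^ 2 + β ^ 2) ≤
        α ^ 2 * localMoment a b fT K h 0 s + 2 * α * β * localMoment a b fT K h 1 s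
          + β ^ 2 * localMoment a b fT K h 2 s := by
  obtain ⟨⟨cT, MT, hcT, hT⟩, -⟩ := hd
  have hMT : 0 ≤ MT := by
    have := hT a (left_mem_Icc.2 hab.le); linarith
  obtain ⟨c, hc, hcq⟩ := hK.exists_local_lower_bound hcT (le_designLaw fun t ht => (hT t ht).1)
  obtain ⟨M, hM1, hM⟩ := hK.exists_hasModulus
  refine ⟨c, M * (2 * MT), hc, by positivity, fun s hs h hh hhab => ⟨?_, fun α β => ?_⟩⟩
  · set B := Icc (s - h) (s + h)
    have hz : ∀ x, kernelMoment K 0 ((x - s) / h) ≤ B.indicator (fun _ => M) x := by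
      intro x
      by_cases hx : x ∈ B
      · rw [indicator_of_mem hx]; exact (le_abs_self _).trans ((hM 0 (by norm_num)).1 _)
      · rw [indicator_of_notMem hx, hK.kernelMoment_eq_zero]
        intro hx'
        refine hx ⟨?_, ?_⟩
        · have := (le_div_iff₀ hh).1 hx'.1; linarith
        · have := (div_le_iff₀ hh).1 hx'.2; linarith
    have h1 : ∫ x, kernelMoment K 0 ((x - s) / h) ∂designLaw a b fT ≤ (2 * MT * h) * M := by
      refine (integral_mono ((hM 0 (by norm_num)).integrable _ (by fun_prop))
        ((integrable_const M).indicator measurableSet_Icc) hz).trans ?_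
      rw [integral_indicator_const _ measurableSet_Icc, smul_eq_mul]
      gcongr
      refine ENNReal.toReal_le_of_le_ofReal (by positivity) ?_
      exact designLaw_window_le (fun t ht => (hT t ht).2) hMT s
    unfold localMoment
    rw [inv_mul_le_iff₀ hh]
    linarith
  · refine (hcq s hs h hh hhab α β).trans (le_of_eq ?_)
    simp only [sq_mul_scaledKernel]
    have hm : Measurable fun x : ℝ => (x - s) / h := by fun_prop
    have i0 := ((hM 0 (by norm_num)).integrable (designLaw a b fT) hm).const_mul (α ^ 2)
    have i1 := ((hM 1 (by norm_num)).integrable (designLaw a b fT) hm).const_mul (2 * α * β)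
    have i2 := ((hM 2 (by norm_num)).integrable (designLaw a b fT) hm).const_mul (β ^ 2)
    have e := integral_add (i0.add i1) i2
    simp only [Pi.add_apply] at e
    rw [integral_const_mul, e, integral_add i0 i1, integral_const_mul, integral_const_mul,
      integral_const_mul]
    unfold localMoment
    rw [one_div]
    ring

theorem exists_forall_eventually_le {α Θ : Type*} (F : Finset α) {S : Set Θ}
    {f : α → ℕ → Θ → ℝ} {ρ : ℕ → ℝ} (hρ : ∀ᶠ n in atTop, 0 ≤ ρ n)
    (h : ∀ r ∈ F, ∃ C : ℝ, ∀ᶠ n in atTop, ∀ θ ∈ S, |f r n θ| ≤ C * ρ n) :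
    ∃ C : ℝ, 0 ≤ C ∧ ∀ᶠ n in atTop, ∀ r ∈ F, ∀ θ ∈ S, |f r n θ| ≤ C * ρ n := by
  choose! C hC using h
  refine ⟨∑ r ∈ F, |C r|, Finset.sum_nonneg fun r _ => abs_nonneg _, ?_⟩
  have h1 := (Filter.eventually_all_finset F).2 hC
  filter_upwards [h1, hρ] with n hn h0 r hr θ hθ
  refine (hn r hr θ hθ).trans (mul_le_mul_of_nonneg_right ?_ h0)
  exact (le_abs_self _).trans (Finset.single_le_sum (f := fun r => |C r|)
    (fun r _ => abs_nonneg _) hr)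

namespace IsSamplingModel

theorem integral_design (h : IsSamplingModel P Q a b X fT ξ T U) (i j : ℕ) {g : ℝ → ℝ}
    (hg : Measurable g) : ∫ ω, g (T i j ω) ∂P = ∫ t, g t ∂designLaw a b fT := by
  rw [← h.map_design i j, integral_map (h.measurable_design i j).aemeasurable
    hg.aestronglyMeasurable]

theorem integral_design_mul (h : IsSamplingModel P Q a b X fT ξ T U) (i : ℕ) {j k : ℕ}
    (hjk : j ≠ k) {f g : ℝ → ℝ} (hf : Measurable f) (hg : Measurable g) :
    ∫ ω, f (T i j ω) * g (T i k ω) ∂P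
      = (∫ t, f t ∂designLaw a b fT) * ∫ t, g t ∂designLaw a b fT := by
  have hind := ((h.iIndepFun_design i).indepFun hjk).comp hf hg
  have := hind.integral_mul_eq_mul_integral
    (hf.comp (h.measurable_design i j)).aestronglyMeasurable
    (hg.comp (h.measurable_design i k)).aestronglyMeasurable
  simp only [Pi.mul_apply, Function.comp_apply] at this
  rw [this, h.integral_design i j hf, h.integral_design i k hg]

/-- Uniform deviations of the univariate smoothing statistics. -/
theorem ae_mean_statistics (h : IsSamplingModel P Q a b X fT ξ T U) [IsProbabilityMeasure P]
    [IsProbabilityMeasure Q] (hab : a < b) {MT : ℝ} (hMT0 : 0 ≤ MT)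
    (hMT : ∀ t ∈ Icc a b, fT t ≤ MT) (hK : KernelCondition K) {c : ℝ} (hc : 1 ≤ c)
    (hcμ : ∀ t ∈ Icc a b, |meanFun Q X t| ≤ c) {p : ℝ} (hp : 4 ≤ p)
    (hmom : MomentCondition P Q a b X U p) {lam : ℝ} (hlam : 2 < lam)
    (hmomlam : MomentCondition P Q a b X U lam) {m : ℕ → ℕ → ℕ} (hm : ∀ n i, i < n → 2 ≤ m n i)
    {bw : ℕ → ℝ} (hband : MeanBandwidthCondition m bw lam) :
    ∀ᵐ ω ∂P, ∃ C : ℝ, 0 ≤ C ∧ ∀ᶠ n : ℕ in atTop, ∀ r ∈ Finset.range 3, ∀ t ∈ Icc a b,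
      |curveAvg n (fun i => Finset.range (m n i))
          (fun q => kernelMoment K r ((T q.1 q.2 ω - t) / bw n))
        - bw n * localMoment a b fT K (bw n) r t| ≤ C * (bw n * delta₁ n (m n) (bw n)) ∧
      |curveAvg n (fun i => Finset.range (m n i))
          (fun q => centered Q X ξ T U q.1 q.2 ω * kernelMoment K r ((T q.1 q.2 ω - t) / bw n))|
        ≤ C * (bw n * delta₁ n (m n) (bw n)) := by
  have hprob := h.isProbabilityMeasure_designLaw
  obtain ⟨M, hM1, hM⟩ := hK.exists_hasModulus
  have hM0 : 0 ≤ M := by linarith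
  have hr2 : ∀ r ∈ Finset.range 3, r ≤ 2 := fun r hr => by rw [Finset.mem_range] at hr; omega
  have hsub : ∀ (n : ℕ) (t : ℝ), Measurable fun x : ℝ => (x - t) / bw n := fun n t => by fun_prop
  have hρ : ∀ n, 0 ≤ bw n * delta₁ n (m n) (bw n) := fun n =>
    mul_nonneg (hband.1 n).le (Real.sqrt_nonneg _)
  -- Gram entries and noise correlations are the same statistic with different responses: `y = 1`,
  -- whose mean is the local moment of the design, and `y` the centred response, whose mean
  -- vanishes.
  have key : ∀ {y : ℕ → ℕ → Ω → ℝ}, (∀ i j, Measurable[genAlg ξ T U (curveIdx i)] (y i j)) →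
      (∀ᵐ ω ∂P, ∀ i j, |y i j ω| ≤ h.noiseBound c i j ω) → ∀ e : ℕ → ℕ → ℝ → ℝ,
      (∀ r ∈ Finset.range 3, ∀ n t i j,
        ∫ ω, y i j ω * kernelMoment K r ((T i j ω - t) / bw n) ∂P = e r n t) →
      ∀ᵐ ω ∂P, ∃ C : ℝ, 0 ≤ C ∧ ∀ᶠ n : ℕ in atTop, ∀ r ∈ Finset.range 3, ∀ t ∈ Icc a b,
        |curveAvg n (fun i => Finset.range (m n i))
          (fun q => y q.1 q.2 ω * kernelMoment K r ((T q.1 q.2 ω - t) / bw n)) - e r n t|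
          ≤ C * (bw n * delta₁ n (m n) (bw n)) := by
    intro y hy hyH e he
    have hall : ∀ᵐ ω ∂P, ∀ r ∈ Finset.range 3, ∃ C : ℝ, ∀ᶠ n : ℕ in atTop, ∀ t ∈ Icc a b,
        |∑ i ∈ Finset.range n, (favg (Finset.range (m n i))
          (fun j => y i j ω * kernelMoment K r ((T i j ω - t) / bw n))
        - ∫ ω', favg (Finset.range (m n i))
          (fun j => y i j ω' * kernelMoment K r ((T i j ω' - t) / bw n)) ∂P)|
        ≤ C * sumRate (meanFactor m bw) n := by
      rw [Filter.eventually_all_finset]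
      exact fun r hr => h.ae_eventually_sum_favg_le hab hMT0 hMT hc hp hmom hlam hmomlam hband hy
        hyH (hM r (hr2 r hr)) (hK.kernelMoment_eq_zero r)
    filter_upwards [hall] with ω hω
    refine exists_forall_eventually_le (Finset.range 3) (Eventually.of_forall hρ) fun r hr => ?_
    obtain ⟨C, hC⟩ := hω r hr
    refine ⟨C, ?_⟩
    filter_upwards [hC, eventually_ge_atTop 1] with n hn hn1 t ht
    refine abs_curveAvg_sub_le hn1 (g := fun i => ∫ ω', favg (Finset.range (m n i))
          (fun j => y i j ω' * kernelMoment K r ((T i j ω' - t) / bw n)) ∂P) (fun i hi => ?_) ?_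
    · have hne : (Finset.range (m n i)).Nonempty :=
        Finset.nonempty_range_iff.2 (by have := hm n i hi; omega)
      rw [integral_favg, ← favg_const hne (e r n t)]
      · simp only [he r hr]
      · intro j _
        refine h.integrable_of_abs_le_noiseBound hc hp hmom i j j (M := M)
          (((hy i j).mono (h.genAlg_le _) le_rfl).mul ((hM r (hr2 r hr)).measurable.comp
            ((hsub n t).comp (h.measurable_design i j)))) ?_
        filter_upwards [hyH] with ω' hω'
        have h1 : 1 ≤ h.noiseBound c i j ω' := hc.trans (h.noiseBound_ge c i j ω')
        rw [abs_mul, mul_comm]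
        gcongr
        · exact (hM r (hr2 r hr)).1 _
        · exact (hω' i j).trans (le_mul_of_one_le_right (by linarith) h1)
    · rw [sumRate_meanFactor hn1 (hband.1 n)] at hn
      refine (hn t ht).trans (le_of_eq ?_)
      ring
  -- The constant response is dominated by the envelope because `1 ≤ c`.
  have key1 := key (y := fun _ _ _ => 1) (fun i j => measurable_const)
    (Eventually.of_forall fun ω i j => by
      rw [abs_one]; exact hc.trans (h.noiseBound_ge c i j ω))
    (fun r n t => bw n * localMoment a b fT K (bw n) r t) fun r hr n t i j => by
      simp only [one_mul]
      rw [h.integral_design i j (g := fun x => kernelMoment K r ((x - t) / bw n))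
        ((hM r (hr2 r hr)).measurable.comp (hsub n t)), localMoment,
        mul_inv_cancel_left₀ (hband.1 n).ne']
  have key2 := key (fun i j => h.measurable_centered i j)
    (h.ae_abs_centered_le (by linarith) hmom.2 hcμ) (fun _ _ _ => 0) fun r hr n t i j =>
      h.integral_centered_mul_eq_zero hc hp hmom hcμ
        (φ := fun x => kernelMoment K r ((x - t) / bw n))
        ((hM r (hr2 r hr)).measurable.comp (hsub n t)) (fun x => (hM r (hr2 r hr)).1 _) i j
  filter_upwards [key1, key2] with ω ⟨C1, hC1, h1⟩ ⟨C2, hC2, h2⟩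
  refine ⟨C1 + C2, by positivity, ?_⟩
  filter_upwards [h1, h2] with n h1 h2 r hr t ht
  have e1 := h1 r hr t ht
  have e2 := h2 r hr t ht
  simp only [one_mul, sub_zero] at e1 e2
  have := hρ n
  constructor
  · refine e1.trans ?_; gcongr; linarith
  · refine e2.trans ?_; gcongr; linarith

/-- Uniform deviations of the bivariate smoothing statistics. -/
theorem ae_pair_statistics (h : IsSamplingModel P Q a b X fT ξ T U) [IsProbabilityMeasure P]
    [IsProbabilityMeasure Q] (hab : a < b) {MT : ℝ} (hMT0 : 0 ≤ MT)
    (hMT : ∀ t ∈ Icc a b, fT t ≤ MT) (hK : KernelCondition K) {c : ℝ} (hc : 1 ≤ c)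
    (hcC : ∀ s ∈ Icc a b, ∀ t ∈ Icc a b, |secondMoment Q X s t| ≤ c ^ 2) {lam : ℝ}
    (hlam : 2 < lam) (hmom : MomentCondition P Q a b X U (2 * lam)) {m : ℕ → ℕ → ℕ}
    (hm : ∀ n i, i < n → 2 ≤ m n i) {bw : ℕ → ℝ} (hband : CovBandwidthCondition m bw lam) :
    ∀ᵐ ω ∂P, ∃ C : ℝ, 0 ≤ C ∧ ∀ᶠ n : ℕ in atTop, ∀ r ∈ Finset.range 3 ×ˢ Finset.range 3,
      ∀ θ ∈ Icc a b ×ˢ Icc a b,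
      |curveAvg n (fun i => (Finset.range (m n i)).offDiag)
          (fun q => kernelMoment K r.1 ((T q.1 q.2.1 ω - θ.1) / bw n)
            * kernelMoment K r.2 ((T q.1 q.2.2 ω - θ.2) / bw n))
        - bw n ^ 2 * (localMoment a b fT K (bw n) r.1 θ.1 * localMoment a b fT K (bw n) r.2 θ.2)|
        ≤ C * (bw n ^ 2 * delta₂ n (m n) (bw n)) ∧
      |curveAvg n (fun i => (Finset.range (m n i)).offDiag)
          (fun q => centeredPair Q X ξ T U q.1 q.2 ω
            * (kernelMoment K r.1 ((T q.1 q.2.1 ω - θ.1) / bw n)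
            * kernelMoment K r.2 ((T q.1 q.2.2 ω - θ.2) / bw n)))|
        ≤ C * (bw n ^ 2 * delta₂ n (m n) (bw n)) := by
  have hp : 4 ≤ 2 * lam := by linarith
  obtain ⟨M, hM1, hM⟩ := hK.exists_hasModulus
  have hM0 : 0 ≤ M := by linarith
  have hr2 : ∀ r ∈ Finset.range 3 ×ˢ Finset.range 3, r.1 ≤ 2 ∧ r.2 ≤ 2 := fun r hr => by
    rw [Finset.mem_product, Finset.mem_range, Finset.mem_range] at hr; omega
  have hkm : ∀ r ≤ 2, ∀ (n : ℕ) (t : ℝ), Measurable fun x : ℝ => kernelMoment K r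
      ((x - t) / bw n) :=
    fun r hr n t => (hM r hr).measurable.comp (by fun_prop)
  have hφm : ∀ r ∈ Finset.range 3 ×ˢ Finset.range 3, ∀ (n : ℕ) (θ : ℝ × ℝ),
      Measurable fun x : ℝ × ℝ => kernelMoment K r.1 ((x.1 - θ.1) / bw n)
        * kernelMoment K r.2 ((x.2 - θ.2) / bw n) := fun r hr n θ =>
    ((hkm r.1 (hr2 r hr).1 n θ.1).comp measurable_fst).mul
      ((hkm r.2 (hr2 r hr).2 n θ.2).comp measurable_snd)
  have hφM : ∀ r ∈ Finset.range 3 ×ˢ Finset.range 3, ∀ (n : ℕ) (θ x : ℝ × ℝ),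
      |kernelMoment K r.1 ((x.1 - θ.1) / bw n) * kernelMoment K r.2 ((x.2 - θ.2) / bw n)|
        ≤ M ^ 2 := fun r hr n θ x => by
    rw [abs_mul, sq]; gcongr
    exacts [(hM r.1 (hr2 r hr).1).1 _, (hM r.2 (hr2 r hr).2).1 _]
  have hρ : ∀ n, 0 ≤ bw n ^ 2 * delta₂ n (m n) (bw n) := fun n =>
    mul_nonneg (sq_nonneg _) (Real.sqrt_nonneg _)
  have key : ∀ {y : ℕ → ℕ × ℕ → Ω → ℝ}, (∀ i l, Measurable[genAlg ξ T U (curveIdx i)] (y i l)) →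
      (∀ᵐ ω ∂P, ∀ i l, |y i l ω| ≤ h.noiseBound c i l.1 ω * h.noiseBound c i l.2 ω) →
      ∀ e : ℕ × ℕ → ℕ → ℝ × ℝ → ℝ,
      (∀ r ∈ Finset.range 3 ×ˢ Finset.range 3, ∀ n θ i, ∀ l : ℕ × ℕ, l.1 ≠ l.2 →
        ∫ ω, y i l ω * (kernelMoment K r.1 ((T i l.1 ω - θ.1) / bw n)
            * kernelMoment K r.2 ((T i l.2 ω - θ.2) / bw n)) ∂P = e r n θ) →
      ∀ᵐ ω ∂P, ∃ C : ℝ, 0 ≤ C ∧ ∀ᶠ n : ℕ in atTop, ∀ r ∈ Finset.range 3 ×ˢ Finset.range 3,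
        ∀ θ ∈ Icc a b ×ˢ Icc a b,
        |curveAvg n (fun i => (Finset.range (m n i)).offDiag)
          (fun q => y q.1 q.2 ω * (kernelMoment K r.1 ((T q.1 q.2.1 ω - θ.1) / bw n)
            * kernelMoment K r.2 ((T q.1 q.2.2 ω - θ.2) / bw n))) - e r n θ|
          ≤ C * (bw n ^ 2 * delta₂ n (m n) (bw n)) := by
    intro y hy hyH e he
    have hall : ∀ᵐ ω ∂P, ∀ r ∈ Finset.range 3 ×ˢ Finset.range 3, ∃ C : ℝ, ∀ᶠ n : ℕ in atTop,
        ∀ θ ∈ Icc a b ×ˢ Icc a b,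
        |∑ i ∈ Finset.range n, (favg (Finset.range (m n i)).offDiag
          (fun l => y i l ω * (kernelMoment K r.1 ((T i l.1 ω - θ.1) / bw n)
            * kernelMoment K r.2 ((T i l.2 ω - θ.2) / bw n)))
        - ∫ ω', favg (Finset.range (m n i)).offDiag
          (fun l => y i l ω' * (kernelMoment K r.1 ((T i l.1 ω' - θ.1) / bw n)
            * kernelMoment K r.2 ((T i l.2 ω' - θ.2) / bw n))) ∂P)|
        ≤ C * sumRate (covFactor m bw) n := by
      rw [Filter.eventually_all_finset]
      exact fun r hr => h.ae_eventually_sum_favg_pair_le hab hMT0 hMT hc hlam hmom hm hband hy hyH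
        (hM r.1 (hr2 r hr).1) (hM r.2 (hr2 r hr).2) (hK.kernelMoment_eq_zero r.1)
        (hK.kernelMoment_eq_zero r.2)
    filter_upwards [hall] with ω hω
    refine exists_forall_eventually_le (Finset.range 3 ×ˢ Finset.range 3)
      (Eventually.of_forall hρ) fun r hr => ?_
    obtain ⟨C, hC⟩ := hω r hr
    refine ⟨C, ?_⟩
    filter_upwards [hC, eventually_ge_atTop 1] with n hn hn1 θ hθ
    refine abs_curveAvg_sub_le hn1 (g := fun i => ∫ ω', favg (Finset.range (m n i)).offDiag
          (fun l => y i l ω' * (kernelMoment K r.1 ((T i l.1 ω' - θ.1) / bw n)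
            * kernelMoment K r.2 ((T i l.2 ω' - θ.2) / bw n))) ∂P) (fun i hi => ?_) ?_
    · have hmi := hm n i hi
      have hne : (Finset.range (m n i)).offDiag.Nonempty :=
        ⟨(0, 1), Finset.mem_offDiag.2 ⟨Finset.mem_range.2 (by omega),
          Finset.mem_range.2 (by omega), zero_ne_one⟩⟩
      rw [integral_favg, ← favg_const hne (e r n θ)]
      · unfold favg
        congr 1
        exact Finset.sum_congr rfl fun l hl => he r hr n θ i l (Finset.mem_offDiag.1 hl).2.2
      · intro l _
        refine h.integrable_of_abs_le_noiseBound hc hp hmom i l.1 l.2 (M := M ^ 2)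
          (((hy i l).mono (h.genAlg_le _) le_rfl).mul ((hφm r hr n θ).comp
            ((h.measurable_design i l.1).prodMk (h.measurable_design i l.2)))) ?_
        filter_upwards [hyH] with ω' hω'
        rw [abs_mul, mul_comm]
        gcongr
        · exact hφM r hr n θ (T i l.1 ω', T i l.2 ω')
        · exact hω' i l
    · rw [sumRate_covFactor hn1 (hband.1 n)] at hn
      refine (hn θ hθ).trans (le_of_eq ?_)
      ring
  have key1 := key (y := fun _ _ _ => 1) (fun i j => measurable_const)
    (Eventually.of_forall fun ω i l => by
      rw [abs_one]
      have h1 := hc.trans (h.noiseBound_ge c i l.1 ω)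
      have h2 := hc.trans (h.noiseBound_ge c i l.2 ω)
      nlinarith)
    (fun r n θ => bw n ^ 2 * (localMoment a b fT K (bw n) r.1 θ.1
      * localMoment a b fT K (bw n) r.2 θ.2)) fun r hr n θ i l hl => by
      simp only [one_mul]
      rw [h.integral_design_mul i hl (hkm r.1 (hr2 r hr).1 n θ.1) (hkm r.2 (hr2 r hr).2 n θ.2),
        localMoment, localMoment]
      have := (hband.1 n).ne'
      field_simp
  have key2 := key (fun i j => h.measurable_centeredPair i j)
    (h.ae_abs_centeredPair_le (by linarith) hmom.2 (by linarith) hcC) (fun _ _ _ => 0)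
    fun r hr n θ i l hl => h.integral_centeredPair_mul_eq_zero hc hp hmom hcC
      (hφm r hr n θ) (hφM r hr n θ) i hl
  filter_upwards [key1, key2] with ω ⟨C1, hC1, h1⟩ ⟨C2, hC2, h2⟩
  refine ⟨C1 + C2, by positivity, ?_⟩
  filter_upwards [h1, h2] with n h1 h2 r hr t ht
  have e1 := h1 r hr t ht
  have e2 := h2 r hr t ht
  simp only [one_mul, sub_zero] at e1 e2
  have := hρ n
  constructor
  · refine e1.trans ?_; gcongr; linarith
  · refine e2.trans ?_; gcongr; linarith

end IsSamplingModel

end LocalMoments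

/-! ### Deterministic error bounds for the local-linear estimators -/

section Perturbation

variable {ι : Type*} {d : ℕ}

theorem map_sq_sum_smul (L : (ι → ℝ) →ₗ[ℝ] ℝ) (z : Fin d → ι → ℝ) (v : Fin d → ℝ) :
    L ((∑ i, v i • z i) ^ 2) = ∑ i, ∑ j, v i * v j * L (z i * z j) := by
  rw [sq, Finset.sum_mul_sum, map_sum]
  refine Finset.sum_congr rfl fun i _ => ?_
  rw [map_sum]
  refine Finset.sum_congr rfl fun j _ => ?_
  rw [smul_mul_smul_comm, map_smul, smul_eq_mul]

/-- Entrywise closeness changes the form by at most `ε` times the squared `ℓ¹` norm, which is at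
most `d ε` times the squared Euclidean norm; half of the lower bound survives. -/
theorem quadratic_form_ge_of_close {μ A : Fin d → Fin d → ℝ} {c ε : ℝ}
    (hμ : ∀ v : Fin d → ℝ, c * ∑ i, v i ^ 2 ≤ ∑ i, ∑ j, v i * v j * μ i j)
    (hA : ∀ i j, |A i j - μ i j| ≤ ε) (hε : d * ε ≤ c / 2) (v : Fin d → ℝ) :
    c / 2 * ∑ i, v i ^ 2 ≤ ∑ i, ∑ j, v i * v j * A i j := by
  have h1 : ∑ i, ∑ j, v i * v j * μ i j - ∑ i, ∑ j, v i * v j * A i j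
      ≤ ε * (∑ i, |v i|) ^ 2 := by
    rw [sq, Finset.sum_mul_sum, Finset.mul_sum, ← Finset.sum_sub_distrib]
    refine Finset.sum_le_sum fun i _ => ?_
    rw [Finset.mul_sum, ← Finset.sum_sub_distrib]
    refine Finset.sum_le_sum fun j _ => ?_
    calc v i * v j * μ i j - v i * v j * A i j = -(v i * v j * (A i j - μ i j)) := by ring
      _ ≤ |v i * v j * (A i j - μ i j)| := neg_le_abs _
      _ = |A i j - μ i j| * (|v i| * |v j|) := by rw [abs_mul, abs_mul]; ring
      _ ≤ _ := by gcongr; exact hA i j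
  have h2 : (∑ i, |v i|) ^ 2 ≤ d * ∑ i, v i ^ 2 := by
    have := sq_sum_le_card_mul_sum_sq (s := (Finset.univ : Finset (Fin d))) (f := fun i => |v i|)
    simpa [sq_abs] using this
  have h3 : 0 ≤ ∑ i, v i ^ 2 := Finset.sum_nonneg fun i _ => sq_nonneg _
  have h4 : ε * (∑ i, |v i|) ^ 2 ≤ c / 2 * ∑ i, v i ^ 2 := by
    rcases Nat.eq_zero_or_pos d with rfl | hd
    · simp
    have hε0 : 0 ≤ ε := (abs_nonneg _).trans (hA ⟨0, hd⟩ ⟨0, hd⟩)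
    calc ε * (∑ i, |v i|) ^ 2 ≤ ε * (d * ∑ i, v i ^ 2) := by gcongr
      _ = d * ε * ∑ i, v i ^ 2 := by ring
      _ ≤ _ := by gcongr
  have h5 := hμ v
  linarith

/-- A weighted least squares problem whose Gram matrix is close to a positive definite one has a
minimizer, and its minimizers are close to the coefficients of the regression function. -/
theorem leastSquares_error_of_close {L : (ι → ℝ) →ₗ[ℝ] ℝ} (hL : ∀ f, 0 ≤ f → 0 ≤ L f)
    {z : Fin d → ι → ℝ} {y e r : ι → ℝ} {β : Fin d → ℝ} {μ : Fin d → Fin d → ℝ} {c ε D R : ℝ}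
    (hc : 0 < c) (hμ : ∀ v : Fin d → ℝ, c * ∑ i, v i ^ 2 ≤ ∑ i, ∑ j, v i * v j * μ i j)
    (hA : ∀ i j, |L (z i * z j) - μ i j| ≤ ε) (hε : d * ε ≤ c / 2)
    (hy : y = ∑ i, β i • z i + e + r) (he : ∀ i, |L (e * z i)| ≤ D)
    (hr : ∀ i, |L (r * z i)| ≤ R) :
    (∃ a : Fin d → ℝ, ∀ b : Fin d → ℝ,
      L ((y - ∑ i, a i • z i) ^ 2) ≤ L ((y - ∑ i, b i • z i) ^ 2)) ∧
    ∀ a : Fin d → ℝ, (∀ b : Fin d → ℝ,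
      L ((y - ∑ i, a i • z i) ^ 2) ≤ L ((y - ∑ i, b i • z i) ^ 2)) →
      ∀ i, |a i - β i| ≤ d * (D + R) / (c / 2) := by
  have hpd : ∀ v : Fin d → ℝ, c / 2 * ∑ i, v i ^ 2 ≤ L ((∑ i, v i • z i) ^ 2) := fun v => by
    rw [map_sq_sum_smul]
    exact quadratic_form_ge_of_close (A := fun i j => L (z i * z j)) hμ hA hε v
  refine ⟨exists_leastSquares hL (half_pos hc) hpd, fun a ha i =>
    leastSquares_error (half_pos hc) hpd ha β (fun i => ?_) i⟩
  have : (y - ∑ j, β j • z j) * z i = e * z i + r * z i := by rw [hy]; ring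
  rw [this, map_add]
  exact (abs_add_le _ _).trans (add_le_add (he i) (hr i))

/-- The Kronecker product of two positive definite moment matrices, restricted to degree one. -/
theorem product_moment_ge {c : ℝ} (hc : 0 < c) {f g : ℕ → ℝ}
    (hf : ∀ α β : ℝ, c * (α ^ 2 + β ^ 2) ≤ α ^ 2 * f 0 + 2 * α * β * f 1 + β ^ 2 * f 2)
    (hg : ∀ α β : ℝ, c * (α ^ 2 + β ^ 2) ≤ α ^ 2 * g 0 + 2 * α * β * g 1 + β ^ 2 * g 2)
    (x y w : ℝ) :
    c ^ 2 * (x ^ 2 + y ^ 2 + w ^ 2) ≤ x ^ 2 * (f 0 * g 0) + 2 * x * y * (f 1 * g 0)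
      + 2 * x * w * (f 0 * g 1) + y ^ 2 * (f 2 * g 0) + 2 * y * w * (f 1 * g 1)
      + w ^ 2 * (f 0 * g 2) := by
  have hf0 : c ≤ f 0 := by have := hf 1 0; linarith
  have hg0 : c ≤ g 0 := by have := hg 1 0; linarith
  have hgp : 0 < g 0 := hc.trans_le hg0
  have hdet : 0 ≤ g 0 * g 2 - g 1 ^ 2 := by
    have h1 := hg (-g 1) (g 0)
    have h2 : (-g 1) ^ 2 * g 0 + 2 * (-g 1) * g 0 * g 1 + g 0 ^ 2 * g 2
        = g 0 * (g 0 * g 2 - g 1 ^ 2) := by ring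
    rw [h2] at h1
    have h3 : 0 ≤ c * ((-g 1) ^ 2 + g 0 ^ 2) := by positivity
    exact nonneg_of_mul_nonneg_right (h3.trans h1) hgp
  -- If `f` and `g` are moments in `u` and `v`, then integrating over `u` first gives at least `c
  -- ((x + w v)² + y²)`, and its `v`-integral is `G` below. For mere numbers this is a completed
  -- square: `g 0 * F` is the `f`-form at `(x g₀ + w g₁, y g₀)` plus `f₀ (g₀ g₂ - g₁²) w²`, and `g 0
  -- * G` is the same with `c` times the identity in place of the `f`-form.
  have h1 := hf (x * g 0 + w * g 1) (y * g 0)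
  have h2 : 0 ≤ (f 0 - c) * ((g 0 * g 2 - g 1 ^ 2) * w ^ 2) :=
    mul_nonneg (sub_nonneg.2 hf0) (mul_nonneg hdet (sq_nonneg _))
  set F := x ^ 2 * (f 0 * g 0) + 2 * x * y * (f 1 * g 0)
      + 2 * x * w * (f 0 * g 1) + y ^ 2 * (f 2 * g 0) + 2 * y * w * (f 1 * g 1)
      + w ^ 2 * (f 0 * g 2) with hF
  set G := c * (x ^ 2 * g 0 + 2 * x * w * g 1 + w ^ 2 * g 2 + y ^ 2 * g 0) with hG
  have h3 : 0 ≤ g 0 * (F - G) := by rw [hF, hG]; linarith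
  have h4 : 0 ≤ F - G := nonneg_of_mul_nonneg_right h3 hgp
  have h5 : c ^ 2 * (x ^ 2 + y ^ 2 + w ^ 2) ≤ G := by
    have h6 := hg x w
    have h7 : c * y ^ 2 ≤ y ^ 2 * g 0 := by nlinarith [sq_nonneg y]
    rw [hG, sq, mul_assoc]
    refine mul_le_mul_of_nonneg_left ?_ hc.le
    linarith
  linarith

end Perturbation

/-! ### The estimators as abstract least squares problems -/

section Estimators

variable {ι : Type*}

theorem abs_curveAvg_le {n : ℕ} {s : ℕ → Finset ι} {f g : ℕ × ι → ℝ}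
    (h : ∀ q, |f q| ≤ g q) : |curveAvg n s f| ≤ curveAvg n s g := by
  rw [abs_le]
  constructor
  · have : curveAvg n s (-g) ≤ curveAvg n s f :=
      curveAvg_mono fun i _ l _ => neg_le_of_abs_le (h (i, l))
    rwa [map_neg] at this
  · exact curveAvg_mono fun i _ l _ => (le_abs_self _).trans (h (i, l))

/-- The weighted average over the curves. -/
noncomputable def weightedAvg (n : ℕ) (s : ℕ → Finset ι) (w : ℕ × ι → ℝ) :
    (ℕ × ι → ℝ) →ₗ[ℝ] ℝ := (curveAvg n s).comp (LinearMap.mulRight ℝ w)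

theorem weightedAvg_apply (n : ℕ) (s : ℕ → Finset ι) (w f : ℕ × ι → ℝ) :
    weightedAvg n s w f = curveAvg n s (f * w) := rfl

theorem weightedAvg_nonneg {n : ℕ} {s : ℕ → Finset ι} {w : ℕ × ι → ℝ} (hw : ∀ q, 0 ≤ w q)
    (f : ℕ × ι → ℝ) (hf : 0 ≤ f) : 0 ≤ weightedAvg n s w f := by
  rw [weightedAvg_apply, ← map_zero (curveAvg n s)]
  exact curveAvg_mono fun i _ l _ => mul_nonneg (hf (i, l)) (hw (i, l))

theorem abs_weightedAvg_mul_le {n : ℕ} {s : ℕ → Finset ι} {w r z : ℕ × ι → ℝ} {R : ℝ}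
    (hw : ∀ q, 0 ≤ w q) (hr : ∀ q, w q ≠ 0 → |r q| ≤ R) (hz : ∀ q, w q ≠ 0 → |z q| ≤ 1) :
    |weightedAvg n s w (r * z)| ≤ R * curveAvg n s w := by
  rw [weightedAvg_apply, ← smul_eq_mul R, ← map_smul]
  refine abs_curveAvg_le fun q => ?_
  simp only [Pi.mul_apply, Pi.smul_apply, smul_eq_mul]
  by_cases h : w q = 0
  · simp [h]
  · rw [abs_mul, abs_mul, abs_of_nonneg (hw q)]
    have := mul_le_mul (hr q h) (hz q h) (abs_nonneg _) ((abs_nonneg _).trans (hr q h))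
    rw [mul_one] at this
    exact mul_le_mul_of_nonneg_right this (hw q)

variable {K : ℝ → ℝ} {h : ℝ} {n : ℕ} {m : ℕ → ℕ} {T Y : ℕ → ℕ → ℝ}

theorem KernelCondition.abs_le_of_scaledKernel_ne_zero (hK : KernelCondition K) {u : ℝ}
    (hu : scaledKernel K h u ≠ 0) : |u / h| ≤ 1 := by
  by_contra hlt
  refine hu ?_
  rw [scaledKernel, hK.support _ fun hx => hlt (abs_le.2 hx), mul_zero]

/-- Measuring the displacement in units of `h`, with the slope multiplied by `h` in return, makes
the Gram matrix comparable to the identity at every bandwidth. The intercept is unaffected. -/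
theorem meanCriterion_eq_weightedAvg (hh : 0 < h) (t a₀ a₁ : ℝ) :
    meanCriterion K h n m T Y t a₀ a₁
      = weightedAvg n (fun i => Finset.range (m i)) (fun q => scaledKernel K h (T q.1 q.2 - t))
        (((fun q => Y q.1 q.2) - ∑ i, (![a₀, h * a₁] : Fin 2 → ℝ) i •
          fun q : ℕ × ℕ => ((T q.1 q.2 - t) / h) ^ (i : ℕ)) ^ 2) := by
  rw [weightedAvg_apply, curveAvg_apply, meanCriterion, one_div]
  congr 1
  refine Finset.sum_congr rfl fun i _ => ?_
  rw [favg, Finset.card_range, one_div]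
  congr 1
  refine Finset.sum_congr rfl fun j _ => ?_
  simp [Fin.sum_univ_two]
  left
  congr 1
  field_simp
  ring

/-- The error of the local-linear mean estimator. -/
theorem abs_meanEstimator_sub_le (hK : KernelCondition K) (hh : 0 < h) {t : ℝ} {μ : ℕ → ℝ}
    {c ε D R : ℝ} (hc : 0 < c)
    (hμ : ∀ α β : ℝ, c * (α ^ 2 + β ^ 2) ≤ α ^ 2 * μ 0 + 2 * α * β * μ 1 + β ^ 2 * μ 2)
    (hdev : ∀ r ≤ 2, |h⁻¹ * curveAvg n (fun i => Finset.range (m i))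
      (fun q => kernelMoment K r ((T q.1 q.2 - t) / h)) - μ r| ≤ ε) (hε : 2 * ε ≤ c / 2)
    {e r : ℕ × ℕ → ℝ} {β₀ β₁ : ℝ}
    (hY : ∀ i j, Y i j = β₀ + β₁ * (T i j - t) + e (i, j) + r (i, j))
    (hR : 0 ≤ R) (he : ∀ r ≤ 2, |h⁻¹ * curveAvg n (fun i => Finset.range (m i))
      (fun q => e q * kernelMoment K r ((T q.1 q.2 - t) / h))| ≤ D)
    (hr : ∀ i j, |T i j - t| ≤ h → |r (i, j)| ≤ R) :
    |meanEstimator K h n m T Y t - β₀| ≤ 2 * (D + R * (μ 0 + ε)) / (c / 2) := by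
  set s : ℕ → Finset ℕ := fun i => Finset.range (m i) with hs
  set w : ℕ × ℕ → ℝ := fun q => scaledKernel K h (T q.1 q.2 - t) with hw
  set z : Fin 2 → ℕ × ℕ → ℝ := fun i q => ((T q.1 q.2 - t) / h) ^ (i : ℕ) with hz
  have hw0 : ∀ q, 0 ≤ w q := fun q => scaledKernel_nonneg hK hh _
  have hzw : ∀ (r : ℕ) (f : ℕ × ℕ → ℝ), curveAvg n s (fun q =>
      f q * ((T q.1 q.2 - t) / h) ^ r * w q)
      = h⁻¹ * curveAvg n s (fun q => f q * kernelMoment K r ((T q.1 q.2 - t) / h)) := by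
    intro r f
    rw [← smul_eq_mul h⁻¹, ← map_smul]
    congr 1
    ext q
    simp only [hw, scaledKernel, kernelMoment, Pi.smul_apply, smul_eq_mul]
    ring
  have hzz : ∀ i j : Fin 2, weightedAvg n s w (z i * z j) = h⁻¹ * curveAvg n s
      (fun q => kernelMoment K (i + j) ((T q.1 q.2 - t) / h)) := by
    intro i j
    have := hzw (i + j) fun _ => 1
    simp only [one_mul] at this
    rw [← this, weightedAvg_apply]
    congr 1
    ext q
    simp only [hz, Pi.mul_apply, pow_add]
  have hW : curveAvg n s w ≤ μ 0 + ε := by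
    have h1 := hzw 0 fun _ => 1
    simp only [one_mul, pow_zero] at h1
    have h2 := (abs_le.1 (hdev 0 (by norm_num))).2
    rw [← h1] at h2
    linarith
  have hq : ∀ v : Fin 2 → ℝ, c * ∑ i, v i ^ 2
      ≤ ∑ i : Fin 2, ∑ j : Fin 2, v i * v j * μ (i + j) := fun v => by
    have := hμ (v 0) (v 1)
    simp [Fin.sum_univ_two]
    linarith
  have hA : ∀ i j : Fin 2, |weightedAvg n s w (z i * z j) - μ (i + j)| ≤ ε := fun i j => by
    rw [hzz]
    exact hdev _ (by omega)
  have hy : (fun q : ℕ × ℕ => Y q.1 q.2)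
      = ∑ i, (![β₀, h * β₁] : Fin 2 → ℝ) i • z i + e + r := by
    ext q
    simp only [Fin.sum_univ_two, Pi.add_apply, Pi.smul_apply, smul_eq_mul, hz, hY]
    simp
    field_simp
  have he' : ∀ i, |weightedAvg n s w (e * z i)| ≤ D := fun i => by
    have : weightedAvg n s w (e * z i) = h⁻¹ * curveAvg n s
        (fun q => e q * kernelMoment K i ((T q.1 q.2 - t) / h)) := by
      rw [← hzw]; rfl
    rw [this]
    exact he _ (by omega)
  have hr' : ∀ i, |weightedAvg n s w (r * z i)| ≤ R * (μ 0 + ε) := fun i => by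
    have hu : ∀ q, w q ≠ 0 → |(T q.1 q.2 - t) / h| ≤ 1 := fun q hq =>
      hK.abs_le_of_scaledKernel_ne_zero hq
    refine (abs_weightedAvg_mul_le (n := n) (s := s) hw0 (r := r) (R := R)
      (fun q hq => hr _ _ ?_) (fun q hq => ?_)).trans (mul_le_mul_of_nonneg_left hW hR)
    · have := hu q hq
      rwa [abs_div, abs_of_pos hh, div_le_one hh] at this
    · simp only [hz]
      rw [abs_pow]
      exact pow_le_one₀ (abs_nonneg _) (hu q hq)
  obtain ⟨⟨a, ha⟩, hb⟩ := leastSquares_error_of_close (weightedAvg_nonneg hw0)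
    (μ := fun i j => μ (i + j)) hc hq hA (by exact_mod_cast hε) hy he' hr'
  have hex : ∃ a₀ a₁ : ℝ, ∀ b₀ b₁ : ℝ,
      meanCriterion K h n m T Y t a₀ a₁ ≤ meanCriterion K h n m T Y t b₀ b₁ := by
    refine ⟨a 0, a 1 / h, fun b₀ b₁ => ?_⟩
    rw [meanCriterion_eq_weightedAvg hh, meanCriterion_eq_weightedAvg hh]
    have e1 : ![a 0, h * (a 1 / h)] = a := by
      ext i; fin_cases i <;> simp [mul_div_cancel₀ _ hh.ne']
    rw [e1]
    exact ha _
  -- Existence of a minimizer makes the chosen value the intercept of an actual minimizer, to which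
  -- the least squares bound applies.
  obtain ⟨a₁, ha₁⟩ := Classical.epsilon_spec hex
  have := hb ![meanEstimator K h n m T Y t, h * a₁] (fun b => ?_) 0
  · simpa using this
  · have h1 := ha₁ (b 0) (b 1 / h)
    rw [meanCriterion_eq_weightedAvg hh, meanCriterion_eq_weightedAvg hh] at h1
    have e1 : ![b 0, h * (b 1 / h)] = b := by
      ext i; fin_cases i <;> simp [mul_div_cancel₀ _ hh.ne']
    rw [e1] at h1
    exact h1

/-- The exponents of the first variable in the regressors `1`, `u`, `v`. -/
def firstExp : Fin 3 → ℕ := ![0, 1, 0]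

/-- The exponents of the second variable in the regressors `1`, `u`, `v`. -/
def secondExp : Fin 3 → ℕ := ![0, 0, 1]

theorem firstExp_le (i : Fin 3) : firstExp i ≤ 1 := by
  fin_cases i <;> simp [firstExp]

theorem secondExp_le (i : Fin 3) : secondExp i ≤ 1 := by
  fin_cases i <;> simp [secondExp]

theorem productCriterion_eq_weightedAvg (hh : 0 < h) (s t a₀ a₁ a₂ : ℝ) :
    productCriterion K h n m T Y s t a₀ a₁ a₂
      = weightedAvg n (fun i => (Finset.range (m i)).offDiag)
        (fun q => scaledKernel K h (T q.1 q.2.1 - s) * scaledKernel K h (T q.1 q.2.2 - t))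
        (((fun q => Y q.1 q.2.1 * Y q.1 q.2.2) - ∑ i, (![a₀, h * a₁, h * a₂] : Fin 3 → ℝ) i •
          fun q : ℕ × ℕ × ℕ => ((T q.1 q.2.1 - s) / h) ^ firstExp i
            * ((T q.1 q.2.2 - t) / h) ^ secondExp i) ^ 2) := by
  rw [weightedAvg_apply, curveAvg_apply, productCriterion, one_div]
  congr 1
  refine Finset.sum_congr rfl fun i _ => ?_
  have hcard : (((Finset.range (m i)).offDiag.card : ℕ) : ℝ) = m i * ((m i : ℝ) - 1) := by
    rw [Finset.offDiag_card, Finset.card_range, Nat.cast_sub (Nat.le_mul_self _)]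
    push_cast; ring
  rw [favg, hcard, one_div]
  congr 1
  rw [← Finset.sum_finset_product' (Finset.range (m i)).offDiag (Finset.range (m i))
    (fun j => (Finset.range (m i)).erase j) (fun l => by
      rw [Finset.mem_offDiag, Finset.mem_erase]; tauto)]
  refine Finset.sum_congr rfl fun l _ => ?_
  simp [Fin.sum_univ_three, firstExp, secondExp]
  rw [mul_assoc]
  congr 2
  field_simp
  ring

/-- The error of the local-linear estimator of the second moment function. -/
theorem abs_productEstimator_sub_le (hK : KernelCondition K) (hh : 0 < h) {s t : ℝ}
    {μ ν : ℕ → ℝ} {c ε D R : ℝ} (hc : 0 < c)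
    (hμ : ∀ α β : ℝ, c * (α ^ 2 + β ^ 2) ≤ α ^ 2 * μ 0 + 2 * α * β * μ 1 + β ^ 2 * μ 2)
    (hν : ∀ α β : ℝ, c * (α ^ 2 + β ^ 2) ≤ α ^ 2 * ν 0 + 2 * α * β * ν 1 + β ^ 2 * ν 2)
    (hdev : ∀ r ≤ 2, ∀ r' ≤ 2, |(h ^ 2)⁻¹ * curveAvg n (fun i => (Finset.range (m i)).offDiag)
      (fun q => kernelMoment K r ((T q.1 q.2.1 - s) / h)
        * kernelMoment K r' ((T q.1 q.2.2 - t) / h)) - μ r * ν r'| ≤ ε) (hε : 3 * ε ≤ c ^ 2 / 2)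
    {e r : ℕ × ℕ × ℕ → ℝ} {β₀ β₁ β₂ : ℝ}
    (hY : ∀ i j k, Y i j * Y i k
      = β₀ + β₁ * (T i j - s) + β₂ * (T i k - t) + e (i, j, k) + r (i, j, k))
    (hR : 0 ≤ R) (he : ∀ r ≤ 2, ∀ r' ≤ 2,
      |(h ^ 2)⁻¹ * curveAvg n (fun i => (Finset.range (m i)).offDiag)
      (fun q => e q * (kernelMoment K r ((T q.1 q.2.1 - s) / h)
        * kernelMoment K r' ((T q.1 q.2.2 - t) / h)))| ≤ D)
    (hr : ∀ i j k, |T i j - s| ≤ h → |T i k - t| ≤ h → |r (i, j, k)| ≤ R) :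
    |productEstimator K h n m T Y s t - β₀| ≤ 3 * (D + R * (μ 0 * ν 0 + ε)) / (c ^ 2 / 2) := by
  set S : ℕ → Finset (ℕ × ℕ) := fun i => (Finset.range (m i)).offDiag with hS
  set w : ℕ × ℕ × ℕ → ℝ := fun q =>
    scaledKernel K h (T q.1 q.2.1 - s) * scaledKernel K h (T q.1 q.2.2 - t) with hw
  set z : Fin 3 → ℕ × ℕ × ℕ → ℝ := fun i q =>
    ((T q.1 q.2.1 - s) / h) ^ firstExp i * ((T q.1 q.2.2 - t) / h) ^ secondExp i with hz
  have hw0 : ∀ q, 0 ≤ w q := fun q =>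
    mul_nonneg (scaledKernel_nonneg hK hh _) (scaledKernel_nonneg hK hh _)
  have hzw : ∀ (r r' : ℕ) (f : ℕ × ℕ × ℕ → ℝ), curveAvg n S (fun q =>
      f q * (((T q.1 q.2.1 - s) / h) ^ r * ((T q.1 q.2.2 - t) / h) ^ r') * w q)
      = (h ^ 2)⁻¹ * curveAvg n S (fun q => f q * (kernelMoment K r ((T q.1 q.2.1 - s) / h)
        * kernelMoment K r' ((T q.1 q.2.2 - t) / h))) := by
    intro r r' f
    rw [← smul_eq_mul (h ^ 2)⁻¹, ← map_smul]
    congr 1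
    ext q
    simp only [hw, scaledKernel, kernelMoment, Pi.smul_apply, smul_eq_mul]
    field_simp
  have hzz : ∀ i j : Fin 3, weightedAvg n S w (z i * z j) = (h ^ 2)⁻¹ * curveAvg n S
      (fun q => kernelMoment K (firstExp i + firstExp j) ((T q.1 q.2.1 - s) / h)
        * kernelMoment K (secondExp i + secondExp j) ((T q.1 q.2.2 - t) / h)) := by
    intro i j
    have := hzw (firstExp i + firstExp j) (secondExp i + secondExp j) fun _ => 1
    simp only [one_mul] at this
    rw [← this, weightedAvg_apply]
    congr 1
    ext q
    simp only [hz, Pi.mul_apply, pow_add]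
    ring
  have hW : curveAvg n S w ≤ μ 0 * ν 0 + ε := by
    have h1 := hzw 0 0 fun _ => 1
    simp only [one_mul, pow_zero] at h1
    have h2 := (abs_le.1 (hdev 0 (by norm_num) 0 (by norm_num))).2
    rw [← h1] at h2
    linarith
  have hq : ∀ v : Fin 3 → ℝ, c ^ 2 * ∑ i, v i ^ 2 ≤ ∑ i : Fin 3, ∑ j : Fin 3,
      v i * v j * (μ (firstExp i + firstExp j) * ν (secondExp i + secondExp j)) := fun v => by
    have := product_moment_ge hc hμ hν (v 0) (v 1) (v 2)
    simp [Fin.sum_univ_three, firstExp, secondExp]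
    linarith
  have hA : ∀ i j : Fin 3, |weightedAvg n S w (z i * z j)
      - μ (firstExp i + firstExp j) * ν (secondExp i + secondExp j)| ≤ ε := fun i j => by
    have h1 := firstExp_le i
    have h2 := firstExp_le j
    have h3 := secondExp_le i
    have h4 := secondExp_le j
    rw [hzz]
    exact hdev _ (by omega) _ (by omega)
  have hy : (fun q : ℕ × ℕ × ℕ => Y q.1 q.2.1 * Y q.1 q.2.2)
      = ∑ i, (![β₀, h * β₁, h * β₂] : Fin 3 → ℝ) i • z i + e + r := by
    ext q
    simp only [Fin.sum_univ_three, Pi.add_apply, Pi.smul_apply, smul_eq_mul, hz, hY]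
    simp [firstExp, secondExp]
    field_simp
  have he' : ∀ i, |weightedAvg n S w (e * z i)| ≤ D := fun i => by
    have : weightedAvg n S w (e * z i) = (h ^ 2)⁻¹ * curveAvg n S
        (fun q => e q * (kernelMoment K (firstExp i) ((T q.1 q.2.1 - s) / h)
          * kernelMoment K (secondExp i) ((T q.1 q.2.2 - t) / h))) := by
      rw [← hzw]; rfl
    rw [this]
    exact he _ ((firstExp_le i).trans (by norm_num)) _ ((secondExp_le i).trans (by norm_num))
  have hr' : ∀ i, |weightedAvg n S w (r * z i)| ≤ R * (μ 0 * ν 0 + ε) := fun i => by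
    have hu : ∀ q, w q ≠ 0 → |(T q.1 q.2.1 - s) / h| ≤ 1 ∧ |(T q.1 q.2.2 - t) / h| ≤ 1 :=
      fun q hq => ⟨hK.abs_le_of_scaledKernel_ne_zero (left_ne_zero_of_mul hq),
        hK.abs_le_of_scaledKernel_ne_zero (right_ne_zero_of_mul hq)⟩
    refine (abs_weightedAvg_mul_le (n := n) (s := S) hw0 (r := r) (R := R)
      (fun q hq => hr _ _ _ ?_ ?_) (fun q hq => ?_)).trans (mul_le_mul_of_nonneg_left hW hR)
    · have := (hu q hq).1
      rwa [abs_div, abs_of_pos hh, div_le_one hh] at this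
    · have := (hu q hq).2
      rwa [abs_div, abs_of_pos hh, div_le_one hh] at this
    · simp only [hz]
      rw [abs_mul, abs_pow, abs_pow]
      exact mul_le_one₀ (pow_le_one₀ (abs_nonneg _) (hu q hq).1) (by positivity)
        (pow_le_one₀ (abs_nonneg _) (hu q hq).2)
  obtain ⟨⟨a, ha⟩, hb⟩ := leastSquares_error_of_close (weightedAvg_nonneg hw0)
    (μ := fun i j => μ (firstExp i + firstExp j) * ν (secondExp i + secondExp j))
    (pow_pos hc 2) hq hA (by exact_mod_cast hε) hy he' hr'
  have hex : ∃ a₀ a₁ a₂ : ℝ, ∀ b₀ b₁ b₂ : ℝ,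
      productCriterion K h n m T Y s t a₀ a₁ a₂ ≤ productCriterion K h n m T Y s t b₀ b₁ b₂ := by
    refine ⟨a 0, a 1 / h, a 2 / h, fun b₀ b₁ b₂ => ?_⟩
    rw [productCriterion_eq_weightedAvg hh, productCriterion_eq_weightedAvg hh]
    have e1 : ![a 0, h * (a 1 / h), h * (a 2 / h)] = a := by
      ext i; fin_cases i <;> simp [mul_div_cancel₀ _ hh.ne']
    rw [e1]
    exact ha _
  obtain ⟨a₁, a₂, ha₁⟩ := Classical.epsilon_spec hex
  have := hb ![productEstimator K h n m T Y s t, h * a₁, h * a₂] (fun b => ?_) 0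
  · simpa using this
  · have h1 := ha₁ (b 0) (b 1 / h) (b 2 / h)
    rw [productCriterion_eq_weightedAvg hh, productCriterion_eq_weightedAvg hh] at h1
    have e1 : ![b 0, h * (b 1 / h), h * (b 2 / h)] = b := by
      ext i; fin_cases i <;> simp [mul_div_cancel₀ _ hh.ne']
    rw [e1] at h1
    exact h1

end Estimators

/-! ### Uniform rates of convergence -/

section Rates

variable {Ω 𝒳 : Type*} [mΩ : MeasurableSpace Ω] [MeasurableSpace 𝒳]
  {P : Measure Ω} {Q : Measure 𝒳} {a b : ℝ} {X : 𝒳 → ℝ → ℝ} {fT : ℝ → ℝ}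
  {ξ : ℕ → Ω → 𝒳} {T U : ℕ → ℕ → Ω → ℝ} {K : ℝ → ℝ}

/-- The gradient is that of the covariance plus the product rule for `μ(s) μ(t)`. The remainder
consists of the remainder of the covariance, the two remainders of the mean times bounded values,
and a product of two increments of the mean, each `O(h)`. -/
theorem exists_secondMoment_taylor (hmean : MeanSmoothness a b (meanFun Q X))
    (hcov : CovSmoothness a b (covFun Q X)) (hab : a < b) :
    ∃ (G₁ G₂ : ℝ → ℝ → ℝ) (M : ℝ), 0 ≤ M ∧ ∀ s ∈ Icc a b, ∀ t ∈ Icc a b, ∀ u ∈ Icc a b,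
      ∀ v ∈ Icc a b, ∀ h, |u - s| ≤ h → |v - t| ≤ h →
      |secondMoment Q X u v - secondMoment Q X s t - G₁ s t * (u - s) - G₂ s t * (v - t)|
        ≤ M * h ^ 2 := by
  have ha : a ∈ Icc a b := left_mem_Icc.2 hab.le
  obtain ⟨f', f'', M₁, hf⟩ := hmean
  have hM₁ : 0 ≤ M₁ := (abs_nonneg _).trans (hf a ha).2.2
  obtain ⟨F₁, F₂, F₁₁, F₁₂, F₂₁, F₂₂, M₂, hF⟩ := hcov
  have hM₂ : 0 ≤ M₂ := (abs_nonneg _).trans (hF a ha a ha).2.2.2.2.2.2.1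
  set μ := meanFun Q X with hμ
  obtain ⟨c, hc⟩ : ∃ c, ∀ t ∈ Icc a b, |μ t| ≤ c :=
    isCompact_Icc.exists_bound_of_continuousOn fun t ht => (hf t ht).1.continuousWithinAt
  obtain ⟨c', hc'⟩ : ∃ c, ∀ t ∈ Icc a b, |f' t| ≤ c :=
    isCompact_Icc.exists_bound_of_continuousOn fun t ht => (hf t ht).2.1.continuousWithinAt
  have hc0 : 0 ≤ c := (abs_nonneg _).trans (hc a ha)
  have hc0' : 0 ≤ c' := (abs_nonneg _).trans (hc' a ha)
  have hba : 0 ≤ b - a := (sub_pos.2 hab).le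
  refine ⟨fun s t => F₁ s t + f' s * μ t, fun s t => F₂ s t + μ s * f' t,
    4 * M₂ + 2 * (M₁ * c) + (c' + M₁ * (b - a)) ^ 2, by positivity,
    fun s hs t ht u hu v hv h hus hvt => ?_⟩
  have hh : 0 ≤ h := (abs_nonneg _).trans hus
  have hρ : ∀ {s u}, s ∈ Icc a b → u ∈ Icc a b → |u - s| ≤ h →
      |μ u - μ s - f' s * (u - s)| ≤ M₁ * h ^ 2 ∧
        |μ u - μ s| ≤ (c' + M₁ * (b - a)) * h := by
    intro s u hs hu hus
    have h1 := abs_sub_taylor_le (fun t ht => (hf t ht).1) (fun t ht => (hf t ht).2.1)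
      (fun t ht => (hf t ht).2.2) hs hu
    have h2 : (u - s) ^ 2 ≤ h ^ 2 := by rw [← sq_abs]; gcongr
    have h3 : |u - s| ≤ b - a := abs_le.2 ⟨by linarith [hu.1, hs.2], by linarith [hu.2, hs.1]⟩
    have h4 : (u - s) ^ 2 ≤ (b - a) * h := by
      rw [← sq_abs, sq]; gcongr
    refine ⟨h1.trans (by gcongr), ?_⟩
    have h5 : |f' s * (u - s)| ≤ c' * h := by
      rw [abs_mul]; gcongr; exact hc' s hs
    have e : μ u - μ s = (μ u - μ s - f' s * (u - s)) + f' s * (u - s) := by ring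
    rw [e]
    refine (abs_add_le _ _).trans ?_
    have h6 : M₁ * (u - s) ^ 2 ≤ M₁ * ((b - a) * h) := by gcongr
    linarith
  obtain ⟨r1, l1⟩ := hρ hs hu hus
  obtain ⟨r2, l2⟩ := hρ ht hv hvt
  have hR := abs_sub_taylor_le_of_partials (fun s hs t ht => (hF s hs t ht).1)
      (fun s hs t ht => (hF s hs t ht).2.1) (fun s hs t ht => (hF s hs t ht).2.2.1)
      (fun s hs t ht => (hF s hs t ht).2.2.2.1) (fun s hs t ht => (hF s hs t ht).2.2.2.2.2.1)
      (fun s hs t ht => (hF s hs t ht).2.2.2.2.2.2.1)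
      (fun s hs t ht => (hF s hs t ht).2.2.2.2.2.2.2.1)
      (fun s hs t ht => (hF s hs t ht).2.2.2.2.2.2.2.2.2) hs ht hu hv
  have hR' : M₂ * (|u - s| + |v - t|) ^ 2 ≤ M₂ * (h + h) ^ 2 := by gcongr
  have e : secondMoment Q X u v - secondMoment Q X s t - (F₁ s t + f' s * μ t) * (u - s)
      - (F₂ s t + μ s * f' t) * (v - t)
      = (covFun Q X u v - covFun Q X s t - F₁ s t * (u - s) - F₂ s t * (v - t))
        + (μ u - μ s - f' s * (u - s)) * μ t + (μ v - μ t - f' t * (v - t)) * μ s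
        + (μ u - μ s) * (μ v - μ t) := by
    simp only [secondMoment, ← hμ]; ring
  have b1 : |(μ u - μ s - f' s * (u - s)) * μ t| ≤ M₁ * h ^ 2 * c := by
    rw [abs_mul]; gcongr; exact hc t ht
  have b2 : |(μ v - μ t - f' t * (v - t)) * μ s| ≤ M₁ * h ^ 2 * c := by
    rw [abs_mul]; gcongr; exact hc s hs
  have b3 : |(μ u - μ s) * (μ v - μ t)|
      ≤ (c' + M₁ * (b - a)) * h * ((c' + M₁ * (b - a)) * h) := by
    rw [abs_mul]; gcongr
  simp only
  rw [e]
  refine (abs_add_le _ _).trans ((add_le_add ((abs_add_le _ _).trans (add_le_add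
    ((abs_add_le _ _).trans (add_le_add (hR.trans hR') b1)) b2)) b3).trans (le_of_eq ?_))
  ring

namespace IsSamplingModel

/-- The uniform rate of the local-linear mean estimator. -/
theorem ae_meanEstimator_rate (h : IsSamplingModel P Q a b X fT ξ T U) [IsProbabilityMeasure P]
    [IsProbabilityMeasure Q] (hab : a < b) (hd : DensityCondition a b fT) (hK : KernelCondition K)
    (hmean : MeanSmoothness a b (meanFun Q X)) {p : ℝ} (hp : 4 ≤ p)
    (hmom : MomentCondition P Q a b X U p) {lam : ℝ} (hlam : 2 < lam)
    (hmomlam : MomentCondition P Q a b X U lam) {m : ℕ → ℕ → ℕ} (hm : ∀ n i, i < n → 2 ≤ m n i)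
    {bw : ℕ → ℝ} (hband : MeanBandwidthCondition m bw lam) {c₀ : ℝ} (hc₀ : 1 ≤ c₀)
    (hμ : ∀ t ∈ Icc a b, |meanFun Q X t| ≤ c₀) :
    ∀ᵐ ω ∂P, ∃ C : ℝ, 0 ≤ C ∧ ∀ᶠ n : ℕ in atTop, ∀ t ∈ Icc a b,
      |meanEstimator K (bw n) n (m n) (fun i j => T i j ω) (observation X ξ T U ω) t
        - meanFun Q X t| ≤ C * (bw n ^ 2 + delta₁ n (m n) (bw n)) := by
  have hprob := h.isProbabilityMeasure_designLaw
  have ha : a ∈ Icc a b := left_mem_Icc.2 hab.le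
  obtain ⟨c, Cm, hc, hCm, hloc⟩ := exists_localMoment_bounds hK hd hab
  obtain ⟨⟨cT, MT, hcT, hT⟩, -⟩ := hd
  have hMT : 0 ≤ MT := by have := hT a ha; linarith
  obtain ⟨f', f'', M, hf⟩ := hmean
  have hM : 0 ≤ M := (abs_nonneg _).trans (hf a ha).2.2
  have hδ := hband.tendsto_delta hm (by linarith)
  filter_upwards [h.ae_mean_statistics hab hMT (fun t ht => (hT t ht).2) hK hc₀ hμ hp hmom hlam
    hmomlam hm hband, h.ae_mem_design] with ω ⟨C, hC, hst⟩ hTm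
  -- The least squares bound `2 (D + R (μ₀ + ε)) / (c / 2)` with `D = C δ`, `R = M h²`, `μ₀ ≤ Cm`
  -- and `ε = C δ ≤ 1`.
  refine ⟨4 / c * (C + M * (Cm + 1)), by positivity, ?_⟩
  have hCδ : Tendsto (fun n => C * delta₁ n (m n) (bw n)) atTop (𝓝 0) := by
    simpa using hδ.const_mul C
  -- Eventually `h ≤ (b - a) / 2`, so half windows fit, and `C δ ≤ c / 4`, which is the closeness
  -- needed for a `2 × 2` Gram matrix.
  filter_upwards [hst, hband.2.1.eventually (ge_mem_nhds (half_pos (sub_pos.2 hab))),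
    hCδ.eventually (ge_mem_nhds (by positivity : 0 < c / 4)),
    hCδ.eventually (ge_mem_nhds zero_lt_one)] with n hs hbw h1 h2 t ht
  have hh := hband.1 n
  obtain ⟨hl0, hlpd⟩ := hloc t ht (bw n) hh hbw
  set δ := delta₁ n (m n) (bw n) with hδdef
  have hδ0 : 0 ≤ δ := Real.sqrt_nonneg _
  have hmul : ∀ {x : ℝ}, |x| ≤ C * (bw n * δ) → |(bw n)⁻¹ * x| ≤ C * δ := by
    intro x hx
    rw [abs_mul, abs_of_pos (inv_pos.2 hh), inv_mul_le_iff₀ hh]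
    linarith
  have key := abs_meanEstimator_sub_le (n := n) (m := m n) (T := fun i j => T i j ω)
    (Y := observation X ξ T U ω) hK hh (t := t) (μ := fun r => localMoment a b fT K (bw n) r t)
    (c := c) (ε := C * δ) (D := C * δ) (R := M * bw n ^ 2) hc hlpd (fun r hr => ?_) (by linarith)
    (e := fun q => centered Q X ξ T U q.1 q.2 ω)
    (r := fun q => meanFun Q X (T q.1 q.2 ω) - meanFun Q X t - f' t * (T q.1 q.2 ω - t))
    (β₀ := meanFun Q X t) (β₁ := f' t) (fun i j => by simp only [centered]; ring)
    (by positivity) (fun r hr => ?_) (fun i j hij => ?_)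
  · refine key.trans ?_
    have h3 : M * bw n ^ 2 * (localMoment a b fT K (bw n) 0 t + C * δ)
        ≤ M * bw n ^ 2 * (Cm + 1) := by gcongr
    rw [div_le_iff₀ (by positivity)]
    have h4 : 4 / c * (C + M * (Cm + 1)) * (bw n ^ 2 + δ) * (c / 2)
        = 2 * (C + M * (Cm + 1)) * (bw n ^ 2 + δ) := by field_simp; ring
    rw [h4]
    have h5 : 0 ≤ C * bw n ^ 2 + M * (Cm + 1) * δ := by positivity
    nlinarith
  · have := hmul (hs r (Finset.mem_range.2 (by omega)) t ht).1
    rwa [mul_sub, inv_mul_cancel_left₀ hh.ne'] at this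
  · exact hmul (hs r (Finset.mem_range.2 (by omega)) t ht).2
  · refine (abs_sub_taylor_le (fun t ht => (hf t ht).1) (fun t ht => (hf t ht).2.1)
      (fun t ht => (hf t ht).2.2) ht (hTm i j)).trans ?_
    rw [← sq_abs]
    gcongr

/-- The uniform rate of the local-linear estimator of the second moment function. -/
theorem ae_productEstimator_rate (h : IsSamplingModel P Q a b X fT ξ T U) [IsProbabilityMeasure P]
    [IsProbabilityMeasure Q] (hab : a < b) (hd : DensityCondition a b fT) (hK : KernelCondition K)
    (hmean : MeanSmoothness a b (meanFun Q X)) (hcov : CovSmoothness a b (covFun Q X)) {lam : ℝ}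
    (hlam : 2 < lam) (hmom : MomentCondition P Q a b X U (2 * lam)) {m : ℕ → ℕ → ℕ}
    (hm : ∀ n i, i < n → 2 ≤ m n i) {bw : ℕ → ℝ} (hband : CovBandwidthCondition m bw lam)
    {c₀ : ℝ} (hc₀ : 1 ≤ c₀)
    (hC₀ : ∀ s ∈ Icc a b, ∀ t ∈ Icc a b, |secondMoment Q X s t| ≤ c₀ ^ 2) :
    ∀ᵐ ω ∂P, ∃ C : ℝ, 0 ≤ C ∧ ∀ᶠ n : ℕ in atTop, ∀ s ∈ Icc a b, ∀ t ∈ Icc a b,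
      |productEstimator K (bw n) n (m n) (fun i j => T i j ω) (observation X ξ T U ω) s t
        - secondMoment Q X s t| ≤ C * (bw n ^ 2 + delta₂ n (m n) (bw n)) := by
  have hprob := h.isProbabilityMeasure_designLaw
  have ha : a ∈ Icc a b := left_mem_Icc.2 hab.le
  obtain ⟨c, Cm, hc, hCm, hloc⟩ := exists_localMoment_bounds hK hd hab
  obtain ⟨⟨cT, MT, hcT, hT⟩, -⟩ := hd
  have hMT : 0 ≤ MT := by have := hT a ha; linarith
  obtain ⟨G₁, G₂, M, hM, hG⟩ := exists_secondMoment_taylor hmean hcov hab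
  have hδ := hband.tendsto_delta hm (by linarith)
  filter_upwards [h.ae_pair_statistics hab hMT (fun t ht => (hT t ht).2) hK hc₀ hC₀ hlam hmom hm
    hband, h.ae_mem_design] with ω ⟨C, hC, hst⟩ hTm
  -- As for the mean, with three regressors, lower bound `c ^ 2` for the product moments and total
  -- weight at most `Cm ^ 2 + 1`; the closeness threshold is accordingly `c ^ 2 / 6`.
  refine ⟨6 / c ^ 2 * (C + M * (Cm ^ 2 + 1)), by positivity, ?_⟩
  have hCδ : Tendsto (fun n => C * delta₂ n (m n) (bw n)) atTop (𝓝 0) := by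
    simpa using hδ.const_mul C
  filter_upwards [hst, hband.2.1.eventually (ge_mem_nhds (half_pos (sub_pos.2 hab))),
    hCδ.eventually (ge_mem_nhds (by positivity : 0 < c ^ 2 / 6)),
    hCδ.eventually (ge_mem_nhds zero_lt_one)] with n hs hbw h1 h2 s hs' t ht
  have hh := hband.1 n
  obtain ⟨hl0, hlpd⟩ := hloc s hs' (bw n) hh hbw
  obtain ⟨hl0', hlpd'⟩ := hloc t ht (bw n) hh hbw
  have hp0 : 0 ≤ localMoment a b fT K (bw n) 0 t := by
    have := hlpd' 1 0; linarith
  set δ := delta₂ n (m n) (bw n) with hδdef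
  have hδ0 : 0 ≤ δ := Real.sqrt_nonneg _
  have hmul : ∀ {x : ℝ}, |x| ≤ C * (bw n ^ 2 * δ) → |(bw n ^ 2)⁻¹ * x| ≤ C * δ := by
    intro x hx
    have h3 : 0 < bw n ^ 2 := by positivity
    rw [abs_mul, abs_of_pos (inv_pos.2 h3), inv_mul_le_iff₀ h3]
    linarith
  have hmem : ∀ r ≤ 2, ∀ r' ≤ 2, (r, r') ∈ Finset.range 3 ×ˢ Finset.range 3 := fun r hr r' hr' =>
    Finset.mem_product.2 ⟨Finset.mem_range.2 (by omega), Finset.mem_range.2 (by omega)⟩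
  have key := abs_productEstimator_sub_le (n := n) (m := m n) (T := fun i j => T i j ω)
    (Y := observation X ξ T U ω) hK hh (s := s) (t := t)
    (μ := fun r => localMoment a b fT K (bw n) r s) (ν := fun r => localMoment a b fT K (bw n) r t)
    (c := c) (ε := C * δ) (D := C * δ) (R := M * bw n ^ 2) hc hlpd hlpd'
    (fun r hr r' hr' => ?_) (by linarith) (e := fun q => centeredPair Q X ξ T U q.1 q.2 ω)
    (r := fun q => secondMoment Q X (T q.1 q.2.1 ω) (T q.1 q.2.2 ω) - secondMoment Q X s t
      - G₁ s t * (T q.1 q.2.1 ω - s) - G₂ s t * (T q.1 q.2.2 ω - t))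
    (β₀ := secondMoment Q X s t) (β₁ := G₁ s t) (β₂ := G₂ s t)
    (fun i j k => by simp only [centeredPair]; ring)
    (by positivity) (fun r hr r' hr' => ?_)
    (fun i j k hij hik => hG s hs' t ht _ (hTm i j) _ (hTm i k) _ hij hik)
  · refine key.trans ?_
    have h3 : M * bw n ^ 2 * (localMoment a b fT K (bw n) 0 s * localMoment a b fT K (bw n) 0 t
        + C * δ) ≤ M * bw n ^ 2 * (Cm ^ 2 + 1) := by
      rw [sq Cm]
      gcongr
    rw [div_le_iff₀ (by positivity)]
    have h4 : 6 / c ^ 2 * (C + M * (Cm ^ 2 + 1)) * (bw n ^ 2 + δ) * (c ^ 2 / 2)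
        = 3 * (C + M * (Cm ^ 2 + 1)) * (bw n ^ 2 + δ) := by field_simp; ring
    rw [h4]
    have h5 : 0 ≤ C * bw n ^ 2 + M * (Cm ^ 2 + 1) * δ := by positivity
    nlinarith
  · have := hmul (hs (r, r') (hmem r hr r' hr') (s, t) ⟨hs', ht⟩).1
    rwa [mul_sub, inv_mul_cancel_left₀ (pow_pos hh 2).ne'] at this
  · exact hmul (hs (r, r') (hmem r hr r' hr') (s, t) ⟨hs', ht⟩).2

end IsSamplingModel

end Rates

end FunctionalData

theorem theorem3p3 {Ω 𝒳 : Type*} [MeasurableSpace Ω] [MeasurableSpace 𝒳]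
    (P : Measure Ω) [IsProbabilityMeasure P] (Q : Measure 𝒳) [IsProbabilityMeasure Q]
    (a b : ℝ) (hab : a < b)
    (X : 𝒳 → ℝ → ℝ) (fT K : ℝ → ℝ) (ξ : ℕ → Ω → 𝒳) (T U : ℕ → ℕ → Ω → ℝ)
    (m : ℕ → ℕ → ℕ) (hm : ∀ n i, i < n → 2 ≤ m n i)
    (hmodel : FunctionalData.IsSamplingModel P Q a b X fT ξ T U)
    (hdensity : FunctionalData.DensityCondition a b fT)
    (hkernel : FunctionalData.KernelCondition K)
    (hmean : FunctionalData.MeanSmoothness a b (FunctionalData.meanFun Q X))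
    (hcov : FunctionalData.CovSmoothness a b (FunctionalData.covFun Q X))
    (hμ hR : ℕ → ℝ) (lamμ lamR : ℝ) (hlamμ : 2 < lamμ) (hlamR : 2 < lamR)
    (hmomμ : FunctionalData.MomentCondition P Q a b X U lamμ)
    (hbandμ : FunctionalData.MeanBandwidthCondition m hμ lamμ)
    (hmomR : FunctionalData.MomentCondition P Q a b X U (2 * lamR))
    (hbandR : FunctionalData.CovBandwidthCondition m hR lamR) :
    ∀ᵐ ω ∂P, ∃ C : ℝ, ∀ᶠ n : ℕ in atTop,
      (⨆ s ∈ Icc a b, ⨆ t ∈ Icc a b,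
        ‖FunctionalData.covEstimator K (hμ n) (hR n) n (m n) (fun i j => T i j ω)
            (FunctionalData.observation X ξ T U ω) s t - FunctionalData.covFun Q X s t‖ₑ) ≤
      ENNReal.ofReal (C * (hμ n ^ 2 + FunctionalData.delta₁ n (m n) (hμ n) +
        hR n ^ 2 + FunctionalData.delta₂ n (m n) (hR n))) := by
  -- Fourth moments of the envelopes control the second moments of the averages in both smoothers;
  -- `lamμ` governs only the truncation for the mean.
  have hp : 4 ≤ 2 * lamR := by linarith
  obtain ⟨c₀, hc₀, hμ₀, hC₀⟩ := FunctionalData.exists_bound_of_smooth hab hmean hcov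
  have hδ := hbandμ.tendsto_delta hm (by linarith)
  filter_upwards [hmodel.ae_meanEstimator_rate hab hdensity hkernel hmean hp hmomR hlamμ hmomμ hm
    hbandμ hc₀ hμ₀, hmodel.ae_productEstimator_rate hab hdensity hkernel hmean hcov hlamR hmomR hm
    hbandR hc₀ hC₀] with ω ⟨C₁, hC₁, h₁⟩ ⟨C₂, hC₂, h₂⟩
  -- `2 c₀ C₁` from the two terms linear in the mean error, `C₁ * C₁` from their product, where one
  -- factor `ρ` is eventually at most one, and `C₂` from the second moment.
  refine ⟨C₁ * (2 * c₀ + C₁) + C₂, ?_⟩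
  have hsmall : Tendsto (fun n => hμ n ^ 2 + FunctionalData.delta₁ n (m n) (hμ n)) atTop (𝓝 0) := by
    simpa using (hbandμ.2.1.pow 2).add hδ
  filter_upwards [h₁, h₂, hsmall.eventually (ge_mem_nhds zero_lt_one)] with n e₁ e₂ hle
  refine iSup₂_le fun s hs => iSup₂_le fun t ht => ?_
  rw [Real.enorm_eq_ofReal_abs]
  refine ENNReal.ofReal_le_ofReal ?_
  have hδ₁ : 0 ≤ FunctionalData.delta₁ n (m n) (hμ n) := Real.sqrt_nonneg _
  have hδ₂ : 0 ≤ FunctionalData.delta₂ n (m n) (hR n) := Real.sqrt_nonneg _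
  have es := e₁ s hs
  have et := e₁ t ht
  have est := e₂ s hs t ht
  have ms := hμ₀ s hs
  have mt := hμ₀ t ht
  unfold FunctionalData.covEstimator
  set μs := FunctionalData.meanEstimator K (hμ n) n (m n) (fun i j => T i j ω)
    (FunctionalData.observation X ξ T U ω) s
  set μt := FunctionalData.meanEstimator K (hμ n) n (m n) (fun i j => T i j ω)
    (FunctionalData.observation X ξ T U ω) t
  set C' := FunctionalData.productEstimator K (hR n) n (m n) (fun i j => T i j ω)
    (FunctionalData.observation X ξ T U ω) s t
  set ρ := hμ n ^ 2 + FunctionalData.delta₁ n (m n) (hμ n) with hρ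
  have hρ0 : 0 ≤ ρ := by positivity
  have key : C' - μs * μt - FunctionalData.covFun Q X s t
      = (C' - FunctionalData.secondMoment Q X s t)
        - ((μs - FunctionalData.meanFun Q X s) * (μt - FunctionalData.meanFun Q X t)
          + (μs - FunctionalData.meanFun Q X s) * FunctionalData.meanFun Q X t
          + FunctionalData.meanFun Q X s * (μt - FunctionalData.meanFun Q X t)) := by
    unfold FunctionalData.secondMoment; ring
  have b₁ : |(μs - FunctionalData.meanFun Q X s) * (μt - FunctionalData.meanFun Q X t)|
      ≤ C₁ * ρ * (C₁ * 1) := by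
    rw [abs_mul]
    gcongr
    exact et.trans (by gcongr)
  have b₂ : |(μs - FunctionalData.meanFun Q X s) * FunctionalData.meanFun Q X t|
      ≤ C₁ * ρ * c₀ := by
    rw [abs_mul]; gcongr
  have b₃ : |FunctionalData.meanFun Q X s * (μt - FunctionalData.meanFun Q X t)|
      ≤ c₀ * (C₁ * ρ) := by
    rw [abs_mul]; gcongr
  rw [key]
  refine (abs_sub _ _).trans ((add_le_add est ((abs_add_le _ _).trans (add_le_add
    ((abs_add_le _ _).trans (add_le_add b₁ b₂)) b₃))).trans ?_)
  have hn₁ : 0 ≤ C₂ * ρ := by positivity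
  have hn₂ : 0 ≤ C₁ * (2 * c₀ + C₁) * (hR n ^ 2 + FunctionalData.delta₂ n (m n) (hR n)) := by
    positivity
  nlinarith
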